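/- **Setup.** Let $(\mathfrak g,K)$ be a reductive pair: $K$ is a compact Lie group, $\mathfrak g=\mathbf C\otimes\mathfrak g_0$ for a real Lie algebra $\mathfrak g_0$ with an action of $K$, a Cartan involution $\theta$ with fixed algebra $\mathfrak k_0=\operatorname{Lie}K$, and an invariant form, negative definite on the $(+1)$-eigenspace and positive definite on the $(-1)$-eigenspace of $\theta$. Let $\mathfrak q\subseteq\mathfrak g$ be a germane parabolic subalgebra with nilpotent radical $\mathfrak u$ (i.e. $\mathfrak q$ has a Levi factor $\mathfrak l$ that is the complexification of a $\theta$-stable real subalgebra of $\mathfrak g_0$), let $L\cap K$ be the subgroup of $K$ normalizing $\mathfrak q$ and $\theta(\mathfrak q)$ (hence $\mathfrak l$), and let $d=\dim\mathfrak u$. Let $\mathcal C(\mathfrak g,K)$, $\mathcal C(\mathfrak l,L\cap K)$ be the categories of (locally finite) $(\mathfrak g,K)$- and $(\mathfrak l,L\cap K)$-modules. For a module $V$ let $V^*$ be its locally finite dual, and for a $(\mathfrak g,K)$-module let $V'\supseteq V^*$ be its locally $L\cap K$-finite dual, a $(\mathfrak q,L\cap K)$-module. $K(\mathcal C)$ is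 the Grothendieck group of $\mathcal C$. A *$\mathfrak u$-admissible pair* $(\mathcal G,\mathcal L)$ consists of full abelian subcategories $\mathcal G\subseteq\mathcal C(\mathfrak g,K)$, $\mathcal L\subseteq\mathcal C(\mathfrak l,L\cap K)$ (closed under isomorphisms, finite direct sums, kernels and cokernels) such that $\mathbf C\in\mathcal G$; $\bigwedge^q\mathfrak u^*\in\mathcal L$ for all $q$; $\mathcal L$ is closed under tensoring with all $\bigwedge^q\mathfrak u^*$; and $H^q(\mathfrak u;V)\in\mathcal L$ for all $V\in\mathcal G$ and all $q$. It is *multiplicative* if $V,W,V\otimes W\in\mathcal G$ implies $H^p(\mathfrak u;V)\otimes H^q(\mathfrak u;W)\in\mathcal L$ for all $p,q$. It *has duality* if $V,V^*\in\mathcal G$ implies that $H^q(\mathfrak u;V)^*$, $H^q(\mathfrak u;V')$, $H^q(\mathfrak u;V'/V^*)$ lie in $\mathcal L$ for all $q$ and $\sum_q(-1)^q[H^q(\mathfrak u;V'/V^*)]=0$ in $K(\mathcal L)$. Let $H:K(\mathcal G)\to K(\mathcal L)$, $[V]\mapsto\sum_q(-1)^q[H^q(\mathfrak u;V)]$, and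 $W_{\mathfrak q}=\sum_q(-1)^q[\bigwedge^q\mathfrak u^*]$, acting on $K(\mathcal L)$ by tensoring. In $K(\mathcal C)$, for $\mathcal C=\mathcal G$ or $\mathcal L$, products and duals are partially defined: $Z$ is a product $X\cdot Y$ if there are finite expressions $X=\sum a_i[V_i]$, $Y=\sum b_j[W_j]$ (integers $a_i,b_j$, objects $V_i,W_j$ of $\mathcal C$) with all $V_i\otimes W_j\in\mathcal C$ and $Z=\sum a_ib_j[V_i\otimes W_j]$; $Y$ is a dual $X^*$ if $X=\sum a_i[V_i]$ with all $V_i^*\in\mathcal C$ and $Y=\sum a_i[V_i^*]$. They are called well defined if they exist and have only one value. Similarly $R\in K(\mathcal L)$ is a restriction of $X\in K(\mathcal G)$ to $(\mathfrak l,L\cap K)$ if $X=\sum a_i[V_i]$ with all $V_i|_{(\mathfrak l,L\cap K)}\in\mathcal L$ and $R=\sum a_i[V_i|_{(\mathfrak l,L\cap K)}]$. A *$\mathfrak u$-admissible quadruple* $\mathcal Q=(\mathcal G,\mathcal L,K_{\mathcal G},K_{\mathcal L})$ consists of a $\mathfrak u$-admissible pair and subgroups $K_{\mathcal G}\subseteq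 K(\mathcal G)$, $K_{\mathcal L}\subseteq K(\mathcal L)$ with $H(K_{\mathcal G})\subseteq K_{\mathcal L}$ and $W_{\mathfrak q}\cdot K_{\mathcal L}\subseteq K_{\mathcal L}$. It is *multiplicative* if the pair is and $X\cdot Y\in K_{\mathcal G}$ whenever $X,Y\in K_{\mathcal G}$ and $X\cdot Y$ is well defined in $K(\mathcal G)$; it *has duality* if the pair has and $X^*\in K_{\mathcal G}$ whenever $X\in K_{\mathcal G}$ is of finite length (a combination of classes of finite length objects) and $X^*$ is well defined in $K(\mathcal G)$. Let $C_{\mathfrak q}(\mathcal Q)=K_{\mathcal L}[W_{\mathfrak q}^{-1}]\subseteq K(\mathcal L)[W_{\mathfrak q}^{-1}]$. Multiplication of fractions is partially defined by $\frac{S}{W_{\mathfrak q}^m}\cdot\frac{T}{W_{\mathfrak q}^n}=\frac{S\cdot T}{W_{\mathfrak q}^{m+n}}$, and duality by $\left(\frac{S}{W_{\mathfrak q}^n}\right)^*=\frac{S^*}{(W_{\mathfrak q}^*)^n}$, where $\frac1{W_{\mathfrak q}^*}=\frac{(-1)^d[\bigwedge^d\mathfrak u^*]}{W_{\mathfrak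 q}}$. For $X\in K_{\mathcal G}$ put $$c_{\mathfrak q}(X)=\frac{H(X)}{W_{\mathfrak q}}\in C_{\mathfrak q}(\mathcal Q).$$ **Theorem 1.4.** For every $\mathfrak u$-admissible quadruple $\mathcal Q$, the map $c_{\mathfrak q}:K_{\mathcal G}\to C_{\mathfrak q}(\mathcal Q)$ is a group homomorphism with $c_{\mathfrak q}([\mathbf C])=[\mathbf C]=1$ (if $[\mathbf C]\in K_{\mathcal G}$). Moreover: 1. If the restriction $[X]$ of $X\in K_{\mathcal G}$ to $(\mathfrak l,L\cap K)$ lies in $K_{\mathcal L}$, then $c_{\mathfrak q}(X)=[X]$. 2. If $\mathcal Q$ is multiplicative and $X$, $Y$ and a product $X\cdot Y$ lie in $K_{\mathcal G}$, then $c_{\mathfrak q}(X\cdot Y)=c_{\mathfrak q}(X)\cdot c_{\mathfrak q}(Y)$; more precisely, $H(X)$ and $H(Y)$ have a product $S\in K_{\mathcal L}$ with $c_{\mathfrak q}(X\cdot Y)=S/W_{\mathfrak q}^2$. 3. If $\mathcal Q$ has duality and $X$ and a dual $X^*$ lie in $K_{\mathcal G}$, then $c_{\mathfrak q}(X^*)=c_{\mathfrak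 q}(X)^*$; more precisely, $H(X)$ has a dual $T\in K(\mathcal L)$ with $c_{\mathfrak q}(X^*)=(-1)^d[\bigwedge^d\mathfrak u^*]\cdot T/W_{\mathfrak q}$. -/

import Mathlib

open scoped TensorProduct Manifold ContDiff

noncomputable section

namespace AlgChar

universe u v w

/-! ### Reductive pairs -/

/-- A Lie group of class `C^∞` has a Lie algebra in the sense of Mathlib. -/
instance lieGroup_minSmoothness (E : Type w) (K : Type v) [NormedAddCommGroup E] [NormedSpace ℝ E]
    [TopologicalSpace K] [ChartedSpace E K] [Group K] [LieGroup 𝓘(ℝ, E) ∞ K] :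
    LieGroup 𝓘(ℝ, E) (minSmoothness ℝ 3) K := by
  rw [minSmoothness_of_isRCLikeNormedField]
  infer_instance

/-- A reductive pair `(𝔤, K)`: a compact Lie group `K`, a real Lie algebra `𝔤₀` (with
complexification `𝔤 = ℂ ⊗ 𝔤₀`) containing the Lie algebra of `K`, an action `Ad` of `K` on `𝔤₀` by
Lie algebra automorphisms extending the adjoint action of `K` and having differential `ad`,
a Cartan involution `θ` whose fixed space is the Lie algebra of `K`, and a nondegenerate invariant
symmetric bilinear form `B`, negative definite on the `(+1)`-eigenspace and positive definite on
the `(-1)`-eigenspace of `θ`.  (In particular `𝔤₀` is reductive.) -/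
structure ReductivePair (E : Type w) (K : Type v) (𝔤₀ : Type u)
    [NormedAddCommGroup E] [NormedSpace ℝ E] [FiniteDimensional ℝ E]
    [TopologicalSpace K] [ChartedSpace E K] [Group K] [LieGroup 𝓘(ℝ, E) ∞ K]
    [CompactSpace K] [T2Space K]
    [LieRing 𝔤₀] [LieAlgebra ℝ 𝔤₀] [FiniteDimensional ℝ 𝔤₀] where
  /-- the inclusion of the Lie algebra `𝔨₀` of `K` -/
  ι : GroupLieAlgebra 𝓘(ℝ, E) K →ₗ⁅ℝ⁆ 𝔤₀
  ι_injective : Function.Injective ι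
  /-- the adjoint action of `K` on `𝔤₀` -/
  Ad : K →* (𝔤₀ →ₗ[ℝ] 𝔤₀)
  Ad_lie : ∀ k x y, Ad k ⁅x, y⁆ = ⁅Ad k x, Ad k y⁆
  Ad_ι : ∀ (k : K) (X : GroupLieAlgebra 𝓘(ℝ, E) K), Ad k (ι X) =
    ι ((mfderiv 𝓘(ℝ, E) 𝓘(ℝ, E) (fun x : K => k * x * k⁻¹) 1 X : E) : GroupLieAlgebra 𝓘(ℝ, E) K)
  Ad_smooth : ∀ (y : 𝔤₀) (φ : 𝔤₀ →ₗ[ℝ] ℝ),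
    ContMDiff 𝓘(ℝ, E) 𝓘(ℝ, ℝ) ∞ (fun k : K => φ (Ad k y))
  Ad_deriv : ∀ (y : 𝔤₀) (φ : 𝔤₀ →ₗ[ℝ] ℝ) (X : GroupLieAlgebra 𝓘(ℝ, E) K),
    (mfderiv 𝓘(ℝ, E) 𝓘(ℝ, ℝ) (fun k : K => φ (Ad k y)) 1 X : ℝ) = φ ⁅ι X, y⁆
  /-- the Cartan involution -/
  θ : 𝔤₀ →ₗ⁅ℝ⁆ 𝔤₀
  θ_θ : ∀ x, θ (θ x) = x
  range_ι : ∀ x, (∃ X, ι X = x) ↔ θ x = x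
  Ad_θ : ∀ k x, Ad k (θ x) = θ (Ad k x)
  /-- the invariant form -/
  B : LinearMap.BilinForm ℝ 𝔤₀
  B_symm : ∀ x y, B x y = B y x
  B_lie : ∀ x y z, B ⁅x, y⁆ z = B x ⁅y, z⁆
  B_Ad : ∀ k x y, B (Ad k x) (Ad k y) = B x y
  B_θ : ∀ x y, B (θ x) (θ y) = B x y
  B_neg : ∀ x, θ x = x → x ≠ 0 → B x x < 0
  B_pos : ∀ x, θ x = -x → x ≠ 0 → 0 < B x x

section Pairs

variable {E : Type w} {K : Type v} {𝔤₀ : Type u}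
  [NormedAddCommGroup E] [NormedSpace ℝ E] [FiniteDimensional ℝ E]
  [TopologicalSpace K] [ChartedSpace E K] [Group K] [LieGroup 𝓘(ℝ, E) ∞ K]
  [CompactSpace K] [T2Space K]
  [LieRing 𝔤₀] [LieAlgebra ℝ 𝔤₀] [FiniteDimensional ℝ 𝔤₀]

namespace ReductivePair

/-- The `ℂ`-linear extension of a Lie algebra endomorphism to the complexification. -/
def extendC (f : 𝔤₀ →ₗ[ℝ] 𝔤₀) (hf : ∀ x y, f ⁅x, y⁆ = ⁅f x, f y⁆) :
    (ℂ ⊗[ℝ] 𝔤₀) →ₗ⁅ℂ⁆ (ℂ ⊗[ℝ] 𝔤₀) :=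
  { f.baseChange ℂ with
    map_lie' := by
      intro x y
      exact (LieAlgebra.ExtendScalars.map (AlgHom.id ℝ ℂ)
        ({ f with map_lie' := hf _ _ } : 𝔤₀ →ₗ⁅ℝ⁆ 𝔤₀)).map_lie x y }

/-- The adjoint action of `K` on the complexification `𝔤 = ℂ ⊗ 𝔤₀`. -/
def adC (P : ReductivePair E K 𝔤₀) (k : K) : (ℂ ⊗[ℝ] 𝔤₀) →ₗ⁅ℂ⁆ (ℂ ⊗[ℝ] 𝔤₀) :=
  extendC (P.Ad k) (P.Ad_lie k)

/-- The Cartan involution on the complexification (extended `ℂ`-linearly). -/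
def thetaC (P : ReductivePair E K 𝔤₀) : (ℂ ⊗[ℝ] 𝔤₀) →ₗ⁅ℂ⁆ (ℂ ⊗[ℝ] 𝔤₀) :=
  extendC P.θ (fun x y => P.θ.map_lie x y)

theorem adC_tmul (P : ReductivePair E K 𝔤₀) (k : K) (z : ℂ) (x : 𝔤₀) :
    P.adC k (z ⊗ₜ x) = z ⊗ₜ P.Ad k x := rfl

theorem adC_mul (P : ReductivePair E K 𝔤₀) (k l : K) (x : ℂ ⊗[ℝ] 𝔤₀) :
    P.adC (k * l) x = P.adC k (P.adC l x) := by
  induction x with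
  | zero => simp
  | add x y hx hy => simp [hx, hy]
  | tmul z x => simp [adC_tmul]

theorem adC_one (P : ReductivePair E K 𝔤₀) (x : ℂ ⊗[ℝ] 𝔤₀) : P.adC 1 x = x := by
  induction x with
  | zero => simp
  | add x y hx hy => simp [hx, hy]
  | tmul z x => simp [adC_tmul]

/-- The generator in `𝔤` of a one-parameter subgroup of `K`, i.e. its velocity at `0`. -/
def generator (P : ReductivePair E K 𝔤₀) (γ : Multiplicative ℝ →* K) : ℂ ⊗[ℝ] 𝔤₀ :=
  1 ⊗ₜ P.ι ((mfderiv 𝓘(ℝ, ℝ) 𝓘(ℝ, E) (fun t : ℝ => γ (Multiplicative.ofAdd t)) 0 (1 : ℝ) : E) :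
    GroupLieAlgebra 𝓘(ℝ, E) K)

end ReductivePair

/-- A subpair `(𝔰, H)` of `(𝔤, K)`: a complex subalgebra of `𝔤` and a subgroup of `K`
whose adjoint action preserves it. -/
structure Subpair (P : ReductivePair E K 𝔤₀) where
  alg : LieSubalgebra ℂ (ℂ ⊗[ℝ] 𝔤₀)
  grp : Subgroup K
  stable : ∀ k ∈ grp, ∀ x ∈ alg, P.adC k x ∈ alg

/-- The pair `(𝔤, K)` itself. -/
def Subpair.full (P : ReductivePair E K 𝔤₀) : Subpair P where
  alg := ⊤
  grp := ⊤
  stable _ _ _ _ := trivial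

instance (P : ReductivePair E K 𝔤₀) : LE (Subpair P) where
  le p q := p.alg ≤ q.alg ∧ p.grp ≤ q.grp

variable {P : ReductivePair E K 𝔤₀}

theorem Subpair.le_full (p : Subpair P) : p ≤ Subpair.full P := ⟨le_top, le_top⟩

/-- The adjoint action of `H` on `𝔰` for a subpair `(𝔰, H)`. -/
def Subpair.act (p : Subpair P) (k : p.grp) : p.alg →ₗ⁅ℂ⁆ p.alg where
  toFun x := ⟨P.adC k x, p.stable k k.2 x x.2⟩
  map_add' x y := by ext; simp
  map_smul' c x := by ext; simp
  map_lie' := by intro x y; ext; simp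

theorem Subpair.act_mul (p : Subpair P) (k l : p.grp) (x : p.alg) :
    p.act (k * l) x = p.act k (p.act l x) := by
  ext; simp [Subpair.act, P.adC_mul]

theorem Subpair.act_one (p : Subpair P) (x : p.alg) : p.act 1 x = x := by
  ext; simp [Subpair.act, P.adC_one]

/-! ### Modules over a pair -/

/-- A complex vector space with compatible actions of `𝔰` and `H` (no finiteness or continuity
is imposed yet; see `PreModule.IsHC`). -/
structure PreModule (p : Subpair P) where
  V : Type u
  [addCommGroup : AddCommGroup V]
  [module : Module ℂ V]
  lie : p.alg →ₗ[ℂ] Module.End ℂ V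
  lie_lie : ∀ x y v, lie ⁅x, y⁆ v = lie x (lie y v) - lie y (lie x v)
  rep : p.grp →* Module.End ℂ V
  compat : ∀ k x v, rep k (lie x v) = lie (p.act k x) (rep k v)

attribute [instance] PreModule.addCommGroup PreModule.module

namespace PreModule

variable {p : Subpair P}

/-- `(𝔰, H)`-modules: the action of `H` is locally finite and continuous, and its differential
is the given action of the Lie algebra of `H` (expressed through one-parameter subgroups `γ` of
`H` and matrix coefficients). -/
structure IsHC (M : PreModule p) : Prop where
  locallyFinite : ∀ v : M.V,
    FiniteDimensional ℂ (Submodule.span ℂ (Set.range fun k : p.grp => M.rep k v))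
  continuous : ∀ (v : M.V) (φ : M.V →ₗ[ℂ] ℂ), Continuous fun k : p.grp => φ (M.rep k v)
  deriv : ∀ γ : Multiplicative ℝ →* p.grp, Continuous γ →
    ∀ x : p.alg, (x : ℂ ⊗[ℝ] 𝔤₀) = P.generator (p.grp.subtype.comp γ) →
    ∀ (v : M.V) (φ : M.V →ₗ[ℂ] ℂ),
      HasDerivAt (fun t : ℝ => φ (M.rep (γ (Multiplicative.ofAdd t)) v)) (φ (M.lie x v)) 0

/-- A linear map commuting with both actions. -/
structure IsHom (M N : PreModule p) (f : M.V →ₗ[ℂ] N.V) : Prop where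
  lie : ∀ x v, f (M.lie x v) = N.lie x (f v)
  rep : ∀ k v, f (M.rep k v) = N.rep k (f v)

/-- Isomorphism of modules. -/
def Iso (M N : PreModule p) : Prop := ∃ e : M.V ≃ₗ[ℂ] N.V, IsHom M N e.toLinearMap

/-- Stable subspaces. -/
structure IsStable (M : PreModule p) (W : Submodule ℂ M.V) : Prop where
  lie : ∀ x, ∀ v ∈ W, M.lie x v ∈ W
  rep : ∀ k, ∀ v ∈ W, M.rep k v ∈ W

/-- The submodule carried by a stable subspace. -/
def sub (M : PreModule p) (W : Submodule ℂ M.V) (hW : M.IsStable W) : PreModule p where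
  V := W
  lie :=
    { toFun := fun x => (M.lie x).restrict (hW.lie x)
      map_add' := fun x y => by ext; simp
      map_smul' := fun c x => by ext; simp }
  lie_lie x y v := by ext; simp [M.lie_lie]
  rep :=
    { toFun := fun k => (M.rep k).restrict (hW.rep k)
      map_one' := by ext; simp
      map_mul' := fun k l => by ext; simp }
  compat k x v := by ext; simp [M.compat]

/-- The quotient module by a stable subspace. -/
def quot (M : PreModule p) (W : Submodule ℂ M.V) (hW : M.IsStable W) : PreModule p where
  V := M.V ⧸ W
  lie :=
    { toFun := fun x => W.mapQ W (M.lie x) (hW.lie x)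
      map_add' := fun x y => by ext; simp
      map_smul' := fun c x => by ext; simp }
  lie_lie x y v := by
    induction v using Submodule.Quotient.induction_on with
    | H v => simp [M.lie_lie]
  rep :=
    { toFun := fun k => W.mapQ W (M.rep k) (hW.rep k)
      map_one' := by ext; simp
      map_mul' := fun k l => by ext; simp }
  compat k x v := by
    induction v using Submodule.Quotient.induction_on with
    | H v => simp [M.compat]

theorem IsHom.stable_ker {M N : PreModule p} {f : M.V →ₗ[ℂ] N.V} (hf : IsHom M N f) :
    M.IsStable (LinearMap.ker f) where
  lie x v hv := by simp_all [hf.lie]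
  rep k v hv := by simp_all [hf.rep]

theorem IsHom.stable_range {M N : PreModule p} {f : M.V →ₗ[ℂ] N.V} (hf : IsHom M N f) :
    N.IsStable (LinearMap.range f) where
  lie x v := by rintro ⟨w, rfl⟩; exact ⟨M.lie x w, hf.lie x w⟩
  rep k v := by rintro ⟨w, rfl⟩; exact ⟨M.rep k w, hf.rep k w⟩

/-- Direct sum of two modules. -/
def prod (M N : PreModule p) : PreModule p where
  V := M.V × N.V
  lie :=
    { toFun := fun x => (M.lie x).prodMap (N.lie x)
      map_add' := fun x y => by ext <;> simp
      map_smul' := fun c x => by ext <;> simp }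
  lie_lie x y v := by ext <;> simp [M.lie_lie, N.lie_lie]
  rep :=
    { toFun := fun k => (M.rep k).prodMap (N.rep k)
      map_one' := by ext <;> simp
      map_mul' := fun k l => by ext <;> simp }
  compat k x v := by ext <;> simp [M.compat, N.compat]

/-- Tensor product over `ℂ`. -/
def tensor (M N : PreModule p) : PreModule p where
  V := M.V ⊗[ℂ] N.V
  lie :=
    { toFun := fun x => (M.lie x).rTensor N.V + (N.lie x).lTensor M.V
      map_add' := fun x y => by ext; simp; abel
      map_smul' := fun c x => by ext; simp [TensorProduct.smul_tmul'] }
  lie_lie x y v := by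
    induction v with
    | zero => simp
    | add v w hv hw => simp only [map_add, hv, hw]; abel
    | tmul a b =>
      simp [M.lie_lie, N.lie_lie, TensorProduct.sub_tmul, TensorProduct.tmul_sub]; abel
  rep :=
    { toFun := fun k => TensorProduct.map (M.rep k) (N.rep k)
      map_one' := by ext; simp
      map_mul' := fun k l => by ext; simp }
  compat k x v := by
    induction v with
    | zero => simp
    | add v w hv hw => simp only [map_add, hv, hw]
    | tmul a b => simp [M.compat, N.compat]

/-- The trivial one-dimensional module `ℂ`. -/
def triv (p : Subpair P) : PreModule p where
  V := ULift.{u} ℂ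
  lie := 0
  lie_lie x y v := by simp
  rep := 1
  compat k x v := by simp

/-- Restriction to a smaller pair. -/
def res {p q : Subpair P} (h : p ≤ q) (M : PreModule q) : PreModule p where
  V := M.V
  lie := M.lie ∘ₗ (LieSubalgebra.inclusion h.1 : p.alg →ₗ[ℂ] q.alg)
  lie_lie x y v := M.lie_lie (LieSubalgebra.inclusion h.1 x) (LieSubalgebra.inclusion h.1 y) v
  rep := M.rep.comp (Subgroup.inclusion h.2)
  compat k x v := M.compat (Subgroup.inclusion h.2 k) (LieSubalgebra.inclusion h.1 x) v

/-- The full algebraic dual (contragredient action). -/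
def fullDual (M : PreModule p) : PreModule p where
  V := Module.Dual ℂ M.V
  lie :=
    { toFun := fun x => -(Module.Dual.transpose (M.lie x))
      map_add' := fun x y => by ext; simp; abel
      map_smul' := fun c x => by ext; simp }
  lie_lie x y φ := by ext v; simp [Module.Dual.transpose_apply, M.lie_lie]
  rep :=
    { toFun := fun k => Module.Dual.transpose (M.rep k⁻¹)
      map_one' := by ext; simp [Module.Dual.transpose_apply]
      map_mul' := fun k l => by ext; simp [Module.Dual.transpose_apply] }
  compat k x φ := by
    ext v
    have h := M.compat k⁻¹ (p.act k x) v
    rw [← p.act_mul, inv_mul_cancel, p.act_one] at h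
    simp [Module.Dual.transpose_apply, h]

/-- The span of the `H`-orbit of a vector. -/
def orbitSpan (M : PreModule p) (v : M.V) : Submodule ℂ M.V :=
  Submodule.span ℂ (Set.range fun k : p.grp => M.rep k v)

theorem rep_mem_orbitSpan (M : PreModule p) (k : p.grp) (v : M.V) : M.rep k v ∈ M.orbitSpan v :=
  Submodule.subset_span ⟨k, rfl⟩

theorem orbitSpan_le (M : PreModule p) {v : M.V} {W : Submodule ℂ M.V}
    (h : ∀ k, M.rep k v ∈ W) : M.orbitSpan v ≤ W := by
  refine Submodule.span_le.2 ?_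
  rintro _ ⟨k, rfl⟩
  exact h k

/-- The subspace of `H`-finite vectors. -/
def finiteVectors (M : PreModule p) : Submodule ℂ M.V where
  carrier := {v | FiniteDimensional ℂ (M.orbitSpan v)}
  zero_mem' := Submodule.finiteDimensional_of_le (S₂ := ⊥) (M.orbitSpan_le (by simp))
  add_mem' := by
    intro a b (ha : FiniteDimensional ℂ (M.orbitSpan a)) (hb : FiniteDimensional ℂ (M.orbitSpan b))
    refine Submodule.finiteDimensional_of_le (S₂ := M.orbitSpan a ⊔ M.orbitSpan b)
      (M.orbitSpan_le fun k => ?_)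
    rw [map_add]
    exact Submodule.add_mem_sup (M.rep_mem_orbitSpan k a) (M.rep_mem_orbitSpan k b)
  smul_mem' := by
    intro c a (ha : FiniteDimensional ℂ (M.orbitSpan a))
    refine Submodule.finiteDimensional_of_le (S₂ := M.orbitSpan a) (M.orbitSpan_le fun k => ?_)
    rw [map_smul]
    exact Submodule.smul_mem _ _ (M.rep_mem_orbitSpan k a)

theorem stable_finiteVectors (M : PreModule p) : M.IsStable M.finiteVectors where
  lie x v hv := by
    have hv' : FiniteDimensional ℂ (M.orbitSpan v) := hv
    have : FiniteDimensional ℂ (Submodule.map₂ M.lie ⊤ (M.orbitSpan v)) :=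
      Module.Finite.iff_fg.2 (Submodule.FG.map₂ _ Module.Finite.fg_top (Module.Finite.iff_fg.1 hv'))
    refine Submodule.finiteDimensional_of_le (M.orbitSpan_le fun k => ?_) (S₂ := Submodule.map₂ M.lie ⊤ (M.orbitSpan v))
    rw [M.compat]
    exact Submodule.apply_mem_map₂ _ trivial (M.rep_mem_orbitSpan k v)
  rep k v hv := by
    have hv' : FiniteDimensional ℂ (M.orbitSpan v) := hv
    refine Submodule.finiteDimensional_of_le (M.orbitSpan_le fun l => ?_) (S₂ := M.orbitSpan v)
    rw [← Module.End.mul_apply, ← map_mul]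
    exact M.rep_mem_orbitSpan _ v

/-- The locally `H`-finite dual of an `(𝔰, H)`-module. -/
def dual (M : PreModule p) : PreModule p :=
  M.fullDual.sub M.fullDual.finiteVectors M.fullDual.stable_finiteVectors

/-- Finite length: chains of submodules have bounded length. -/
def FiniteLength (M : PreModule p) : Prop :=
  ∃ n : ℕ, ∀ s : LTSeries {W : Submodule ℂ M.V // M.IsStable W}, s.length ≤ n

end PreModule

end Pairs

/-! ### Alternating maps and derivations -/

section AltDeriv

variable {U V : Type*} [AddCommGroup U] [Module ℂ U] [AddCommGroup V] [Module ℂ V] {n : ℕ}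

/-- The derivation of alternating forms induced by an endomorphism `T` of the source:
`(x₁, …, xₙ) ↦ ∑ₖ f (x₁, …, T xₖ, …, xₙ)`. -/
def altDeriv (T : U →ₗ[ℂ] U) (f : U [⋀^Fin n]→ₗ[ℂ] V) : U [⋀^Fin n]→ₗ[ℂ] V where
  toMultilinearMap := ∑ k : Fin n,
    f.toMultilinearMap.compLinearMap (Function.update (fun _ => LinearMap.id) k T)
  map_eq_zero_of_eq' := by
    intro v i j hv hij
    have key : ∀ k : Fin n, (f.toMultilinearMap.compLinearMap
        (Function.update (fun _ => LinearMap.id) k T)) v = f (Function.update v k (T (v k))) := by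
      intro k
      rw [MultilinearMap.compLinearMap_apply]
      change f _ = f _
      congr 1; ext l
      rcases eq_or_ne l k with rfl | h <;> simp [*]
    suffices ∑ k : Fin n, f (Function.update v k (T (v k))) = 0 by
      simpa [_root_.sum_apply, key] using this
    rw [Fintype.sum_eq_add i j hij]
    · have := f.map_swap (Function.update v i (T (v i))) hij
      rw [← neg_eq_iff_eq_neg] at this
      rw [← this, hv]
      have e : (Function.update v i (T (v j)) ∘ Equiv.swap i j) = Function.update v j (T (v j)) := by
        ext l
        rcases eq_or_ne l i with rfl | hi
        · simp [hij, hij.symm, hv]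
        · rcases eq_or_ne l j with rfl | hj
          · simp
          · simp [Equiv.swap_apply_of_ne_of_ne hi hj, hi, hj]
      rw [e]; simp
    · rintro k ⟨hi, hj⟩
      exact f.map_eq_zero_of_eq _ (i := i) (j := j) (by simp [hi.symm, hj.symm, hv]) hij

theorem altDeriv_apply (T : U →ₗ[ℂ] U) (f : U [⋀^Fin n]→ₗ[ℂ] V) (v : Fin n → U) :
    altDeriv T f v = ∑ k, f (Function.update v k (T (v k))) := by
  have key : ∀ k : Fin n, (f.toMultilinearMap.compLinearMap
      (Function.update (fun _ => LinearMap.id) k T)) v = f (Function.update v k (T (v k))) := by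
    intro k
    rw [MultilinearMap.compLinearMap_apply]
    change f _ = f _
    congr 1; ext l
    rcases eq_or_ne l k with rfl | h <;> simp [*]
  change (∑ k : Fin n, f.toMultilinearMap.compLinearMap
    (Function.update (fun _ => LinearMap.id) k T)) v = _
  simp [key]

/-- `altDeriv` as a bilinear map. -/
def altDerivLM : (U →ₗ[ℂ] U) →ₗ[ℂ] (U [⋀^Fin n]→ₗ[ℂ] V) →ₗ[ℂ] (U [⋀^Fin n]→ₗ[ℂ] V) :=
  LinearMap.mk₂ ℂ altDeriv
    (fun T T' f => by ext v; simp [altDeriv_apply, Finset.sum_add_distrib])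
    (fun c T f => by ext v; simp [altDeriv_apply, Finset.smul_sum])
    (fun T f g => by ext v; simp [altDeriv_apply, Finset.sum_add_distrib])
    (fun c T f => by ext v; simp [altDeriv_apply, Finset.smul_sum])

@[simp] theorem altDerivLM_apply (T : U →ₗ[ℂ] U) (f : U [⋀^Fin n]→ₗ[ℂ] V) :
    altDerivLM T f = altDeriv T f := rfl

theorem altDeriv_altDeriv_sub (S T : U →ₗ[ℂ] U) (f : U [⋀^Fin n]→ₗ[ℂ] V) :
    altDeriv S (altDeriv T f) - altDeriv T (altDeriv S f) = altDeriv (T ∘ₗ S - S ∘ₗ T) f := by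
  have key : ∀ (S T : U →ₗ[ℂ] U) (v : Fin n → U), altDeriv S (altDeriv T f) v =
      (∑ k, f (Function.update v k (T (S (v k))))) +
      ∑ k, ∑ l, if l = k then 0 else
        f (Function.update (Function.update v k (S (v k))) l (T (v l))) := by
    intro S T v
    simp only [altDeriv_apply, ← Finset.sum_add_distrib]
    refine Finset.sum_congr rfl fun k _ => ?_
    rw [Finset.sum_eq_add_sum_sdiff_singleton_of_mem (Finset.mem_univ k),
      Finset.sum_eq_add_sum_sdiff_singleton_of_mem (Finset.mem_univ k) (f := fun l => ite _ _ _)]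
    simp only [Function.update_self, Function.update_idem, if_true, zero_add]
    congr 1
    refine Finset.sum_congr rfl fun l hl => ?_
    have hl : l ≠ k := by simpa using hl
    simp [hl]
  ext v
  rw [AlternatingMap.sub_apply, key, key, altDeriv_apply]
  have sw : (∑ k, ∑ l, if l = k then 0 else
        f (Function.update (Function.update v k (S (v k))) l (T (v l)))) =
      ∑ k, ∑ l, if l = k then 0 else
        f (Function.update (Function.update v k (T (v k))) l (S (v l))) := by
    rw [Finset.sum_comm]
    refine Finset.sum_congr rfl fun k _ => Finset.sum_congr rfl fun l _ => ?_
    rcases eq_or_ne k l with rfl | h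
    · simp
    · rw [if_neg h, if_neg h.symm, Function.update_comm h.symm]
  rw [sw, add_sub_add_right_eq_sub, ← Finset.sum_sub_distrib]
  refine Finset.sum_congr rfl fun k _ => ?_
  simp [← AlternatingMap.map_update_sub]

theorem altDeriv_compAlternatingMap {V' : Type*} [AddCommGroup V'] [Module ℂ V']
    (T : U →ₗ[ℂ] U) (g : V →ₗ[ℂ] V') (f : U [⋀^Fin n]→ₗ[ℂ] V) :
    altDeriv T (g.compAlternatingMap f) = g.compAlternatingMap (altDeriv T f) := by
  ext v; simp [altDeriv_apply]

theorem altDeriv_compLinearMap (T A A' : U →ₗ[ℂ] U) (h : A ∘ₗ T = A' ∘ₗ A)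
    (f : U [⋀^Fin n]→ₗ[ℂ] V) :
    altDeriv T (f.compLinearMap A) = (altDeriv A' f).compLinearMap A := by
  ext v
  simp only [altDeriv_apply, AlternatingMap.compLinearMap_apply]
  refine Finset.sum_congr rfl fun k _ => congrArg f ?_
  ext l
  rcases eq_or_ne l k with rfl | hl
  · simpa using LinearMap.congr_fun h (v l)
  · simp [hl]

open AlternatingMap in
theorem altDeriv_alternatize (T : U →ₗ[ℂ] U) (g : U →ₗ[ℂ] U [⋀^Fin n]→ₗ[ℂ] V) :
    altDeriv T (alternatizeUncurryFin g) =
      alternatizeUncurryFin (g ∘ₗ T + altDerivLM T ∘ₗ g) := by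
  ext v
  simp only [altDeriv_apply, alternatizeUncurryFin_apply]
  rw [Finset.sum_comm]
  refine Finset.sum_congr rfl fun i _ => ?_
  rw [← Finset.smul_sum, Fin.sum_univ_succAbove _ i]
  congr 1
  simp only [Function.update_self, LinearMap.add_apply, LinearMap.comp_apply, altDerivLM_apply,
    AlternatingMap.add_apply, altDeriv_apply]
  congr 1
  · congr 1; ext k; simp [Fin.removeNth]
  · refine Finset.sum_congr rfl fun k _ => ?_
    rw [Function.update_of_ne (Fin.succAbove_ne i k).symm]
    congr 1
    ext l
    rcases eq_or_ne l k with rfl | hl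
    · simp [Fin.removeNth]
    · simp [Fin.removeNth, hl]

open AlternatingMap in
theorem curryLeft_alternatize (g : U →ₗ[ℂ] U [⋀^Fin (n + 1)]→ₗ[ℂ] V) (x : U) :
    (alternatizeUncurryFin g).curryLeft x = g x -
      alternatizeUncurryFin ((curryLeftLinearMap.flip x) ∘ₗ g) := by
  ext v
  rw [curryLeft_apply_apply, alternatizeUncurryFin_apply, Fin.sum_univ_succ]
  simp only [AlternatingMap.sub_apply, alternatizeUncurryFin_apply, LinearMap.comp_apply]
  rw [sub_eq_add_neg, ← Finset.sum_neg_distrib]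
  congr 1
  · simp
  · refine Finset.sum_congr rfl fun i _ => ?_
    have : i.succ.removeNth (Matrix.vecCons x v) = Matrix.vecCons x (i.removeNth v) := by
      ext l
      refine Fin.cases ?_ (fun l => ?_) l <;> simp [Fin.removeNth]
    rw [this, Fin.val_succ, pow_succ]
    simp

open AlternatingMap in
theorem altDeriv_eq_alternatize (T : U →ₗ[ℂ] U) (f : U [⋀^Fin (n + 1)]→ₗ[ℂ] V) :
    altDeriv T f = alternatizeUncurryFin (f.curryLeft ∘ₗ T) := by
  ext v
  simp only [altDeriv_apply, alternatizeUncurryFin_apply, LinearMap.comp_apply,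
    curryLeft_apply_apply]
  refine Finset.sum_congr rfl fun i _ => ?_
  have := neg_one_pow_smul_map_insertNth f i (T (v i)) (i.removeNth v)
  rw [← this, Fin.insertNth_removeNth]
  simp [smul_smul, ← mul_pow]

theorem curryLeft_altDeriv (T : U →ₗ[ℂ] U) (f : U [⋀^Fin (n + 1)]→ₗ[ℂ] V) (x : U) :
    (altDeriv T f).curryLeft x = altDeriv T (f.curryLeft x) + f.curryLeft (T x) := by
  ext v
  simp only [AlternatingMap.curryLeft_apply_apply, altDeriv_apply, AlternatingMap.add_apply]
  rw [Fin.sum_univ_succ, add_comm]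
  congr 1
  · refine Finset.sum_congr rfl fun k _ => ?_
    congr 1
    simp [Matrix.vecCons]
  · congr 1
    simp [Matrix.vecCons]

end AltDeriv

/-! ### The standard complex of an ideal -/

namespace CE

variable {L V : Type*} [LieRing L] [LieAlgebra ℂ L] {I : LieIdeal ℂ L}
  [AddCommGroup V] [Module ℂ V]

variable (I) in
/-- The adjoint action of `L` on an ideal. -/
def ad : L →ₗ[ℂ] I →ₗ[ℂ] I :=
  LinearMap.mk₂ ℂ (fun x y => ⁅x, y⁆) (by simp) (by simp) (by simp) (by simp)

@[simp] theorem ad_apply (x : L) (y : I) : ad I x y = ⁅x, y⁆ := rfl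

theorem ad_lie (x y : L) : ad I y ∘ₗ ad I x - ad I x ∘ₗ ad I y = - ad I ⁅x, y⁆ := by
  ext z; simp

variable (ρ : L →ₗ[ℂ] Module.End ℂ V) (n : ℕ)

variable (I) in
/-- The natural action of `L` on `V`-valued alternating forms on an ideal `I`. -/
def act : L →ₗ[ℂ] Module.End ℂ (I [⋀^Fin n]→ₗ[ℂ] V) :=
  LinearMap.mk₂ ℂ (fun x f => (ρ x).compAlternatingMap f - altDeriv (ad I x) f)
    (fun x y f => by ext v; simp [← altDerivLM_apply]; abel)
    (fun c x f => by ext v; simp [← altDerivLM_apply, smul_sub])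
    (fun x f g => by ext v; simp [altDeriv_apply, Finset.sum_add_distrib]; abel)
    (fun c x f => by ext v; simp [altDeriv_apply, Finset.smul_sum, smul_sub])

theorem act_apply (x : L) (f : I [⋀^Fin n]→ₗ[ℂ] V) :
    act I ρ n x f = (ρ x).compAlternatingMap f - altDeriv (ad I x) f := rfl

theorem altDeriv_ad_lie (x y : L) (f : I [⋀^Fin n]→ₗ[ℂ] V) : altDeriv (ad I ⁅x, y⁆) f =
    altDeriv (ad I y) (altDeriv (ad I x) f) - altDeriv (ad I x) (altDeriv (ad I y) f) := by
  have h := altDeriv_altDeriv_sub (ad I x) (ad I y) f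
  rw [ad_lie, ← altDerivLM_apply (-_), map_neg, LinearMap.neg_apply, altDerivLM_apply] at h
  rw [← neg_sub, h, neg_neg]

theorem act_lie (hρ : ∀ x y v, ρ ⁅x, y⁆ v = ρ x (ρ y v) - ρ y (ρ x v)) (x y : L) (f : I [⋀^Fin n]→ₗ[ℂ] V) :
    act I ρ n ⁅x, y⁆ f = act I ρ n x (act I ρ n y f) - act I ρ n y (act I ρ n x f) := by
  simp only [act_apply, altDeriv_ad_lie, map_sub, altDeriv_compAlternatingMap]
  ext v
  simp only [AlternatingMap.sub_apply, LinearMap.compAlternatingMap_apply, hρ]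
  abel

/-- `x ↦ (x acting on the values of f)`, for `x ∈ I`. -/
def valueAct (f : I [⋀^Fin n]→ₗ[ℂ] V) : I →ₗ[ℂ] I [⋀^Fin n]→ₗ[ℂ] V where
  toFun x := (ρ x).compAlternatingMap f
  map_add' x y := by ext v; simp
  map_smul' c x := by ext v; simp

/-- `x ↦ (x acting on the arguments of f)`, for `x ∈ I`. -/
def argAct (f : I [⋀^Fin n]→ₗ[ℂ] V) : I →ₗ[ℂ] I [⋀^Fin n]→ₗ[ℂ] V where
  toFun x := altDeriv (ad I x) f
  map_add' x y := by simp [← altDerivLM_apply]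
  map_smul' c x := by simp [← altDerivLM_apply]

@[simp] theorem valueAct_apply (f : I [⋀^Fin n]→ₗ[ℂ] V) (x : I) :
    valueAct ρ n f x = (ρ x).compAlternatingMap f := rfl

@[simp] theorem argAct_apply (f : I [⋀^Fin n]→ₗ[ℂ] V) (x : I) :
    argAct n f x = altDeriv (ad I x) f := rfl

open AlternatingMap

/-- The differential of the standard (Chevalley–Eilenberg) complex `Hom(⋀^• I, V)`; the usual
explicit formula is `d_apply_zero`, `d_apply_succ` below. -/
def d : (I [⋀^Fin n]→ₗ[ℂ] V) →ₗ[ℂ] (I [⋀^Fin (n + 1)]→ₗ[ℂ] V) where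
  toFun f := alternatizeUncurryFin (valueAct ρ n f) -
    (1 / 2 : ℂ) • alternatizeUncurryFin (argAct n f)
  map_add' f g := by
    have h1 : valueAct ρ n (f + g) = valueAct ρ n f + valueAct ρ n g := by ext; simp
    have h2 : argAct n (f + g) = argAct n f + argAct n g := by
      ext1 x; simp only [argAct_apply, ← altDerivLM_apply, map_add, LinearMap.add_apply]
    rw [h1, h2, alternatizeUncurryFin_add, alternatizeUncurryFin_add, smul_add]; abel
  map_smul' c f := by
    have h1 : valueAct ρ n (c • f) = c • valueAct ρ n f := by ext; simp
    have h2 : argAct n (c • f) = c • argAct n f := by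
      ext1 x; simp only [argAct_apply, ← altDerivLM_apply, map_smul, LinearMap.smul_apply]
    rw [h1, h2, alternatizeUncurryFin_smul, alternatizeUncurryFin_smul, smul_comm (1 / 2 : ℂ) c]
    simp [smul_sub]

theorem d_eq (f : I [⋀^Fin n]→ₗ[ℂ] V) : d ρ n f =
    alternatizeUncurryFin (valueAct ρ n f) - (1 / 2 : ℂ) • alternatizeUncurryFin (argAct n f) :=
  rfl

theorem d_apply_zero (f : I [⋀^Fin 0]→ₗ[ℂ] V) (v : Fin 1 → I) :
    d ρ 0 f v = ρ (v 0) (f ![]) := by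
  simp [d_eq, alternatizeUncurryFin_apply, altDeriv_apply]
  congr 2; ext i; exact i.elim0

/-- The standard formula `(df)(v₀, …, vₙ₊₁) = ∑ᵢ (-1)ⁱ vᵢ f(v₀, …, v̂ᵢ, …, vₙ₊₁)
+ ∑_{i < j'} (-1)^{i + j'} f([vᵢ, vⱼ'], v₀, …, v̂ᵢ, …, v̂ⱼ', …, vₙ₊₁)`, with `j' = j + 1`. -/
theorem d_apply_succ (f : I [⋀^Fin (n + 1)]→ₗ[ℂ] V) (v : Fin (n + 2) → I) :
    d ρ (n + 1) f v =
      ∑ i : Fin (n + 2), (-1 : ℤ) ^ (i : ℕ) • ρ (v i) (f (i.removeNth v)) +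
      ∑ i : Fin (n + 1), ∑ j ≥ i, (-1 : ℤ) ^ (i + (j + 1) : ℕ) •
        f (Matrix.vecCons ⁅v i.castSucc, v j.succ⁆ (j.removeNth (i.castSucc.removeNth v))) := by
  let g : I →ₗ[ℂ] I →ₗ[ℂ] I [⋀^Fin n]→ₗ[ℂ] V :=
    LinearMap.mk₂ ℂ (fun x y => f.curryLeft ⁅x, y⁆) (by simp) (by simp) (by simp) (by simp)
  have e : argAct (n + 1) f = alternatizeUncurryFinLM ∘ₗ g := by
    ext1 x
    rw [argAct_apply, altDeriv_eq_alternatize]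
    rfl
  have hg : ∀ x y v, g x y v = f (Matrix.vecCons ⁅x, y⁆ v) := fun _ _ _ => rfl
  rw [d_eq, e, AlternatingMap.sub_apply, AlternatingMap.smul_apply,
    alternatizeUncurryFin_alternatizeUncurryFinLM_comp_apply, alternatizeUncurryFin_apply,
    sub_eq_add_neg, ← smul_neg]
  congr 1
  simp only [Finset.smul_sum, ← Finset.sum_neg_distrib]
  refine Finset.sum_congr rfl fun i _ => Finset.sum_congr rfl fun j _ => ?_
  have : ∀ w, f (Matrix.vecCons ⁅v j.succ, v i.castSucc⁆ w) =
      - f (Matrix.vecCons ⁅v i.castSucc, v j.succ⁆ w) := by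
    intro w
    rw [← lie_skew, ← neg_one_smul ℂ, f.map_vecCons_smul]; simp
  rw [hg, hg, this, sub_neg_eq_add, ← two_smul ℂ, smul_comm ((-1 : ℤ) ^ _) (2 : ℂ), ← smul_neg,
    smul_smul, ← add_assoc, pow_succ]
  simp

/-- Commutation of the action of `L` with alternatization. -/
theorem act_alternatize (x : L) (g : I →ₗ[ℂ] I [⋀^Fin n]→ₗ[ℂ] V)
    (g' : I →ₗ[ℂ] I [⋀^Fin n]→ₗ[ℂ] V)
    (h : ∀ y, act I ρ n x (g y) - g ⁅x, y⁆ = g' y) :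
    act I ρ (n + 1) x (alternatizeUncurryFin g) = alternatizeUncurryFin g' := by
  rw [act_apply, altDeriv_alternatize]
  ext v
  simp only [AlternatingMap.sub_apply, LinearMap.compAlternatingMap_apply,
    alternatizeUncurryFin_apply, ← h, act_apply, map_sum, ← Finset.sum_sub_distrib]
  refine Finset.sum_congr rfl fun i _ => ?_
  simp [smul_sub, smul_add, map_zsmul]
  abel

theorem d_act (hρ : ∀ x y v, ρ ⁅x, y⁆ v = ρ x (ρ y v) - ρ y (ρ x v)) (x : L) (f : I [⋀^Fin n]→ₗ[ℂ] V) :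
    d ρ n (act I ρ n x f) = act I ρ (n + 1) x (d ρ n f) := by
  rw [d_eq, d_eq, map_sub, map_smul]
  congr 1
  · symm
    refine act_alternatize ρ n x _ _ fun y => ?_
    ext v
    simp only [act_apply, valueAct_apply, altDeriv_compAlternatingMap]
    simp [hρ]
  · congr 1; symm
    refine act_alternatize ρ n x _ _ fun y => ?_
    simp only [act_apply, argAct_apply]
    rw [LieSubmodule.coe_bracket, altDeriv_ad_lie, ← altDerivLM_apply (ad I y) (_ - _), map_sub]
    simp only [altDerivLM_apply, altDeriv_compAlternatingMap]
    abel

/-- Cartan's formula, `ι_x d = L_x - d ι_x`. -/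
theorem curryLeft_d (f : I [⋀^Fin (n + 1)]→ₗ[ℂ] V) (x : I) :
    (d ρ (n + 1) f).curryLeft x = act I ρ (n + 1) x f - d ρ n (f.curryLeft x) := by
  have h0 : (d ρ (n + 1) f).curryLeft x =
    (alternatizeUncurryFin (valueAct ρ (n + 1) f)).curryLeft x -
      (1 / 2 : ℂ) • (alternatizeUncurryFin (argAct (n + 1) f)).curryLeft x := by
    rw [d_eq]; ext v; simp
  rw [h0, curryLeft_alternatize, curryLeft_alternatize, d_eq, act_apply, argAct_apply,
    valueAct_apply]
  have h1 : curryLeftLinearMap.flip x ∘ₗ valueAct ρ (n + 1) f = valueAct ρ n (f.curryLeft x) := by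
    ext y v; simp
  have h2 : curryLeftLinearMap.flip x ∘ₗ argAct (n + 1) f =
      argAct n (f.curryLeft x) - f.curryLeft ∘ₗ ad I x := by
    ext1 y
    have := curryLeft_altDeriv (ad I y) f x
    simp only [LinearMap.comp_apply, argAct_apply, LinearMap.flip_apply,
      curryLeftLinearMap_apply, LinearMap.sub_apply, this]
    rw [sub_eq_add_neg, ← map_neg]
    congr 2
    ext; simp
  have h3 : alternatizeUncurryFin (argAct n (f.curryLeft x) - f.curryLeft ∘ₗ ad I x) =
      alternatizeUncurryFin (argAct n (f.curryLeft x)) - altDeriv (ad I x) f := by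
    rw [altDeriv_eq_alternatize, ← alternatizeUncurryFinLM_apply, map_sub]; rfl
  rw [h1, h2, h3]
  module

theorem curryLeft_d_zero (f : I [⋀^Fin 0]→ₗ[ℂ] V) (x : I) :
    (d ρ 0 f).curryLeft x = act I ρ 0 x f := by
  ext v
  rw [curryLeft_apply_apply, d_apply_zero, act_apply]
  simp [altDeriv_apply]
  congr 2; ext i; exact i.elim0

theorem ext_curryLeft {U V : Type*} [AddCommGroup U] [Module ℂ U] [AddCommGroup V] [Module ℂ V]
    {n : ℕ} {f g : U [⋀^Fin (n + 1)]→ₗ[ℂ] V} (h : ∀ x, f.curryLeft x = g.curryLeft x) : f = g := by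
  ext v
  have := DFunLike.congr_fun (h (v 0)) (fun i => v i.succ)
  simp only [curryLeft_apply_apply] at this
  convert this <;> exact (Fin.cons_self_tail v).symm

theorem d_d (hρ : ∀ x y v, ρ ⁅x, y⁆ v = ρ x (ρ y v) - ρ y (ρ x v)) : ∀ (n : ℕ) (f : I [⋀^Fin n]→ₗ[ℂ] V), d ρ (n + 1) (d ρ n f) = 0
  | 0, f => ext_curryLeft fun x => by
      rw [curryLeft_d, curryLeft_d_zero, d_act ρ 0 hρ, sub_self]; rfl
  | n + 1, f => ext_curryLeft fun x => by
      rw [curryLeft_d, curryLeft_d, map_sub, d_act ρ _ hρ, d_d hρ n, sub_zero, sub_self]; rfl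

/-- Pull back along `a` and push forward along `r`. -/
def twist (a : I →ₗ[ℂ] I) (r : Module.End ℂ V) : Module.End ℂ (I [⋀^Fin n]→ₗ[ℂ] V) where
  toFun f := r.compAlternatingMap (f.compLinearMap a)
  map_add' f g := by ext v; simp
  map_smul' c f := by ext v; simp

theorem twist_apply (a : I →ₗ[ℂ] I) (r : Module.End ℂ V) (f : I [⋀^Fin n]→ₗ[ℂ] V) :
    twist n a r f = r.compAlternatingMap (f.compLinearMap a) := rfl

theorem twist_act (a : I →ₗ[ℂ] I) (r : Module.End ℂ V) (x x' : L)
    (ha : a ∘ₗ ad I x' = ad I x ∘ₗ a) (hr : ∀ v, r (ρ x v) = ρ x' (r v))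
    (f : I [⋀^Fin n]→ₗ[ℂ] V) : twist n a r (act I ρ n x f) = act I ρ n x' (twist n a r f) := by
  simp only [twist_apply, act_apply, altDeriv_compAlternatingMap,
    altDeriv_compLinearMap _ _ _ ha]
  ext v
  simp [hr]

theorem d_twist (a : I →ₗ[ℂ] I) (r : Module.End ℂ V)
    (ha : ∀ y : I, a ∘ₗ ad I y = ad I (a y) ∘ₗ a) (hr : ∀ (y : I) v, r (ρ (a y) v) = ρ y (r v))
    (f : I [⋀^Fin n]→ₗ[ℂ] V) : d ρ n (twist n a r f) = twist (n + 1) a r (d ρ n f) := by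
  ext v
  simp only [d_eq, twist_apply, AlternatingMap.sub_apply, AlternatingMap.smul_apply,
    alternatizeUncurryFin_apply, LinearMap.compAlternatingMap_apply,
    AlternatingMap.compLinearMap_apply, map_sub, map_smul, map_sum, map_zsmul]
  congr 1
  · refine Finset.sum_congr rfl fun i _ => ?_
    simp only [valueAct_apply, LinearMap.compAlternatingMap_apply, hr]
    rfl
  · congr 1
    refine Finset.sum_congr rfl fun i _ => ?_
    rw [argAct_apply, argAct_apply, altDeriv_compAlternatingMap,
      altDeriv_compLinearMap _ _ _ (ha (v i))]
    rfl

theorem act_comp {V' : Type*} [AddCommGroup V'] [Module ℂ V'] (ρ' : L →ₗ[ℂ] Module.End ℂ V')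
    (g : V →ₗ[ℂ] V') (x : L) (hg : ∀ v, g (ρ x v) = ρ' x (g v)) (f : I [⋀^Fin n]→ₗ[ℂ] V) :
    g.compAlternatingMap (act I ρ n x f) = act I ρ' n x (g.compAlternatingMap f) := by
  ext v
  simp [act_apply, altDeriv_compAlternatingMap, hg]

theorem d_comp {V' : Type*} [AddCommGroup V'] [Module ℂ V'] (ρ' : L →ₗ[ℂ] Module.End ℂ V')
    (g : V →ₗ[ℂ] V') (hg : ∀ x v, g (ρ x v) = ρ' x (g v)) (f : I [⋀^Fin n]→ₗ[ℂ] V) :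
    g.compAlternatingMap (d ρ n f) = d ρ' n (g.compAlternatingMap f) := by
  ext v
  simp only [d_eq, AlternatingMap.sub_apply, AlternatingMap.smul_apply,
    alternatizeUncurryFin_apply, LinearMap.compAlternatingMap_apply, map_sub, map_smul, map_sum,
    map_zsmul, valueAct_apply, argAct_apply, altDeriv_compAlternatingMap, hg]

end CE

/-! ### Cohomology of the nilpotent radical -/

section Cohomology

variable {E : Type w} {K : Type v} {𝔤₀ : Type u}
  [NormedAddCommGroup E] [NormedSpace ℝ E] [FiniteDimensional ℝ E]
  [TopologicalSpace K] [ChartedSpace E K] [Group K] [LieGroup 𝓘(ℝ, E) ∞ K]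
  [CompactSpace K] [T2Space K]
  [LieRing 𝔤₀] [LieAlgebra ℝ 𝔤₀] [FiniteDimensional ℝ 𝔤₀]
  {P : ReductivePair E K 𝔤₀}

/-- The nilpotent radical `[𝔰, rad 𝔰]` of a Lie algebra `𝔰`. For a parabolic subalgebra
`𝔮 = 𝔩 ⊕ 𝔲` of a reductive Lie algebra, this is `𝔲`. -/
abbrev nilpotentRadical (L : Type*) [LieRing L] [LieAlgebra ℂ L] : LieIdeal ℂ L :=
  ⁅(⊤ : LieIdeal ℂ L), LieAlgebra.radical ℂ L⁆

/-- The nilpotent radical of the Lie algebra of a pair. -/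
def Subpair.nilRad (p : Subpair P) : LieIdeal ℂ p.alg := nilpotentRadical p.alg

theorem Subpair.act_surjective (p : Subpair P) (k : p.grp) : Function.Surjective (p.act k) :=
  fun x => ⟨p.act k⁻¹ x, by rw [← p.act_mul, mul_inv_cancel, p.act_one]⟩

theorem Subpair.act_mem_nilRad (p : Subpair P) (k : p.grp) {x : p.alg} (hx : x ∈ p.nilRad) :
    p.act k x ∈ p.nilRad := by
  have hrad : (LieAlgebra.radical ℂ p.alg).map (p.act k) ≤ LieAlgebra.radical ℂ p.alg := by
    rw [← LieAlgebra.LieIdeal.solvable_iff_le_radical]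
    let f : LieAlgebra.radical ℂ p.alg →ₗ⁅ℂ⁆ ((LieAlgebra.radical ℂ p.alg).map (p.act k)) :=
      { toFun := fun x => ⟨p.act k x, LieIdeal.mem_map x.2⟩
        map_add' := fun x y => by ext; simp
        map_smul' := fun c x => by ext; simp
        map_lie' := by intro x y; ext; simp }
    refine Function.Surjective.lieAlgebra_isSolvable (f := f) ?_
    rintro ⟨y, hy⟩
    obtain ⟨x, rfl⟩ := LieIdeal.mem_map_of_surjective (p.act_surjective k) hy
    exact ⟨x, rfl⟩
  have h : p.act k x ∈ p.nilRad.map (p.act k) := LieIdeal.mem_map hx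
  refine (LieIdeal.map_bracket_le (p.act k)).trans (LieSubmodule.mono_lie le_top hrad) h

/-- The action of `H` on the nilpotent radical. -/
def Subpair.actRad (p : Subpair P) (k : p.grp) : p.nilRad →ₗ[ℂ] p.nilRad :=
  (p.act k : p.alg →ₗ[ℂ] p.alg).restrict fun _ hx => p.act_mem_nilRad k hx

theorem Subpair.actRad_coe (p : Subpair P) (k : p.grp) (x : p.nilRad) :
    (p.actRad k x : p.alg) = p.act k x := rfl

theorem Subpair.actRad_mul (p : Subpair P) (k l : p.grp) :
    p.actRad (k * l) = p.actRad k ∘ₗ p.actRad l :=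
  LinearMap.ext fun x => Subtype.ext (p.act_mul k l x)

theorem Subpair.actRad_one (p : Subpair P) : p.actRad 1 = LinearMap.id :=
  LinearMap.ext fun x => Subtype.ext (p.act_one x)

theorem Subpair.actRad_lie (p : Subpair P) (k : p.grp) (x : p.alg) :
    p.actRad k ∘ₗ CE.ad p.nilRad x = CE.ad p.nilRad (p.act k x) ∘ₗ p.actRad k :=
  LinearMap.ext fun y => Subtype.ext ((p.act k).map_lie x y)

theorem Subpair.act_inv_act (p : Subpair P) (k : p.grp) (x : p.alg) :
    p.act k (p.act k⁻¹ x) = x := by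
  rw [← p.act_mul, mul_inv_cancel, p.act_one]

theorem Subpair.inv_act_act (p : Subpair P) (k : p.grp) (x : p.alg) :
    p.act k⁻¹ (p.act k x) = x := by
  rw [← p.act_mul, inv_mul_cancel, p.act_one]

namespace PreModule

variable {p : Subpair P}

/-- The module `Hom(⋀ⁿ𝔲, M)` of alternating `n`-forms on the nilpotent radical `𝔲` of `𝔰` with
values in the `(𝔰, H)`-module `M`, with its natural actions
`(x f)(v₁, …, vₙ) = x (f(v₁, …, vₙ)) - ∑ᵢ f(v₁, …, [x, vᵢ], …, vₙ)` and
`(k f)(v₁, …, vₙ) = k (f(Ad(k)⁻¹ v₁, …, Ad(k)⁻¹ vₙ))`. -/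
def cochain (M : PreModule p) (n : ℕ) : PreModule p where
  V := p.nilRad [⋀^Fin n]→ₗ[ℂ] M.V
  lie := CE.act p.nilRad M.lie n
  lie_lie := CE.act_lie M.lie n M.lie_lie
  rep :=
    { toFun := fun k => CE.twist n (p.actRad k⁻¹) (M.rep k)
      map_one' := by ext f v; simp [CE.twist_apply, p.actRad_one]
      map_mul' := fun k l => by
        refine LinearMap.ext fun f => AlternatingMap.ext fun v => ?_
        simp only [CE.twist_apply, mul_inv_rev, p.actRad_mul, map_mul]
        rfl }
  compat k x f := CE.twist_act M.lie n _ _ _ _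
    (by rw [p.actRad_lie, p.inv_act_act]) (fun v => M.compat k x v) f

variable (M : PreModule p) (n : ℕ)

/-- The differential `Hom(⋀ⁿ𝔲, M) → Hom(⋀ⁿ⁺¹𝔲, M)` of the standard complex. -/
def d : (M.cochain n).V →ₗ[ℂ] (M.cochain (n + 1)).V := CE.d M.lie n

theorem d_isHom : IsHom (M.cochain n) (M.cochain (n + 1)) (M.d n) where
  lie x f := CE.d_act M.lie n M.lie_lie x f
  rep k f := CE.d_twist M.lie n _ _ (fun y => by rw [p.actRad_lie]; rfl)
    (fun y v => by rw [M.compat, p.actRad_coe, p.act_inv_act]) f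

theorem d_d (f : (M.cochain n).V) : M.d (n + 1) (M.d n f) = 0 := CE.d_d M.lie M.lie_lie n f

/-- The coboundaries: the image of the preceding differential. -/
def coboundaries : (n : ℕ) → Submodule ℂ (M.cochain n).V
  | 0 => ⊥
  | n + 1 => LinearMap.range (M.d n)

theorem isStable_bot : M.IsStable ⊥ := ⟨by simp, by simp⟩

theorem stable_coboundaries : ∀ n, (M.cochain n).IsStable (M.coboundaries n)
  | 0 => isStable_bot _
  | n + 1 => (M.d_isHom n).stable_range

/-- The module of cocycles. -/
def cocycle : PreModule p := (M.cochain n).sub (LinearMap.ker (M.d n)) (M.d_isHom n).stable_ker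

theorem IsStable.comap_subtype {M : PreModule p} {W W' : Submodule ℂ M.V} (hW : M.IsStable W)
    (hW' : M.IsStable W') : (M.sub W hW).IsStable (W'.comap W.subtype) :=
  ⟨fun x _ hv => hW'.lie x _ hv, fun k _ hv => hW'.rep k _ hv⟩

/-- The cohomology `Hⁿ(𝔲; M)` of the nilpotent radical: cocycles modulo coboundaries,
as a module over the pair `(𝔰, H)`. -/
def cohomology : PreModule p :=
  (M.cocycle n).quot ((M.coboundaries n).comap (LinearMap.ker (M.d n)).subtype)
    ((M.d_isHom n).stable_ker.comap_subtype (M.stable_coboundaries n))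

end PreModule

end Cohomology

section Grothendieck

variable {E : Type w} {K : Type v} {𝔤₀ : Type u}
  [NormedAddCommGroup E] [NormedSpace ℝ E] [FiniteDimensional ℝ E]
  [TopologicalSpace K] [ChartedSpace E K] [Group K] [LieGroup 𝓘(ℝ, E) ∞ K]
  [CompactSpace K] [T2Space K]
  [LieRing 𝔤₀] [LieAlgebra ℝ 𝔤₀] [FiniteDimensional ℝ 𝔤₀]
  {P : ReductivePair E K 𝔤₀} {p : Subpair P}

/-! ### Abelian subcategories and Grothendieck groups -/

/-- A short exact sequence `0 → A → B → C → 0`. -/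
structure IsShortExact (A B C : PreModule p) (f : A.V →ₗ[ℂ] B.V) (g : B.V →ₗ[ℂ] C.V) : Prop where
  hom_left : PreModule.IsHom A B f
  hom_right : PreModule.IsHom B C g
  injective : Function.Injective f
  exact : LinearMap.range f = LinearMap.ker g
  surjective : Function.Surjective g

/-- A class of modules spanning a full abelian subcategory of the category of `(𝔰, H)`-modules
(i.e. closed under finite direct sums, kernels and cokernels) that is closed under isomorphism. -/
structure IsAbelianSubcategory (𝓒 : PreModule p → Prop) : Prop where
  isHC : ∀ M, 𝓒 M → M.IsHC
  iso : ∀ M N, M.Iso N → 𝓒 M → 𝓒 N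
  zero : ∀ M : PreModule p, Subsingleton M.V → 𝓒 M
  prod : ∀ M N, 𝓒 M → 𝓒 N → 𝓒 (M.prod N)
  ker : ∀ M N (f : M.V →ₗ[ℂ] N.V) (hf : PreModule.IsHom M N f), 𝓒 M → 𝓒 N →
    𝓒 (M.sub (LinearMap.ker f) hf.stable_ker)
  coker : ∀ M N (f : M.V →ₗ[ℂ] N.V) (hf : PreModule.IsHom M N f), 𝓒 M → 𝓒 N →
    𝓒 (N.quot (LinearMap.range f) hf.stable_range)

/-- The relations `[B] = [A] + [C]` for short exact sequences `0 → A → B → C → 0`. -/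
def shortExactRelations (𝓒 : PreModule p → Prop) : Set (FreeAbelianGroup {M // 𝓒 M}) :=
  {x | ∃ (A B C : {M // 𝓒 M}) (f : A.1.V →ₗ[ℂ] B.1.V) (g : B.1.V →ₗ[ℂ] C.1.V),
    IsShortExact A.1 B.1 C.1 f g ∧
    x = FreeAbelianGroup.of B - FreeAbelianGroup.of A - FreeAbelianGroup.of C}

/-- The Grothendieck group `K(𝓒)`. -/
abbrev GrothendieckGroup (𝓒 : PreModule p → Prop) : Type (max (u + 1) v) :=
  FreeAbelianGroup {M // 𝓒 M} ⧸ AddSubgroup.closure (shortExactRelations 𝓒)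

namespace GrothendieckGroup

variable {𝓒 : PreModule p → Prop}

/-- The class `[M]` of an object of `𝓒`. -/
def cls (M : PreModule p) (hM : 𝓒 M) : GrothendieckGroup 𝓒 :=
  QuotientAddGroup.mk (FreeAbelianGroup.of ⟨M, hM⟩)

theorem cls_add {A B C : PreModule p} (hA : 𝓒 A) (hB : 𝓒 B) (hC : 𝓒 C) {f : A.V →ₗ[ℂ] B.V}
    {g : B.V →ₗ[ℂ] C.V} (h : IsShortExact A B C f g) : cls B hB = cls A hA + cls C hC := by
  have : (QuotientAddGroup.mk (FreeAbelianGroup.of ⟨B, hB⟩ - FreeAbelianGroup.of ⟨A, hA⟩ -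
      FreeAbelianGroup.of ⟨C, hC⟩) : GrothendieckGroup 𝓒) = 0 := by
    rw [QuotientAddGroup.eq_zero_iff]
    exact AddSubgroup.subset_closure ⟨⟨A, hA⟩, ⟨B, hB⟩, ⟨C, hC⟩, f, g, h, rfl⟩
  rw [sub_sub, QuotientAddGroup.mk_sub, sub_eq_zero] at this
  exact this

/-- A function on objects that is additive on short exact sequences extends to `K(𝓒)`. -/
def lift {A : Type*} [AddCommGroup A] (φ : ∀ M, 𝓒 M → A)
    (hφ : ∀ (M₁ M₂ M₃ : PreModule p) (h₁ : 𝓒 M₁) (h₂ : 𝓒 M₂) (h₃ : 𝓒 M₃) (f : M₁.V →ₗ[ℂ] M₂.V)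
      (g : M₂.V →ₗ[ℂ] M₃.V), IsShortExact M₁ M₂ M₃ f g → φ M₂ h₂ = φ M₁ h₁ + φ M₃ h₃) :
    GrothendieckGroup 𝓒 →+ A :=
  QuotientAddGroup.lift _ (FreeAbelianGroup.lift fun M => φ M.1 M.2) (by
    rw [AddSubgroup.closure_le]
    rintro _ ⟨A, B, C, f, g, h, rfl⟩
    simp [hφ _ _ _ A.2 B.2 C.2 f g h])

theorem lift_cls {A : Type*} [AddCommGroup A] (φ : ∀ M, 𝓒 M → A) (hφ) (M : PreModule p)
    (hM : 𝓒 M) : lift φ hφ (cls M hM) = φ M hM := by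
  change FreeAbelianGroup.lift _ (FreeAbelianGroup.of _) = _
  simp

theorem cls_of_subsingleton {M : PreModule p} (hM : 𝓒 M) (h : Subsingleton M.V) :
    cls M hM = 0 := by
  have : IsShortExact M M M LinearMap.id LinearMap.id :=
    ⟨⟨by simp, by simp⟩, ⟨by simp, by simp⟩, Function.injective_id, by
      ext x; simp [Subsingleton.elim x 0], Function.surjective_id⟩
  simpa using cls_add hM hM hM this

/-- `[M] = [ker φ] + [ker ψ]` for an exact sequence `M → N → O` with maps `φ`, `ψ`. -/
theorem cls_eq_ker_add_ker {M N O : PreModule p} (hM : 𝓒 M)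
    {φ : M.V →ₗ[ℂ] N.V} {ψ : N.V →ₗ[ℂ] O.V} (hφ : PreModule.IsHom M N φ)
    (hψ : PreModule.IsHom N O ψ) (hker : 𝓒 (M.sub (LinearMap.ker φ) hφ.stable_ker))
    (hker' : 𝓒 (N.sub (LinearMap.ker ψ) hψ.stable_ker))
    (hex : LinearMap.range φ = LinearMap.ker ψ) :
    cls M hM = cls _ hker + cls _ hker' := by
  refine cls_add (A := M.sub (LinearMap.ker φ) hφ.stable_ker) (B := M)
    (C := N.sub (LinearMap.ker ψ) hψ.stable_ker) (f := (LinearMap.ker φ).subtype)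
    (g := φ.codRestrict (LinearMap.ker ψ) fun x => hex ▸ LinearMap.mem_range_self φ x) _ _ _ ?_
  refine ⟨⟨fun _ _ => rfl, fun _ _ => rfl⟩, ⟨fun x v => Subtype.ext (hφ.lie x v),
    fun k v => Subtype.ext (hφ.rep k v)⟩, Subtype.val_injective, ?_, ?_⟩
  · exact (Submodule.range_subtype _).trans (LinearMap.ker_codRestrict _ _ _).symm
  · rintro ⟨y, hy⟩
    rw [← hex] at hy
    obtain ⟨x, rfl⟩ := hy
    exact ⟨x, rfl⟩

end GrothendieckGroup

/-! ### The long exact sequence -/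

namespace PreModule

theorem IsHom.res {q : Subpair P} (h : p ≤ q) {M N : PreModule q} {f : M.V →ₗ[ℂ] N.V}
    (hf : IsHom M N f) : IsHom (M.res h) (N.res h) f :=
  ⟨fun _ _ => hf.lie _ _, fun _ _ => hf.rep _ _⟩

variable {A B C : PreModule p} {f : A.V →ₗ[ℂ] B.V} {g : B.V →ₗ[ℂ] C.V}

/-- The map on cochains induced by a linear map. -/
def cochainMap {A B : PreModule p} (f : A.V →ₗ[ℂ] B.V) (n : ℕ) :
    (A.cochain n).V →ₗ[ℂ] (B.cochain n).V :=
  f.compAlternatingMapₗ (R := ℂ) (S := ℂ) (M := p.nilRad) (ι := Fin n)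

/-- The value of a cochain. -/
def ev {A : PreModule p} {n : ℕ} (c : (A.cochain n).V) (v : Fin n → p.nilRad) : A.V :=
  AlternatingMap.toMultilinearMap (R := ℂ) (M := p.nilRad) (N := A.V) (ι := Fin n) c v

theorem ev_ext {A : PreModule p} {n : ℕ} {c c' : (A.cochain n).V} (h : ∀ v, ev c v = ev c' v) :
    c = c' := AlternatingMap.ext (R := ℂ) (M := p.nilRad) (N := A.V) h

theorem ev_cochainMap {A B : PreModule p} (f : A.V →ₗ[ℂ] B.V) (n : ℕ)
    (c : (A.cochain n).V) (v : Fin n → p.nilRad) :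
    ev (cochainMap f n c) v = f (ev c v) := rfl

theorem cochainMap_isHom (hf : IsHom A B f) (n : ℕ) :
    IsHom (A.cochain n) (B.cochain n) (cochainMap f n) where
  lie x := CE.act_comp A.lie n B.lie f x (hf.lie x)
  rep k _ := ev_ext fun _ => hf.rep k _

theorem cochainMap_d (hf : IsHom A B f) (n : ℕ) (c : (A.cochain n).V) :
    cochainMap f (n + 1) (A.d n c) = B.d n (cochainMap f n c) :=
  CE.d_comp A.lie n B.lie f hf.lie c

theorem cochainMap_injective (hf : Function.Injective f) (n : ℕ) :
    Function.Injective (cochainMap f n) := fun _ _ h =>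
  ev_ext fun v => hf (congrArg (fun c => ev c v) h)

theorem cochainMap_surjective (hg : Function.Surjective g) (n : ℕ) :
    Function.Surjective (cochainMap g n) := by
  obtain ⟨s, hs⟩ := LinearMap.exists_rightInverse_of_surjective g (LinearMap.range_eq_top.2 hg)
  exact fun c => ⟨cochainMap s n c, ev_ext fun v => LinearMap.congr_fun hs _⟩

theorem cochainMap_exact (hf : Function.Injective f) (h : LinearMap.range f = LinearMap.ker g)
    (n : ℕ) (b : (B.cochain n).V) :
    cochainMap g n b = 0 ↔ ∃ a, cochainMap f n a = b := by
  constructor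
  · intro hb
    obtain ⟨s, hs⟩ := LinearMap.exists_leftInverse_of_injective f (LinearMap.ker_eq_bot.2 hf)
    refine ⟨cochainMap s n b, ev_ext fun v => ?_⟩
    have hv : g (ev b v) = 0 := congrArg (fun c => ev c v) hb
    rw [← LinearMap.mem_ker, ← h] at hv
    obtain ⟨a, ha⟩ := hv
    rw [ev_cochainMap, ev_cochainMap, ← ha]
    exact congrArg f (LinearMap.congr_fun hs a)
  · rintro ⟨a, rfl⟩
    refine ev_ext fun v => ?_
    have : f (ev a v) ∈ LinearMap.ker g := h ▸ LinearMap.mem_range_self f _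
    exact this

/-- The class of a cocycle. -/
def coh (M : PreModule p) (n : ℕ) (z : (M.cochain n).V) (hz : M.d n z = 0) :
    (M.cohomology n).V :=
  Submodule.Quotient.mk (p := (M.coboundaries n).comap (LinearMap.ker (M.d n)).subtype) ⟨z, hz⟩

theorem coh_surj (M : PreModule p) (n : ℕ) (y : (M.cohomology n).V) :
    ∃ z hz, M.coh n z hz = y := by
  obtain ⟨⟨z, hz⟩, rfl⟩ := Submodule.Quotient.mk_surjective _ y
  exact ⟨z, hz, rfl⟩

theorem coh_eq_iff (M : PreModule p) (n : ℕ) {z z' : (M.cochain n).V} {hz hz'} :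
    M.coh n z hz = M.coh n z' hz' ↔ z - z' ∈ M.coboundaries n :=
  Submodule.Quotient.eq _

theorem coh_eq_zero_iff (M : PreModule p) (n : ℕ) {z : (M.cochain n).V} {hz} :
    M.coh n z hz = 0 ↔ z ∈ M.coboundaries n :=
  Submodule.Quotient.mk_eq_zero _

theorem coh_lie (M : PreModule p) (n : ℕ) (x : p.alg) {z : (M.cochain n).V} (hz : M.d n z = 0) :
    (M.cohomology n).lie x (M.coh n z hz) = M.coh n ((M.cochain n).lie x z)
      (by rw [(M.d_isHom n).lie, hz, map_zero]) := rfl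

theorem coh_rep (M : PreModule p) (n : ℕ) (k : p.grp) {z : (M.cochain n).V} (hz : M.d n z = 0) :
    (M.cohomology n).rep k (M.coh n z hz) = M.coh n ((M.cochain n).rep k z)
      (by rw [(M.d_isHom n).rep, hz, map_zero]) := rfl

/-- A linear map out of cohomology from a linear map on cochains. -/
def cohLift {M N : PreModule p} {m n : ℕ} (φ : (M.cochain m).V →ₗ[ℂ] (N.cochain n).V)
    (h₁ : ∀ z, M.d m z = 0 → N.d n (φ z) = 0)
    (h₂ : ∀ z, M.d m z = 0 → z ∈ M.coboundaries m → φ z ∈ N.coboundaries n) :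
    (M.cohomology m).V →ₗ[ℂ] (N.cohomology n).V :=
  Submodule.mapQ ((M.coboundaries m).comap (LinearMap.ker (M.d m)).subtype)
    ((N.coboundaries n).comap (LinearMap.ker (N.d n)).subtype)
    (φ.restrict (p := LinearMap.ker (M.d m)) (q := LinearMap.ker (N.d n)) h₁)
    fun z hz => h₂ z.1 z.2 hz

theorem cohLift_coh {M N : PreModule p} {m n : ℕ} (φ : (M.cochain m).V →ₗ[ℂ] (N.cochain n).V)
    (h₁ h₂) (z : (M.cochain m).V) (hz) :
    cohLift φ h₁ h₂ (M.coh m z hz) = N.coh n (φ z) (h₁ z hz) := rfl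

/-- The map induced on cohomology by a homomorphism. -/
def cohMap {A B : PreModule p} {f : A.V →ₗ[ℂ] B.V} (hf : IsHom A B f) (n : ℕ) :
    (A.cohomology n).V →ₗ[ℂ] (B.cohomology n).V :=
  cohLift (cochainMap f n) (fun z hz => by rw [← cochainMap_d hf, hz, map_zero]) (by
    intro z _ hz
    cases n with
    | zero =>
      obtain rfl : z = 0 := hz
      rw [map_zero]; exact Submodule.zero_mem _
    | succ n =>
      obtain ⟨c, rfl⟩ := hz
      exact ⟨cochainMap f n c, (cochainMap_d hf n c).symm⟩)

theorem cohMap_coh (hf : IsHom A B f) (n : ℕ) (z : (A.cochain n).V) (hz) :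
    cohMap hf n (A.coh n z hz) = B.coh n (cochainMap f n z)
      (by rw [← cochainMap_d hf, hz, map_zero]) := rfl

theorem cohMap_isHom (hf : IsHom A B f) (n : ℕ) :
    IsHom (A.cohomology n) (B.cohomology n) (cohMap hf n) where
  lie x y := by
    obtain ⟨z, hz, rfl⟩ := A.coh_surj n y
    simp only [coh_lie, cohMap_coh, (cochainMap_isHom hf n).lie]
  rep k y := by
    obtain ⟨z, hz, rfl⟩ := A.coh_surj n y
    simp only [coh_rep, cohMap_coh, (cochainMap_isHom hf n).rep]

theorem cohMap_exact (h : IsShortExact A B C f g) (n : ℕ) :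
    LinearMap.range (cohMap h.hom_left n) = LinearMap.ker (cohMap h.hom_right n) := by
  ext y
  constructor
  · rintro ⟨x, rfl⟩
    obtain ⟨z, hz, rfl⟩ := A.coh_surj n x
    rw [LinearMap.mem_ker, cohMap_coh, cohMap_coh, coh_eq_zero_iff,
      (cochainMap_exact h.injective h.exact n _).2 ⟨z, rfl⟩]
    exact Submodule.zero_mem _
  · intro hy
    obtain ⟨z, hz, rfl⟩ := B.coh_surj n y
    rw [LinearMap.mem_ker, cohMap_coh, coh_eq_zero_iff] at hy
    have key : ∃ b ∈ B.coboundaries n, cochainMap g n b = cochainMap g n z := by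
      cases n with
      | zero => exact ⟨0, Submodule.zero_mem _, by rw [map_zero]; exact hy.symm⟩
      | succ n =>
        obtain ⟨c, hc⟩ := hy
        obtain ⟨b, rfl⟩ := cochainMap_surjective h.surjective n c
        exact ⟨B.d n b, ⟨b, rfl⟩, by rw [cochainMap_d h.hom_right, hc]⟩
    obtain ⟨b, hb, hbz⟩ := key
    have hdb : B.d n b = 0 := by
      cases n with
      | zero =>
        obtain rfl : b = 0 := hb
        exact map_zero _
      | succ n => obtain ⟨b, rfl⟩ := hb; exact B.d_d n b
    obtain ⟨a, ha⟩ := (cochainMap_exact h.injective h.exact n (z - b)).1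
      (by rw [map_sub, hbz, sub_self])
    have hda : A.d n a = 0 := cochainMap_injective h.injective (n + 1) (by
      rw [cochainMap_d h.hom_left, ha, map_sub, hz, hdb, sub_zero, map_zero])
    refine ⟨A.coh n a hda, ?_⟩
    rw [cohMap_coh, coh_eq_iff, ha, sub_sub_cancel_left]
    exact Submodule.neg_mem _ hb

theorem exists_connecting (h : IsShortExact A B C f g) (n : ℕ) :
    ∃ δ : (C.cohomology n).V →ₗ[ℂ] (A.cohomology (n + 1)).V,
      ∀ (b : (B.cochain n).V) (a : (A.cochain (n + 1)).V) (_ : cochainMap f (n + 1) a = B.d n b)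
        (hc : C.d n (cochainMap g n b) = 0) (ha : A.d (n + 1) a = 0),
        δ (C.coh n (cochainMap g n b) hc) = A.coh (n + 1) a ha := by
  obtain ⟨s, hs⟩ := LinearMap.exists_leftInverse_of_injective (cochainMap f (n + 1))
    (LinearMap.ker_eq_bot.2 (cochainMap_injective h.injective (n + 1)))
  obtain ⟨σ, hσ⟩ := LinearMap.exists_rightInverse_of_surjective (cochainMap g n)
    (LinearMap.range_eq_top.2 (cochainMap_surjective h.surjective n))
  have hs' : ∀ a, s (cochainMap f (n + 1) a) = a := fun a => LinearMap.congr_fun hs a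
  have hσ' : ∀ c, cochainMap g n (σ c) = c := fun c => LinearMap.congr_fun hσ c
  have hfs : ∀ c, C.d n c = 0 → cochainMap f (n + 1) (s (B.d n (σ c))) = B.d n (σ c) := by
    intro c hc
    obtain ⟨a, ha⟩ := (cochainMap_exact h.injective h.exact (n + 1) (B.d n (σ c))).1
      (by rw [cochainMap_d h.hom_right, hσ', hc])
    rw [← ha, hs']
  -- if `g b = c` is a cocycle, then `s (d (σ c))` and the preimage of `d b` differ by a coboundary
  have key : ∀ (b : (B.cochain n).V) (a : (A.cochain (n + 1)).V),
      cochainMap f (n + 1) a = B.d n b → C.d n (cochainMap g n b) = 0 →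
      s (B.d n (σ (cochainMap g n b))) - a ∈ A.coboundaries (n + 1) := by
    intro b a hab hc
    obtain ⟨a', ha'⟩ := (cochainMap_exact h.injective h.exact n
      (σ (cochainMap g n b) - b)).1 (by rw [map_sub, hσ', sub_self])
    refine ⟨a', cochainMap_injective h.injective (n + 1) ?_⟩
    rw [cochainMap_d h.hom_left, ha', map_sub, map_sub, hfs _ hc, hab]
  refine ⟨cohLift (s ∘ₗ B.d n ∘ₗ σ) ?_ ?_, ?_⟩
  · intro c hc
    refine cochainMap_injective h.injective (n + 2) ?_
    rw [cochainMap_d h.hom_left, map_zero]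
    change B.d (n + 1) (cochainMap f (n + 1) (s (B.d n (σ c)))) = 0
    rw [hfs c hc, B.d_d]
  · intro c hc hcb
    have : ∃ b, B.d n b = 0 ∧ cochainMap g n b = c := by
      cases n with
      | zero =>
        obtain rfl : c = 0 := hcb
        exact ⟨0, map_zero _, map_zero _⟩
      | succ n =>
        obtain ⟨c', rfl⟩ := hcb
        obtain ⟨b, rfl⟩ := cochainMap_surjective h.surjective n c'
        exact ⟨B.d n b, B.d_d n b, cochainMap_d h.hom_right n b⟩
    obtain ⟨b, hb, rfl⟩ := this
    simpa using key b 0 (by rw [map_zero, hb]) hc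
  · intro b a hab hc ha
    rw [cohLift_coh, coh_eq_iff]
    exact key b a hab hc

theorem exists_lift (h : IsShortExact A B C f g) (n : ℕ) (y : (C.cohomology n).V) :
    ∃ (b : (B.cochain n).V) (a : (A.cochain (n + 1)).V) (hc : C.d n (cochainMap g n b) = 0),
      cochainMap f (n + 1) a = B.d n b ∧ A.d (n + 1) a = 0 ∧
        C.coh n (cochainMap g n b) hc = y := by
  obtain ⟨c, hc, rfl⟩ := C.coh_surj n y
  obtain ⟨b, rfl⟩ := cochainMap_surjective h.surjective n c
  obtain ⟨a, ha⟩ := (cochainMap_exact h.injective h.exact (n + 1) (B.d n b)).1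
    (by rw [cochainMap_d h.hom_right, hc])
  refine ⟨b, a, hc, ha, cochainMap_injective h.injective (n + 2) ?_, rfl⟩
  rw [cochainMap_d h.hom_left, ha, B.d_d, map_zero]

/-- The long exact sequence of cohomology. -/
theorem long_exact (h : IsShortExact A B C f g) (n : ℕ) :
    ∃ δ : (C.cohomology n).V →ₗ[ℂ] (A.cohomology (n + 1)).V,
      IsHom (C.cohomology n) (A.cohomology (n + 1)) δ ∧
      LinearMap.range (cohMap h.hom_right n) = LinearMap.ker δ ∧
      LinearMap.range δ = LinearMap.ker (cohMap h.hom_left (n + 1)) := by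
  obtain ⟨δ, hδ⟩ := exists_connecting h n
  refine ⟨δ, ⟨?_, ?_⟩, ?_, ?_⟩
  · intro x y
    obtain ⟨b, a, hc, hab, ha, rfl⟩ := exists_lift h n y
    rw [hδ b a hab hc ha, coh_lie, coh_lie]
    have e := (cochainMap_isHom h.hom_right n).lie x b
    simp only [← e]
    refine hδ _ _ ?_ _ _
    rw [(cochainMap_isHom h.hom_left (n + 1)).lie, hab, (B.d_isHom n).lie]
  · intro k y
    obtain ⟨b, a, hc, hab, ha, rfl⟩ := exists_lift h n y
    rw [hδ b a hab hc ha, coh_rep, coh_rep]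
    have e := (cochainMap_isHom h.hom_right n).rep k b
    simp only [← e]
    refine hδ _ _ ?_ _ _
    rw [(cochainMap_isHom h.hom_left (n + 1)).rep, hab, (B.d_isHom n).rep]
  · ext y
    constructor
    · rintro ⟨x, rfl⟩
      obtain ⟨b, hb, rfl⟩ := B.coh_surj n x
      rw [LinearMap.mem_ker, cohMap_coh, hδ b 0 (by rw [map_zero, hb]) _ (map_zero _),
        coh_eq_zero_iff]
      exact Submodule.zero_mem _
    · intro hy
      obtain ⟨b, a, hc, hab, ha, rfl⟩ := exists_lift h n y
      rw [LinearMap.mem_ker, hδ b a hab hc ha, coh_eq_zero_iff] at hy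
      obtain ⟨a', rfl⟩ := hy
      rw [cochainMap_d h.hom_left] at hab
      have hd : B.d n (b - cochainMap f n a') = 0 := by rw [map_sub, hab, sub_self]
      refine ⟨B.coh n _ hd, ?_⟩
      rw [cohMap_coh, coh_eq_iff, ← map_sub, sub_sub_cancel_left, map_neg,
        (cochainMap_exact h.injective h.exact n _).2 ⟨a', rfl⟩, neg_zero]
      exact Submodule.zero_mem _
  · ext y
    constructor
    · rintro ⟨x, rfl⟩
      obtain ⟨b, a, hc, hab, ha, rfl⟩ := exists_lift h n x
      rw [LinearMap.mem_ker, hδ b a hab hc ha, cohMap_coh, coh_eq_zero_iff, hab]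
      exact ⟨b, rfl⟩
    · intro hy
      obtain ⟨a, ha, rfl⟩ := A.coh_surj (n + 1) y
      rw [LinearMap.mem_ker, cohMap_coh, coh_eq_zero_iff] at hy
      obtain ⟨b, hb⟩ := hy
      have hc : C.d n (cochainMap g n b) = 0 := by
        rw [← cochainMap_d h.hom_right, hb]
        exact (cochainMap_exact h.injective h.exact (n + 1) _).2 ⟨a, rfl⟩
      exact ⟨C.coh n _ hc, hδ b a hb.symm hc ha⟩

theorem cohMap_zero_injective (h : IsShortExact A B C f g) :
    LinearMap.ker (cohMap h.hom_left 0) = ⊥ := by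
  rw [LinearMap.ker_eq_bot']
  intro y hy
  obtain ⟨a, ha, rfl⟩ := A.coh_surj 0 y
  rw [cohMap_coh, coh_eq_zero_iff] at hy
  have : cochainMap f 0 a = 0 := hy
  rw [coh_eq_zero_iff]
  rw [cochainMap_injective h.injective 0 (this.trans (map_zero _).symm)]
  exact Submodule.zero_mem _

/-- Cohomology vanishes above the dimension of `𝔲`. -/
theorem subsingleton_cohomology (M : PreModule p) {n : ℕ} (hn : Module.finrank ℂ p.nilRad < n) :
    Subsingleton (M.cohomology n).V := by
  refine ⟨fun y y' => ?_⟩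
  obtain ⟨z, hz, rfl⟩ := M.coh_surj n y
  obtain ⟨z', hz', rfl⟩ := M.coh_surj n y'
  obtain rfl : z = z' := ev_ext fun v => by
    have hv : ¬ LinearIndependent ℂ v := fun hv => by
      have := hv.fintype_card_le_finrank
      rw [Fintype.card_fin] at this
      omega
    have e : ∀ c : (M.cochain n).V, ev c v = 0 := fun c =>
      AlternatingMap.map_linearDependent (K := ℂ) (M := p.nilRad) (N := M.V) c v hv
    rw [e, e]
  rfl

/-- The Euler characteristic `∑ₙ (-1)ⁿ [Hⁿ(𝔲; M)]` in `K(𝓛)`, for a class `𝓛` of modules over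
a smaller pair `r` that contains all the `Hⁿ(𝔲; M)`. -/
def eulerChar {r : Subpair P} (hr : r ≤ p) (𝓛 : PreModule r → Prop) (M : PreModule p)
    (hM : ∀ n, 𝓛 ((M.cohomology n).res hr)) : GrothendieckGroup 𝓛 :=
  ∑ n ∈ Finset.range (Module.finrank ℂ p.nilRad + 1), (-1 : ℤ) ^ n • GrothendieckGroup.cls _ (hM n)

theorem eulerChar_add {r : Subpair P} (hr : r ≤ p) {𝓛 : PreModule r → Prop}
    (h𝓛 : IsAbelianSubcategory 𝓛) (hA : ∀ n, 𝓛 ((A.cohomology n).res hr))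
    (hB : ∀ n, 𝓛 ((B.cohomology n).res hr)) (hC : ∀ n, 𝓛 ((C.cohomology n).res hr))
    (h : IsShortExact A B C f g) :
    eulerChar hr 𝓛 B hB = eulerChar hr 𝓛 A hA + eulerChar hr 𝓛 C hC := by
  choose δ hδ hδ₁ hδ₂ using fun n => long_exact h n
  have kf := fun n => h𝓛.ker _ _ _ ((cohMap_isHom h.hom_left n).res hr) (hA n) (hB n)
  have kg := fun n => h𝓛.ker _ _ _ ((cohMap_isHom h.hom_right n).res hr) (hB n) (hC n)
  have kd := fun n => h𝓛.ker _ _ _ ((hδ n).res hr) (hC n) (hA (n + 1))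
  have eA := fun n => GrothendieckGroup.cls_eq_ker_add_ker (hA n)
    ((cohMap_isHom h.hom_left n).res hr) ((cohMap_isHom h.hom_right n).res hr) (kf n) (kg n)
    (cohMap_exact h n)
  have eB := fun n => GrothendieckGroup.cls_eq_ker_add_ker (hB n)
    ((cohMap_isHom h.hom_right n).res hr) ((hδ n).res hr) (kg n) (kd n) (hδ₁ n)
  have eC := fun n => GrothendieckGroup.cls_eq_ker_add_ker (hC n)
    ((hδ n).res hr) ((cohMap_isHom h.hom_left (n + 1)).res hr) (kd n) (kf (n + 1)) (hδ₂ n)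
  have tele : ∀ N : ℕ, ∑ n ∈ Finset.range N, (-1 : ℤ) ^ n • GrothendieckGroup.cls _ (hA n) -
      ∑ n ∈ Finset.range N, (-1 : ℤ) ^ n • GrothendieckGroup.cls _ (hB n) +
      ∑ n ∈ Finset.range N, (-1 : ℤ) ^ n • GrothendieckGroup.cls _ (hC n) =
      GrothendieckGroup.cls _ (kf 0) - (-1 : ℤ) ^ N • GrothendieckGroup.cls _ (kf N) := by
    intro N
    induction N with
    | zero => simp
    | succ N ih =>
      simp only [Finset.sum_range_succ]
      have := eA N
      rw [eB N, eC N]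
      generalize ∑ n ∈ Finset.range N, (-1 : ℤ) ^ n • GrothendieckGroup.cls _ (hA n) = SA at *
      generalize ∑ n ∈ Finset.range N, (-1 : ℤ) ^ n • GrothendieckGroup.cls _ (hB n) = SB at *
      generalize ∑ n ∈ Finset.range N, (-1 : ℤ) ^ n • GrothendieckGroup.cls _ (hC n) = SC at *
      rw [this, pow_succ]
      have : SA = GrothendieckGroup.cls _ (kf 0) -
        (-1 : ℤ) ^ N • GrothendieckGroup.cls _ (kf N) - SC + SB := by rw [← ih]; abel
      rw [this]
      module
  have z0 : GrothendieckGroup.cls _ (kf 0) = 0 := by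
    refine GrothendieckGroup.cls_of_subsingleton _ ?_
    have := cohMap_zero_injective h
    exact (Submodule.subsingleton_iff_eq_bot).2 this
  have zN : GrothendieckGroup.cls _ (kf (Module.finrank ℂ p.nilRad + 1)) = 0 := by
    refine GrothendieckGroup.cls_of_subsingleton _ ?_
    have := subsingleton_cohomology A (Nat.lt_succ_self (Module.finrank ℂ p.nilRad))
    exact ⟨fun x y => Subtype.ext (this.elim _ _)⟩
  have := tele (Module.finrank ℂ p.nilRad + 1)
  rw [z0, zN, smul_zero, sub_zero] at this
  rw [sub_add_eq_add_sub, sub_eq_zero] at this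
  exact this.symm

end PreModule

end Grothendieck

section Characters

variable {E : Type w} {K : Type v} {𝔤₀ : Type u}
  [NormedAddCommGroup E] [NormedSpace ℝ E] [FiniteDimensional ℝ E]
  [TopologicalSpace K] [ChartedSpace E K] [Group K] [LieGroup 𝓘(ℝ, E) ∞ K]
  [CompactSpace K] [T2Space K]
  [LieRing 𝔤₀] [LieAlgebra ℝ 𝔤₀] [FiniteDimensional ℝ 𝔤₀]
  {P : ReductivePair E K 𝔤₀} {p : Subpair P}

theorem PreModule.IsHom.rTensor {M N : PreModule p} {f : M.V →ₗ[ℂ] N.V}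
    (hf : PreModule.IsHom M N f) (F : PreModule p) :
    PreModule.IsHom (M.tensor F) (N.tensor F) (f.rTensor F.V) where
  lie x v := by
    have e : f.rTensor F.V ∘ₗ ((M.lie x).rTensor F.V + (F.lie x).lTensor M.V) =
        ((N.lie x).rTensor F.V + (F.lie x).lTensor N.V) ∘ₗ f.rTensor F.V :=
      TensorProduct.ext' fun a b => by simp [hf.lie]
    exact LinearMap.congr_fun e v
  rep k v := by
    have e : f.rTensor F.V ∘ₗ TensorProduct.map (M.rep k) (F.rep k) =
        TensorProduct.map (N.rep k) (F.rep k) ∘ₗ f.rTensor F.V :=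
      TensorProduct.ext' fun a b => by simp [hf.rep]
    exact LinearMap.congr_fun e v

/-! ### Partially defined operations on Grothendieck groups -/

namespace GrothendieckGroup

variable {𝓒 : PreModule p → Prop}

/-- `Z` is a product of `X` and `Y`: there are finite expressions `X = ∑ aᵢ [Vᵢ]`,
`Y = ∑ bⱼ [Wⱼ]` such that all `Vᵢ ⊗ Wⱼ` lie in `𝓒`, and `Z = ∑ aᵢ bⱼ [Vᵢ ⊗ Wⱼ]`. -/
def IsProduct (X Y Z : GrothendieckGroup 𝓒) : Prop :=
  ∃ (m n : ℕ) (a : Fin m → ℤ) (b : Fin n → ℤ) (V : Fin m → {M // 𝓒 M}) (W : Fin n → {M // 𝓒 M})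
    (h : ∀ i j, 𝓒 ((V i).1.tensor (W j).1)),
    X = ∑ i, a i • cls (V i).1 (V i).2 ∧ Y = ∑ j, b j • cls (W j).1 (W j).2 ∧
    Z = ∑ i, ∑ j, (a i * b j) • cls _ (h i j)

/-- `Y` is a dual of `X`: there is a finite expression `X = ∑ aᵢ [Vᵢ]` such that all `Vᵢ^*` lie in
`𝓒`, and `Y = ∑ aᵢ [Vᵢ^*]`. -/
def IsDual (X Y : GrothendieckGroup 𝓒) : Prop :=
  ∃ (m : ℕ) (a : Fin m → ℤ) (V : Fin m → {M // 𝓒 M}) (h : ∀ i, 𝓒 (V i).1.dual),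
    X = ∑ i, a i • cls (V i).1 (V i).2 ∧ Y = ∑ i, a i • cls _ (h i)

/-- `R` is a restriction of `X` to a smaller pair: there is a finite expression `X = ∑ aᵢ [Vᵢ]` such
that all restrictions of the `Vᵢ` lie in `𝓛`, and `R` is the corresponding sum of their classes. -/
def IsRestriction {r : Subpair P} (hr : r ≤ p) {𝓛 : PreModule r → Prop}
    (X : GrothendieckGroup 𝓒) (R : GrothendieckGroup 𝓛) : Prop :=
  ∃ (m : ℕ) (a : Fin m → ℤ) (V : Fin m → {M // 𝓒 M}) (h : ∀ i, 𝓛 ((V i).1.res hr)),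
    X = ∑ i, a i • cls (V i).1 (V i).2 ∧ R = ∑ i, a i • cls _ (h i)

variable (𝓒) in
/-- The subgroup of `K(𝓒)` generated by the classes of the objects of finite length. -/
def finiteLength : AddSubgroup (GrothendieckGroup 𝓒) :=
  AddSubgroup.closure {X | ∃ M hM, M.FiniteLength ∧ X = cls M hM}

/-- Tensoring with a fixed module `F` is exact, hence defines an endomorphism of `K(𝓒)` if it
preserves `𝓒`. -/
def tensorHom (F : PreModule p) (hF : ∀ M, 𝓒 M → 𝓒 (M.tensor F)) :
    GrothendieckGroup 𝓒 →+ GrothendieckGroup 𝓒 :=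
  lift (fun M hM => cls (M.tensor F) (hF M hM)) (by
    intro M₁ M₂ M₃ h₁ h₂ h₃ f g h
    refine cls_add (f := f.rTensor F.V) (g := g.rTensor F.V) _ _ _
      ⟨h.hom_left.rTensor F, h.hom_right.rTensor F, ?_, ?_, ?_⟩
    · exact Module.Flat.rTensor_preserves_injective_linearMap f h.injective
    · exact (LinearMap.exact_iff.1 (rTensor_exact F.V (LinearMap.exact_iff.2 h.exact.symm)
        h.surjective)).symm
    · exact LinearMap.rTensor_surjective F.V h.surjective)

end GrothendieckGroup

/-! ### Germane parabolic subalgebras -/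

/-- The complexification of a real subalgebra of `𝔤₀`, as a subalgebra of `𝔤 = ℂ ⊗ 𝔤₀`. -/
def complexify (𝔩₀ : LieSubalgebra ℝ 𝔤₀) : LieSubalgebra ℂ (ℂ ⊗[ℝ] 𝔤₀) where
  toSubmodule := 𝔩₀.toSubmodule.baseChange ℂ
  lie_mem' := by
    intro x y (hx : x ∈ 𝔩₀.toSubmodule.baseChange ℂ) (hy : y ∈ 𝔩₀.toSubmodule.baseChange ℂ)
    change ⁅x, y⁆ ∈ 𝔩₀.toSubmodule.baseChange ℂ
    rw [Submodule.baseChange_eq_span] at *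
    induction hx using Submodule.span_induction with
    | zero => simp
    | add a b _ _ ha hb => rw [add_lie]; exact Submodule.add_mem _ ha hb
    | smul c a _ ha => rw [smul_lie]; exact Submodule.smul_mem _ c ha
    | mem a ha =>
      induction hy using Submodule.span_induction with
      | zero => rw [show ⁅a, (0 : ℂ ⊗[ℝ] 𝔤₀)⁆ = 0 from lie_zero a]; exact Submodule.zero_mem _
      | add c b _ _ hc hb =>
        rw [show ⁅a, c + b⁆ = ⁅a, c⁆ + ⁅a, b⁆ from lie_add a c b]; exact Submodule.add_mem _ hc hb
      | smul c b _ hb =>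
        rw [show ⁅a, c • b⁆ = c • ⁅a, b⁆ from lie_smul c a b]; exact Submodule.smul_mem _ c hb
      | mem b hb =>
        obtain ⟨a, ha, rfl⟩ := ha
        obtain ⟨b, hb, rfl⟩ := hb
        refine Submodule.subset_span ⟨⁅a, b⁆, 𝔩₀.lie_mem ha hb, ?_⟩
        simp

/-- The subgroup of the elements of `K` whose adjoint action preserves a subset of `𝔤`. -/
def setNormalizer (P : ReductivePair E K 𝔤₀) (S : Set (ℂ ⊗[ℝ] 𝔤₀)) : Subgroup K where
  carrier := {k | ∀ x, P.adC k x ∈ S ↔ x ∈ S}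
  one_mem' x := by rw [P.adC_one]
  mul_mem' {k l} hk hl x := by rw [P.adC_mul, hk, hl]
  inv_mem' {k} hk x := by rw [← hk, ← P.adC_mul, mul_inv_cancel, P.adC_one]

/-- A germane parabolic subalgebra `𝔮` of `𝔤`: it contains a Borel (i.e. maximal solvable)
subalgebra of `𝔤`, and it has a Levi factor (a subalgebra complementary to the nilpotent radical)
which is the complexification of a `θ`-stable real subalgebra `𝔩₀` of `𝔤₀`. -/
structure GermaneParabolic (P : ReductivePair E K 𝔤₀) where
  𝔮 : LieSubalgebra ℂ (ℂ ⊗[ℝ] 𝔤₀)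
  𝔩₀ : LieSubalgebra ℝ 𝔤₀
  parabolic : ∃ 𝔟 : LieSubalgebra ℂ (ℂ ⊗[ℝ] 𝔤₀),
    Maximal (fun 𝔟 : LieSubalgebra ℂ (ℂ ⊗[ℝ] 𝔤₀) => LieAlgebra.IsSolvable 𝔟) 𝔟 ∧ 𝔟 ≤ 𝔮
  θ_stable : ∀ x ∈ 𝔩₀, P.θ x ∈ 𝔩₀
  levi_le : complexify 𝔩₀ ≤ 𝔮
  isCompl : IsCompl ((complexify 𝔩₀).toSubmodule.comap 𝔮.toSubmodule.subtype)
    (nilpotentRadical 𝔮).toSubmodule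

namespace GermaneParabolic

/-- The Levi factor `𝔩`. -/
def 𝔩 (Q : GermaneParabolic P) : LieSubalgebra ℂ (ℂ ⊗[ℝ] 𝔤₀) := complexify Q.𝔩₀

/-- The group `L ∩ K`, where `L` is the intersection of the normalizers of `𝔮` and `θ(𝔮)` in the
real reductive group. The last normalizer does not change the group, since `𝔩 = 𝔮 ∩ τ(𝔮)` where the
antilinear involution `τ = (complex conjugation) ∘ θ` of `𝔤` commutes with the action of `K`. -/
def leviGroup (Q : GermaneParabolic P) : Subgroup K :=
  setNormalizer P Q.𝔮 ⊓ setNormalizer P (P.thetaC '' Q.𝔮) ⊓ setNormalizer P Q.𝔩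

/-- The pair `(𝔮, L ∩ K)`. -/
def parab (Q : GermaneParabolic P) : Subpair P where
  alg := Q.𝔮
  grp := Q.leviGroup
  stable _ hk x hx := (hk.1.1 x).2 hx

/-- The pair `(𝔩, L ∩ K)`. -/
def levi (Q : GermaneParabolic P) : Subpair P where
  alg := Q.𝔩
  grp := Q.leviGroup
  stable _ hk x hx := (hk.2 x).2 hx

theorem levi_le_parab (Q : GermaneParabolic P) : Q.levi ≤ Q.parab := ⟨Q.levi_le, le_rfl⟩

/-- The dimension of `𝔲`. -/
def dimU (Q : GermaneParabolic P) : ℕ := Module.finrank ℂ Q.parab.nilRad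

/-- The `(𝔩, L ∩ K)`-module `Hⁿ(𝔲; V)`, for a `(𝔮, L ∩ K)`-module `V`. -/
def coh (Q : GermaneParabolic P) (n : ℕ) (V : PreModule Q.parab) : PreModule Q.levi :=
  (V.cohomology n).res Q.levi_le_parab

/-- A `(𝔤, K)`-module considered as a `(𝔮, L ∩ K)`-module. -/
def toParab (Q : GermaneParabolic P) (V : PreModule (Subpair.full P)) : PreModule Q.parab :=
  V.res Q.parab.le_full

/-- The `(𝔩, L ∩ K)`-module `⋀ⁿ𝔲^*`, realized as the space of alternating `n`-forms on `𝔲`. -/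
def extPow (Q : GermaneParabolic P) (n : ℕ) : PreModule Q.levi :=
  ((PreModule.triv Q.parab).cochain n).res Q.levi_le_parab

theorem extPow_zero_iso (Q : GermaneParabolic P) :
    (Q.extPow 0).Iso (PreModule.triv Q.levi) := by
  let e : Q.parab.nilRad [⋀^Fin 0]→ₗ[ℂ] ULift.{u} ℂ ≃ₗ[ℂ] ULift.{u} ℂ :=
    (AlternatingMap.constLinearEquivOfIsEmpty (R' := ℂ) (M'' := Q.parab.nilRad)
      (N'' := ULift.{u} ℂ) (ι := Fin 0)).symm
  have he : ∀ f, e f = f ![] := fun f => by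
    change f _ = f _; congr 1; ext i; exact i.elim0
  have h1 : ∀ x f, e (CE.act Q.parab.nilRad 0 0 x f) = 0 := fun x f => by
    rw [he, CE.act_apply]
    simp [altDeriv_apply]
  have h2 : ∀ a f, e (CE.twist 0 a 1 f) = e f := fun a f => by
    rw [he, he, CE.twist_apply]
    change f _ = f _; congr 1; ext i; exact i.elim0
  exact ⟨e, fun x f => h1 _ f, fun k f => h2 _ f⟩

/-- The locally `(L ∩ K)`-finite dual `V'` of a `(𝔤, K)`-module, a `(𝔮, L ∩ K)`-module. -/
def localDual (Q : GermaneParabolic P) (V : PreModule (Subpair.full P)) : PreModule Q.parab :=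
  (Q.toParab V).dual

/-- The `K`-finite dual `V^*` as a subspace of `V'`. -/
def dualSub (Q : GermaneParabolic P) (V : PreModule (Subpair.full P)) :
    Submodule ℂ (Q.localDual V).V :=
  Submodule.comap (Q.toParab V).fullDual.finiteVectors.subtype V.fullDual.finiteVectors

theorem stable_dualSub (Q : GermaneParabolic P) (V : PreModule (Subpair.full P)) :
    (Q.localDual V).IsStable (Q.dualSub V) where
  lie x v hv := V.fullDual.stable_finiteVectors.lie
    (LieSubalgebra.inclusion Q.parab.le_full.1 x) v.1 hv
  rep k v hv := V.fullDual.stable_finiteVectors.rep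
    (Subgroup.inclusion Q.parab.le_full.2 k) v.1 hv

/-- The `(𝔮, L ∩ K)`-module `V'/V^*`. -/
def dualQuot (Q : GermaneParabolic P) (V : PreModule (Subpair.full P)) : PreModule Q.parab :=
  (Q.localDual V).quot (Q.dualSub V) (Q.stable_dualSub V)

end GermaneParabolic

/-! ### Admissible pairs and quadruples -/

open GrothendieckGroup

/-- `𝔲`-admissible pairs `(𝒢, ℒ)`. -/
structure AdmissiblePair (Q : GermaneParabolic P) where
  𝒢 : PreModule (Subpair.full P) → Prop
  ℒ : PreModule Q.levi → Prop
  abelian_𝒢 : IsAbelianSubcategory 𝒢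
  abelian_ℒ : IsAbelianSubcategory ℒ
  triv_mem : 𝒢 (PreModule.triv _)
  extPow_mem : ∀ n, ℒ (Q.extPow n)
  tensor_mem : ∀ n M, ℒ M → ℒ (M.tensor (Q.extPow n))
  coh_mem : ∀ n V, 𝒢 V → ℒ (Q.coh n (Q.toParab V))

namespace AdmissiblePair

variable {Q : GermaneParabolic P} (A : AdmissiblePair Q)

theorem triv_levi_mem : A.ℒ (PreModule.triv _) :=
  A.abelian_ℒ.iso _ _ Q.extPow_zero_iso (A.extPow_mem 0)

/-- The class `[ℂ]` of the trivial representation in `K(𝒢)`. -/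
def one𝒢 : GrothendieckGroup A.𝒢 := cls _ A.triv_mem

/-- The class `[ℂ]` of the trivial representation in `K(ℒ)`. -/
def oneℒ : GrothendieckGroup A.ℒ := cls _ A.triv_levi_mem

/-- The homomorphism `H : K(𝒢) → K(ℒ)`, `[V] ↦ ∑ₙ (-1)ⁿ [Hⁿ(𝔲; V)]`. -/
def H : GrothendieckGroup A.𝒢 →+ GrothendieckGroup A.ℒ :=
  lift (fun V hV => PreModule.eulerChar Q.levi_le_parab A.ℒ (Q.toParab V)
    (fun n => A.coh_mem n V hV)) (by
      intro M₁ M₂ M₃ h₁ h₂ h₃ f g h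
      exact PreModule.eulerChar_add (A := Q.toParab M₁) (B := Q.toParab M₂) (C := Q.toParab M₃)
        (f := f) (g := g) Q.levi_le_parab A.abelian_ℒ (fun n => A.coh_mem n M₁ h₁)
        (fun n => A.coh_mem n M₂ h₂) (fun n => A.coh_mem n M₃ h₃)
        ⟨h.hom_left.res _, h.hom_right.res _, h.injective, h.exact, h.surjective⟩)

/-- Multiplication by `[⋀ⁿ𝔲^*]` on `K(ℒ)`. -/
def mulExtPow (n : ℕ) : GrothendieckGroup A.ℒ →+ GrothendieckGroup A.ℒ :=
  tensorHom (Q.extPow n) (A.tensor_mem n)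

/-- Multiplication by the Weyl denominator `W = ∑ₙ (-1)ⁿ [⋀ⁿ𝔲^*]` on `K(ℒ)`. -/
def mulW : GrothendieckGroup A.ℒ →+ GrothendieckGroup A.ℒ :=
  ∑ n ∈ Finset.range (Q.dimU + 1), (-1 : ℤ) ^ n • A.mulExtPow n

/-- Multiplication by `(-1)^d [⋀^d 𝔲^*]` on `K(ℒ)`, where `d = dim 𝔲`. -/
def mulTop : GrothendieckGroup A.ℒ →+ GrothendieckGroup A.ℒ :=
  (-1 : ℤ) ^ Q.dimU • A.mulExtPow Q.dimU

/-- Multiplicative pairs. -/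
def IsMultiplicative : Prop :=
  ∀ V W, A.𝒢 V → A.𝒢 W → A.𝒢 (V.tensor W) →
    ∀ m n, A.ℒ ((Q.coh m (Q.toParab V)).tensor (Q.coh n (Q.toParab W)))

/-- Pairs having duality. -/
structure HasDuality : Prop where
  dual_coh_mem : ∀ V, A.𝒢 V → A.𝒢 V.dual → ∀ n, A.ℒ (Q.coh n (Q.toParab V)).dual
  coh_dual_mem : ∀ V, A.𝒢 V → A.𝒢 V.dual → ∀ n, A.ℒ (Q.coh n (Q.localDual V))
  coh_quot_mem : ∀ V, A.𝒢 V → A.𝒢 V.dual → ∀ n, A.ℒ (Q.coh n (Q.dualQuot V))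
  eulerChar_quot : ∀ V (hV : A.𝒢 V) (hV' : A.𝒢 V.dual),
    PreModule.eulerChar Q.levi_le_parab A.ℒ (Q.dualQuot V) (coh_quot_mem V hV hV') = 0

/-- `K(ℒ)` as a module over the polynomial ring `ℤ[X]`, with `X` acting as multiplication by the
Weyl denominator `W`. -/
abbrev KMod : Type _ := Module.AEval' A.mulW.toIntLinearMap

/-- The localization `K(ℒ)[W⁻¹]`. -/
abbrev Loc : Type _ := LocalizedModule (Submonoid.powers (Polynomial.X : Polynomial ℤ)) A.KMod

/-- The fraction `C / Wⁿ` in `K(ℒ)[W⁻¹]`. -/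
def frac (C : GrothendieckGroup A.ℒ) (n : ℕ) : A.Loc :=
  LocalizedModule.mk (Module.AEval'.of A.mulW.toIntLinearMap C) ⟨Polynomial.X ^ n, n, rfl⟩

theorem X_pow_smul_of (n : ℕ) (C : GrothendieckGroup A.ℒ) :
    (Polynomial.X : Polynomial ℤ) ^ n • Module.AEval'.of A.mulW.toIntLinearMap C =
      Module.AEval'.of A.mulW.toIntLinearMap (A.mulW^[n] C) := by
  induction n generalizing C with
  | zero => simp
  | succ n ih =>
    rw [pow_succ, mul_smul, Module.AEval'.X_smul_of, ih]; rfl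

/-- `C / Wᵐ = D / Wⁿ` if and only if `W^{k+n} C = W^{k+m} D` for some `k`. -/
theorem frac_eq_frac_iff {C D : GrothendieckGroup A.ℒ} {m n : ℕ} :
    A.frac C m = A.frac D n ↔ ∃ k, A.mulW^[k + n] C = A.mulW^[k + m] D := by
  rw [frac, frac, LocalizedModule.mk_eq]
  constructor
  · rintro ⟨⟨_, k, rfl⟩, h⟩
    refine ⟨k, (Module.AEval'.of A.mulW.toIntLinearMap).injective ?_⟩
    rw [← X_pow_smul_of, ← X_pow_smul_of, pow_add, pow_add, mul_smul, mul_smul]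
    exact h
  · rintro ⟨k, h⟩
    refine ⟨⟨_, k, rfl⟩, ?_⟩
    have := congrArg (Module.AEval'.of A.mulW.toIntLinearMap) h
    rw [← X_pow_smul_of, ← X_pow_smul_of, pow_add, pow_add, mul_smul, mul_smul] at this
    exact this

theorem frac_add (C D : GrothendieckGroup A.ℒ) (m n : ℕ) :
    A.frac C m + A.frac D n = A.frac (A.mulW^[n] C + A.mulW^[m] D) (m + n) := by
  rw [frac, frac, LocalizedModule.mk_add_mk, frac, map_add, ← X_pow_smul_of, ← X_pow_smul_of]
  congr 1
  exact Subtype.ext (pow_add _ _ _).symm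

theorem frac_neg (C : GrothendieckGroup A.ℒ) (n : ℕ) : -A.frac C n = A.frac (-C) n := by
  rw [frac, frac, map_neg, LocalizedModule.mk_neg]

end AdmissiblePair

/-- `𝔲`-admissible quadruples `(𝒢, ℒ, K_𝒢, K_ℒ)`. -/
structure AdmissibleQuadruple (Q : GermaneParabolic P) extends AdmissiblePair Q where
  K𝒢 : AddSubgroup (GrothendieckGroup 𝒢)
  Kℒ : AddSubgroup (GrothendieckGroup ℒ)
  H_mem : ∀ X ∈ K𝒢, toAdmissiblePair.H X ∈ Kℒ
  W_mem : ∀ C ∈ Kℒ, toAdmissiblePair.mulW C ∈ Kℒ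

namespace AdmissibleQuadruple

variable {Q : GermaneParabolic P} (𝒬 : AdmissibleQuadruple Q)

/-- Multiplicative quadruples: the pair is multiplicative, and if the product of two elements of
`K_𝒢` is well defined in `K(𝒢)` (it exists and has only one value) it lies in `K_𝒢`. -/
structure IsMultiplicative : Prop where
  pair : 𝒬.toAdmissiblePair.IsMultiplicative
  mul_mem : ∀ X ∈ 𝒬.K𝒢, ∀ Y ∈ 𝒬.K𝒢, ∀ Z, IsProduct X Y Z → (∀ Z', IsProduct X Y Z' → Z' = Z) →
    Z ∈ 𝒬.K𝒢

/-- Quadruples with duality: the pair has duality, and if the dual of an element of finite length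
of `K_𝒢` is well defined in `K(𝒢)` (it exists and has only one value) it lies in `K_𝒢`. -/
structure HasDuality : Prop where
  pair : 𝒬.toAdmissiblePair.HasDuality
  dual_mem : ∀ X ∈ 𝒬.K𝒢, X ∈ finiteLength 𝒬.𝒢 → ∀ Y, IsDual X Y → (∀ Y', IsDual X Y' → Y' = Y) →
    Y ∈ 𝒬.K𝒢

theorem iterate_mem (n : ℕ) {C : GrothendieckGroup 𝒬.ℒ} (hC : C ∈ 𝒬.Kℒ) :
    𝒬.mulW^[n] C ∈ 𝒬.Kℒ := by
  induction n with
  | zero => exact hC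
  | succ n ih => rw [Function.iterate_succ_apply']; exact 𝒬.W_mem _ ih

/-- The group `C_𝔮(𝒬) = K_ℒ[W⁻¹]`, as a subgroup of `K(ℒ)[W⁻¹]` (localization is exact):
the fractions with numerator in `K_ℒ`. -/
def characterGroup : AddSubgroup 𝒬.Loc where
  carrier := {x | ∃ C ∈ 𝒬.Kℒ, ∃ n, x = 𝒬.frac C n}
  zero_mem' := ⟨0, zero_mem _, 0, by simp [AdmissiblePair.frac]⟩
  add_mem' := by
    rintro _ _ ⟨C, hC, m, rfl⟩ ⟨D, hD, n, rfl⟩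
    exact ⟨_, add_mem (𝒬.iterate_mem n hC) (𝒬.iterate_mem m hD), m + n, 𝒬.frac_add C D m n⟩
  neg_mem' := by
    rintro _ ⟨C, hC, n, rfl⟩
    exact ⟨_, neg_mem hC, n, 𝒬.frac_neg C n⟩

/-- The algebraic character `c_𝔮(X) = H(X) / W`. -/
def char (X : 𝒬.K𝒢) : 𝒬.characterGroup :=
  ⟨𝒬.frac (𝒬.H X) 1, _, 𝒬.H_mem X X.2, 1, rfl⟩

/-- The partially defined multiplication of `C_𝔮(𝒬)`: `z = x y` if `x = S / Wᵐ`, `y = T / Wⁿ` and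
`z = P / W^{m+n}` for a product `P` of `S` and `T`. -/
def IsCharProduct (x y z : 𝒬.characterGroup) : Prop :=
  ∃ S ∈ 𝒬.Kℒ, ∃ T ∈ 𝒬.Kℒ, ∃ P ∈ 𝒬.Kℒ, ∃ m n : ℕ, x.1 = 𝒬.frac S m ∧ y.1 = 𝒬.frac T n ∧
    IsProduct S T P ∧ z.1 = 𝒬.frac P (m + n)

/-- The partially defined duality of `C_𝔮(𝒬)`: `z = x^*` if `x = S / Wⁿ` and `z = S^* / (W^*)ⁿ`
for a dual `S^*` of `S`. Here `1 / W^* = ε / W` with `ε = (-1)^d [⋀^d 𝔲^*]`, because of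
`W = ε W^*` (from `⋀ⁿ𝔲^* ≅ ⋀^d 𝔲^* ⊗ (⋀^{d-n} 𝔲^*)^*`). -/
def IsCharDual (x z : 𝒬.characterGroup) : Prop :=
  ∃ S ∈ 𝒬.Kℒ, ∃ S' : GrothendieckGroup 𝒬.ℒ, ∃ n : ℕ, x.1 = 𝒬.frac S n ∧ IsDual S S' ∧
    z.1 = 𝒬.frac (𝒬.mulTop^[n] S') n

end AdmissibleQuadruple

end Characters

end AlgChar

end

/-!
The character is `c(X) = H(X) / W`, and each of the assertions is an identity in `K(ℒ)` that holds
before `W` is inverted.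

*Restriction.* The cohomology `H^•(𝔲; V)` and the complex `Hom(⋀^•𝔲, V) ≅ V ⊗ ⋀^•𝔲^*` have the same
Euler characteristic. If the restriction of `V` lies in `ℒ`, then so do the terms of the complex,
and `H([V]) = W · [V]` (`AdmissiblePair.H_eq_mulW_res`). For `V = ℂ` this is `c([ℂ]) = 1`.

*Products.* The identity is `W · H([M ⊗ N]) = H([M]) · H([N])` (`sum_eulerChar_tensor`). Both sides
are the alternating sum over `n` of the Euler characteristics of the `𝔮`-modules
`M ⊗ Hom(⋀ⁿ𝔲, N)`:
* By Lie's theorem a nonzero finite-dimensional `𝔮`-module `F` has nonzero `𝔲`-invariants, hence is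
  filtered by modules on which `𝔲` acts trivially. This gives `H(F ⊗ X) = F · H(X)`
  (`HasEulerChar.tensor`). With `F = ⋀ⁿ𝔲^*` and `X = M ⊗ N` the alternating sum becomes the
  left-hand side.
* The complex `M ⊗ Hom(⋀^•𝔲, N)` has the cohomology `M ⊗ Hⁿ(𝔲; N)`. By Cartan's formula `𝔲` acts
  trivially on `Hⁿ(𝔲; N)`, so `Hᵐ(𝔲; M ⊗ Hⁿ(𝔲; N)) ≅ Hᵐ(𝔲; M) ⊗ Hⁿ(𝔲; N)`
  (`cohomology_tensor_iso`), and the alternating sum becomes the right-hand side.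

The second computation passes through the coboundaries of `Hom(⋀^•𝔲, N)`. The cohomology of their
tensor products with `M` need not lie in `ℒ`, which is not closed under extensions. It is filtered
by objects of `ℒ`, though, and such modules still have a well-defined class in `K(ℒ)`: kernels and
cokernels of homomorphisms between them are filtered again (`HasClass.exactFour`,
`HasClass.unique`). Accordingly `HasEulerChar` is a notion of Euler characteristic for `𝔮`-modules
whose cohomology lies in this larger class, with the two-out-of-three property for short exact
sequences.

*Duals.* Duality of the pair says that `V^*` and `V'` have the same Euler characteristic. The rest
is Poincaré duality `H^{d-n}(𝔲; V') ≅ Hⁿ(𝔲; V)^* ⊗ ⋀^d𝔲^*` (`GermaneParabolic.coh_localDual_iso`).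
Contraction with a top form identifies `Hom(⋀ⁿ𝔲, V)^* ⊗ ⋀^d𝔲^*` with `Hom(⋀^{d-n}𝔲, V^*)`
(`poincare`), compatibly with the differentials up to sign, since `𝔲` acts trivially on `⋀^d𝔲^*`
(`CE.d_poincare`). To pass to cohomology one needs that the locally `L ∩ K`-finite dual is an exact
functor, which holds because `L ∩ K` is compact: extensions of functionals can be averaged with
Haar measure (`exists_finite_extension`).
-/

noncomputable section

namespace AlgChar

universe u v w

variable {E : Type w} {K : Type v} {𝔤₀ : Type u}
  [NormedAddCommGroup E] [NormedSpace ℝ E] [FiniteDimensional ℝ E]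
  [TopologicalSpace K] [ChartedSpace E K] [Group K] [LieGroup 𝓘(ℝ, E) ∞ K]
  [CompactSpace K] [T2Space K]
  [LieRing 𝔤₀] [LieAlgebra ℝ 𝔤₀] [FiniteDimensional ℝ 𝔤₀]
  {P : ReductivePair E K 𝔤₀} {p : Subpair P}

open PreModule

/-! ### Homomorphisms and exact sequences -/

namespace PreModule

theorem IsHom.id (M : PreModule p) : IsHom M M LinearMap.id := ⟨fun _ _ => rfl, fun _ _ => rfl⟩

theorem IsHom.comp {M N O : PreModule p} {f : M.V →ₗ[ℂ] N.V} {g : N.V →ₗ[ℂ] O.V}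
    (hg : IsHom N O g) (hf : IsHom M N f) : IsHom M O (g ∘ₗ f) :=
  ⟨fun x v => by simp [hf.lie, hg.lie], fun k v => by simp [hf.rep, hg.rep]⟩

/-- A linear map `h` is a homomorphism if `h ∘ g` is one for a surjective homomorphism `g`. -/
theorem IsHom.of_comp_surjective {M N O : PreModule p} {g : M.V →ₗ[ℂ] N.V} {h : N.V →ₗ[ℂ] O.V}
    (hg : IsHom M N g) (hs : Function.Surjective g) (hc : ∀ φ : M.V →ₗ[ℂ] O.V,
      (∀ v, φ v = h (g v)) → IsHom M O φ) : IsHom N O h := by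
  have hc := hc (h ∘ₗ g) fun _ => rfl
  constructor
  · intro x v
    obtain ⟨m, rfl⟩ := hs v
    rw [← hg.lie]; exact hc.lie x m
  · intro x v
    obtain ⟨m, rfl⟩ := hs v
    rw [← hg.rep]; exact hc.rep x m

/-- A linear map `g` is a homomorphism if `i ∘ g` is one for an injective homomorphism `i`. -/
theorem IsHom.of_injective_comp {M N O : PreModule p} {g : M.V →ₗ[ℂ] N.V} {i : N.V →ₗ[ℂ] O.V}
    (hi : IsHom N O i) (hj : Function.Injective i) (hc : IsHom M O (i ∘ₗ g)) : IsHom M N g :=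
  ⟨fun x v => hj ((hc.lie x v).trans (hi.lie x _).symm),
    fun x v => hj ((hc.rep x v).trans (hi.rep x _).symm)⟩

theorem isHom_subtype (M : PreModule p) {W : Submodule ℂ M.V} (hW : M.IsStable W) :
    IsHom (M.sub W hW) M W.subtype := ⟨fun _ _ => rfl, fun _ _ => rfl⟩

theorem isHom_mkQ (M : PreModule p) {W : Submodule ℂ M.V} (hW : M.IsStable W) :
    IsHom M (M.quot W hW) W.mkQ := ⟨fun _ _ => rfl, fun _ _ => rfl⟩

theorem IsHom.codRestrict {M N : PreModule p} {f : M.V →ₗ[ℂ] N.V} (hf : IsHom M N f)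
    {W : Submodule ℂ N.V} (hW : N.IsStable W) (h : ∀ v, f v ∈ W) :
    IsHom M (N.sub W hW) (f.codRestrict W h) :=
  ⟨fun x v => Subtype.ext (hf.lie x v), fun x v => Subtype.ext (hf.rep x v)⟩

theorem Iso.of_bijective {M N : PreModule p} {f : M.V →ₗ[ℂ] N.V} (hf : IsHom M N f)
    (hb : Function.Bijective f) : M.Iso N :=
  ⟨LinearEquiv.ofBijective f hb, ⟨fun x v => hf.lie x v, fun x v => hf.rep x v⟩⟩

theorem Iso.symm {M N : PreModule p} (h : M.Iso N) : N.Iso M := by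
  obtain ⟨e, he⟩ := h
  refine ⟨e.symm, ⟨fun x v => ?_, fun x v => ?_⟩⟩
  · refine e.injective ?_
    have := he.lie x (e.symm v)
    simp only [LinearEquiv.coe_coe, LinearEquiv.apply_symm_apply] at this ⊢
    exact this.symm
  · refine e.injective ?_
    have := he.rep x (e.symm v)
    simp only [LinearEquiv.coe_coe, LinearEquiv.apply_symm_apply] at this ⊢
    exact this.symm

theorem Iso.trans {M N O : PreModule p} (h : M.Iso N) (h' : N.Iso O) : M.Iso O := by
  obtain ⟨e, he⟩ := h
  obtain ⟨e', he'⟩ := h'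
  exact ⟨e.trans e', he'.comp he⟩

theorem Iso.res {q : Subpair P} (h : p ≤ q) {M N : PreModule q} (hi : M.Iso N) :
    (M.res h).Iso (N.res h) := by
  obtain ⟨e, he⟩ := hi
  exact ⟨e, he.res h⟩

/-- If a homomorphism `φ` vanishes on the kernel of a surjective homomorphism `g`, it factors
through `g`. -/
theorem IsHom.exists_factor {M N O : PreModule p} {g : M.V →ₗ[ℂ] N.V} {φ : M.V →ₗ[ℂ] O.V}
    (hg : IsHom M N g) (hs : Function.Surjective g) (hφ : IsHom M O φ)
    (h : ∀ v, g v = 0 → φ v = 0) : ∃ ψ : N.V →ₗ[ℂ] O.V, IsHom N O ψ ∧ ∀ v, ψ (g v) = φ v := by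
  obtain ⟨s, hs'⟩ := LinearMap.exists_rightInverse_of_surjective g (LinearMap.range_eq_top.2 hs)
  have key : ∀ v, φ (s (g v)) = φ v := fun v => by
    rw [← sub_eq_zero, ← map_sub]
    apply h
    rw [map_sub, sub_eq_zero]
    exact LinearMap.congr_fun hs' (g v)
  refine ⟨φ ∘ₗ s, hg.of_comp_surjective hs fun φ' hφ' => ?_, key⟩
  obtain rfl : φ' = φ := LinearMap.ext fun v => (hφ' v).trans (key v)
  exact hφ

/-- A homomorphism whose image lies in the image of an injective homomorphism `i` factors
through `i`. -/
theorem IsHom.exists_lift {M N O : PreModule p} {i : N.V →ₗ[ℂ] O.V} {φ : M.V →ₗ[ℂ] O.V}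
    (hi : IsHom N O i) (hj : Function.Injective i) (hφ : IsHom M O φ)
    (h : ∀ v, ∃ w, i w = φ v) : ∃ ψ : M.V →ₗ[ℂ] N.V, IsHom M N ψ ∧ ∀ v, i (ψ v) = φ v := by
  obtain ⟨s, hs⟩ := LinearMap.exists_leftInverse_of_injective i (LinearMap.ker_eq_bot.2 hj)
  have key : ∀ v, i (s (φ v)) = φ v := fun v => by
    obtain ⟨w, hw⟩ := h v
    rw [← hw]
    exact congrArg i (LinearMap.congr_fun hs w)
  refine ⟨s ∘ₗ φ, hi.of_injective_comp hj ?_, key⟩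
  rw [show i ∘ₗ s ∘ₗ φ = φ from LinearMap.ext key]
  exact hφ

theorem IsHom.shortExact_ker {M N : PreModule p} {g : M.V →ₗ[ℂ] N.V} (hg : IsHom M N g)
    (hs : Function.Surjective g) :
    IsShortExact (M.sub (LinearMap.ker g) hg.stable_ker) M N (LinearMap.ker g).subtype g :=
  ⟨M.isHom_subtype _, hg, Subtype.val_injective, Submodule.range_subtype _, hs⟩

theorem IsHom.shortExact_coker {M N : PreModule p} {f : M.V →ₗ[ℂ] N.V} (hf : IsHom M N f)
    (hi : Function.Injective f) :
    IsShortExact M N (N.quot (LinearMap.range f) hf.stable_range) f (LinearMap.range f).mkQ :=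
  ⟨hf, N.isHom_mkQ _, hi, (Submodule.ker_mkQ _).symm, Submodule.mkQ_surjective _⟩

theorem IsHom.exists_shortExact_coker {M N : PreModule p} {f : M.V →ₗ[ℂ] N.V} (hf : IsHom M N f)
    (hi : Function.Injective f) :
    ∃ c, IsShortExact M N (N.quot (LinearMap.range f) hf.stable_range) f c :=
  ⟨_, hf.shortExact_coker hi⟩

theorem shortExact_sub_quot (M : PreModule p) (W : Submodule ℂ M.V) (hW : M.IsStable W) :
    IsShortExact (M.sub W hW) M (M.quot W hW) W.subtype W.mkQ :=
  ⟨M.isHom_subtype _, M.isHom_mkQ _, Subtype.val_injective,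
    (Submodule.range_subtype _).trans (Submodule.ker_mkQ _).symm, Submodule.mkQ_surjective _⟩

end PreModule

theorem IsShortExact.mem_range_iff {A B C : PreModule p} {f : A.V →ₗ[ℂ] B.V} {g : B.V →ₗ[ℂ] C.V}
    (h : IsShortExact A B C f g) {b : B.V} : g b = 0 ↔ ∃ a, f a = b := by
  rw [← LinearMap.mem_ker, ← h.exact, LinearMap.mem_range]

theorem IsShortExact.apply_apply {A B C : PreModule p} {f : A.V →ₗ[ℂ] B.V} {g : B.V →ₗ[ℂ] C.V}
    (h : IsShortExact A B C f g) (a : A.V) : g (f a) = 0 := h.mem_range_iff.2 ⟨a, rfl⟩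

/-- An elementwise form of exactness. -/
theorem IsShortExact.of_forall {A B C : PreModule p} {f : A.V →ₗ[ℂ] B.V} {g : B.V →ₗ[ℂ] C.V}
    (hf : IsHom A B f) (hg : IsHom B C g) (hi : Function.Injective f) (hs : Function.Surjective g)
    (h₁ : ∀ a, g (f a) = 0) (h₂ : ∀ b, g b = 0 → ∃ a, f a = b) : IsShortExact A B C f g :=
  ⟨hf, hg, hi, le_antisymm (by rintro _ ⟨a, rfl⟩; exact h₁ a) fun b hb => h₂ b hb, hs⟩

/-! ### Modules filtered by objects of an abelian subcategory -/

/-- `HasClass 𝓒 M x`: the module `M` has a finite filtration by submodules whose graded pieces lie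
in `𝓒`, and `x ∈ K(𝓒)` is the sum of the classes of these pieces.  If `𝓒` is an abelian
subcategory, `x` is determined by `M` (`HasClass.unique`). -/
inductive HasClass (𝓒 : PreModule p → Prop) : PreModule p → GrothendieckGroup 𝓒 → Prop
  | zero (M : PreModule p) (h : Subsingleton M.V) : HasClass 𝓒 M 0
  | ext {A M N : PreModule p} {f : A.V →ₗ[ℂ] M.V} {g : M.V →ₗ[ℂ] N.V} (hA : 𝓒 A)
      {x : GrothendieckGroup 𝓒} (hN : HasClass 𝓒 N x) (h : IsShortExact A M N f g) :
      HasClass 𝓒 M (GrothendieckGroup.cls A hA + x)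

namespace HasClass

open GrothendieckGroup

variable {𝓒 : PreModule p → Prop}

theorem of_eq {M : PreModule p} {x y : GrothendieckGroup 𝓒} (h : HasClass 𝓒 M x) (e : x = y) :
    HasClass 𝓒 M y := e ▸ h

theorem iso {M N : PreModule p} {x : GrothendieckGroup 𝓒} (h : HasClass 𝓒 M x) (e : M.Iso N) :
    HasClass 𝓒 N x := by
  obtain ⟨e', he⟩ := e.symm
  cases h with
  | zero _ h => exact zero _ (e'.toEquiv.subsingleton)
  | ext hA hN h =>
    obtain ⟨e, he⟩ := e
    refine ext hA hN (IsShortExact.of_forall (he.comp h.hom_left) (h.hom_right.comp ?_)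
      (e.injective.comp h.injective) (h.surjective.comp e.symm.surjective) ?_ ?_)
    · refine he.of_comp_surjective e.surjective fun φ hφ => ?_
      rw [show φ = LinearMap.id from LinearMap.ext fun v => by simpa using hφ v]
      exact IsHom.id M
    · intro a
      simpa using h.apply_apply a
    · intro b hb
      obtain ⟨a, ha⟩ := h.mem_range_iff.1 hb
      exact ⟨a, by simp [ha]⟩

theorem of_mem {M : PreModule p} (hM : 𝓒 M) : HasClass 𝓒 M (cls M hM) := by
  have h := (IsHom.id M).shortExact_coker Function.injective_id
  refine of_eq (ext hM (zero _ ?_) h) (add_zero _)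
  refine ⟨fun a b => ?_⟩
  obtain ⟨a, rfl⟩ := h.surjective a
  obtain ⟨b, rfl⟩ := h.surjective b
  exact (h.apply_apply a).trans (h.apply_apply b).symm

theorem eq_zero {M : PreModule p} {x : GrothendieckGroup 𝓒} (h : HasClass 𝓒 M x)
    (hM : Subsingleton M.V) : x = 0 := by
  induction h with
  | zero => rfl
  | ext hA hN h ih =>
    rw [ih h.surjective.subsingleton, cls_of_subsingleton hA h.injective.subsingleton, add_zero]

/-- An extension of two filtered modules is filtered. -/
theorem extension {A B C : PreModule p} {f : A.V →ₗ[ℂ] B.V} {g : B.V →ₗ[ℂ] C.V}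
    {x z : GrothendieckGroup 𝓒} (hA : HasClass 𝓒 A x) (hC : HasClass 𝓒 C z)
    (h : IsShortExact A B C f g) : HasClass 𝓒 B (x + z) := by
  induction hA generalizing B C z with
  | zero A hA =>
    rw [zero_add]
    refine hC.iso (Iso.symm (Iso.of_bijective h.hom_right ⟨?_, h.surjective⟩))
    rw [← LinearMap.ker_eq_bot, LinearMap.ker_eq_bot']
    intro b hb
    obtain ⟨a, rfl⟩ := h.mem_range_iff.1 hb
    rw [Subsingleton.elim a 0, map_zero]
  | @ext A₀ A N i π hA x hN h₀ ih =>
    obtain ⟨q, hB⟩ := (h.hom_left.comp h₀.hom_left).exists_shortExact_coker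
      (h.injective.comp h₀.injective)
    obtain ⟨f', hf', ef⟩ := h₀.hom_right.exists_factor h₀.surjective
      (hB.hom_right.comp h.hom_left) (fun v hv => by
        obtain ⟨a, rfl⟩ := h₀.mem_range_iff.1 hv
        exact hB.apply_apply a)
    obtain ⟨g', hg', eg⟩ := hB.hom_right.exists_factor hB.surjective h.hom_right (fun v hv => by
        obtain ⟨a, rfl⟩ := hB.mem_range_iff.1 hv
        exact h.apply_apply _)
    rw [add_assoc]
    refine ext hA (ih hC (f := f') (g := g') (IsShortExact.of_forall hf' hg' ?_ ?_ ?_ ?_)) hB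
    · rw [← LinearMap.ker_eq_bot, LinearMap.ker_eq_bot']
      intro n hn
      obtain ⟨a, rfl⟩ := h₀.surjective n
      rw [ef] at hn
      obtain ⟨a₀, ha⟩ := hB.mem_range_iff.1 hn
      rw [h₀.mem_range_iff]
      exact ⟨a₀, h.injective ha⟩
    · intro c
      obtain ⟨b, rfl⟩ := h.surjective c
      exact ⟨_, eg b⟩
    · intro n
      obtain ⟨a, rfl⟩ := h₀.surjective n
      rw [ef]
      exact (eg _).trans (h.apply_apply a)
    · intro b hb
      obtain ⟨b, rfl⟩ := hB.surjective b
      rw [eg] at hb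
      obtain ⟨a, rfl⟩ := h.mem_range_iff.1 hb
      exact ⟨π a, ef a⟩

end HasClass

/-- An exact sequence `0 → K → A → B → C → 0`. -/
structure IsExactFour (K A B C : PreModule p) (k : K.V →ₗ[ℂ] A.V) (f : A.V →ₗ[ℂ] B.V)
    (c : B.V →ₗ[ℂ] C.V) : Prop where
  hom_ker : IsHom K A k
  hom : IsHom A B f
  hom_coker : IsHom B C c
  injective : Function.Injective k
  ker_iff : ∀ {a}, f a = 0 ↔ ∃ x, k x = a
  range_iff : ∀ {b}, c b = 0 ↔ ∃ a, f a = b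
  surjective : Function.Surjective c

theorem PreModule.IsHom.exactFour {A B : PreModule p} {f : A.V →ₗ[ℂ] B.V} (hf : IsHom A B f) :
    IsExactFour (A.sub (LinearMap.ker f) hf.stable_ker) A B
      (B.quot (LinearMap.range f) hf.stable_range) (LinearMap.ker f).subtype f
      (LinearMap.range f).mkQ :=
  ⟨A.isHom_subtype _, hf, B.isHom_mkQ _, Subtype.val_injective,
    fun {a} => ⟨fun h => ⟨⟨a, h⟩, rfl⟩, by rintro ⟨x, rfl⟩; exact x.2⟩,
    fun {_} => Submodule.Quotient.mk_eq_zero _, Submodule.mkQ_surjective _⟩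

theorem PreModule.IsHom.exists_exactFour {A B : PreModule p} {f : A.V →ₗ[ℂ] B.V}
    (hf : IsHom A B f) : ∃ (K C : PreModule p) (k : K.V →ₗ[ℂ] A.V) (c : B.V →ₗ[ℂ] C.V),
      IsExactFour K A B C k f c :=
  ⟨_, _, _, _, hf.exactFour⟩

namespace GrothendieckGroup

variable {𝓒 : PreModule p → Prop}

theorem cls_eq_of_iso (h𝓒 : IsAbelianSubcategory 𝓒) {M N : PreModule p} (hM : 𝓒 M) (hN : 𝓒 N)
    (h : M.Iso N) : cls M hM = cls N hN := by
  obtain ⟨e, he⟩ := h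
  have hZ : Subsingleton (M.sub (LinearMap.ker e.toLinearMap) he.stable_ker).V :=
    (Submodule.subsingleton_iff_eq_bot).2 (LinearMap.ker_eq_bot.2 e.injective)
  rw [cls_add (h𝓒.zero _ hZ) hM hN (he.shortExact_ker e.surjective), cls_of_subsingleton _ hZ,
    zero_add]

/-- `[A] + [C] = [B] + [K]` for an exact sequence `0 → K → A → B → C → 0`. -/
theorem cls_exactFour (h𝓒 : IsAbelianSubcategory 𝓒) {K A B C : PreModule p}
    {k : K.V →ₗ[ℂ] A.V} {f : A.V →ₗ[ℂ] B.V} {c : B.V →ₗ[ℂ] C.V} (h : IsExactFour K A B C k f c)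
    (hA : 𝓒 A) (hB : 𝓒 B) :
    ∃ (hK : 𝓒 K) (hC : 𝓒 C), cls A hA + cls C hC = cls B hB + cls K hK := by
  have hK : 𝓒 K := by
    obtain ⟨k', hk', ek⟩ := (A.isHom_subtype h.hom.stable_ker).exists_lift Subtype.val_injective
      h.hom_ker fun v => ⟨⟨k v, h.ker_iff.2 ⟨v, rfl⟩⟩, rfl⟩
    refine h𝓒.iso _ _ (Iso.of_bijective hk' ⟨fun a b hab => h.injective ?_, ?_⟩).symm
      (h𝓒.ker A B f h.hom hA hB)
    · rw [← ek, hab, ek]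
    · rintro ⟨a, ha⟩
      obtain ⟨x, rfl⟩ := h.ker_iff.1 ha
      exact ⟨x, Subtype.ext (ek x)⟩
  obtain ⟨q, hs⟩ := h.hom_ker.exists_shortExact_coker h.injective
  have hI := h𝓒.coker K A k h.hom_ker hK hA
  obtain ⟨f', hf', ef⟩ := hs.hom_right.exists_factor hs.surjective h.hom (fun v hv =>
    h.ker_iff.2 (hs.mem_range_iff.1 hv))
  have hs' : IsShortExact _ B C f' c := by
    refine IsShortExact.of_forall hf' h.hom_coker ?_ h.surjective ?_ ?_
    · rw [← LinearMap.ker_eq_bot, LinearMap.ker_eq_bot']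
      intro x hx
      obtain ⟨a, rfl⟩ := hs.surjective x
      rw [ef] at hx
      exact hs.mem_range_iff.2 (h.ker_iff.1 hx)
    · intro x
      obtain ⟨a, rfl⟩ := hs.surjective x
      rw [ef]
      exact h.range_iff.2 ⟨a, rfl⟩
    · intro b hb
      obtain ⟨a, rfl⟩ := h.range_iff.1 hb
      exact ⟨_, ef a⟩
  have hC : 𝓒 C := by
    obtain ⟨q', hq'⟩ := hf'.exists_shortExact_coker hs'.injective
    obtain ⟨c', hc', ec⟩ := hq'.hom_right.exists_factor hq'.surjective h.hom_coker (fun v hv => by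
        obtain ⟨a, rfl⟩ := hq'.mem_range_iff.1 hv
        exact hs'.apply_apply a)
    refine h𝓒.iso _ _ (Iso.of_bijective hc' ⟨?_, fun x => ?_⟩) (h𝓒.coker _ B f' hf' hI hB)
    · rw [← LinearMap.ker_eq_bot, LinearMap.ker_eq_bot']
      intro x hx
      obtain ⟨b, rfl⟩ := hq'.surjective x
      rw [ec] at hx
      exact hq'.mem_range_iff.2 (hs'.mem_range_iff.1 hx)
    · obtain ⟨b, rfl⟩ := h.surjective x
      exact ⟨_, ec b⟩
  refine ⟨hK, hC, ?_⟩
  rw [cls_add hK hA hI hs, cls_add hI hB hC hs']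
  abel

end GrothendieckGroup

namespace HasClass

open GrothendieckGroup

variable {𝓒 : PreModule p → Prop}

/-- The kernel of a homomorphism from an object of `𝓒` to a filtered module lies in `𝓒`, and the
cokernel is filtered, with `[A] + [C] = [N] + [K]`. The proof is by induction on the filtration of
`N`: for a bottom piece `A'` with quotient `N''`, the snake lemma relates the kernel and cokernel of
`A → N` to those of `A → N''` and of the induced map from `ker (A → N'')` to `A'`. -/
theorem exactFour_of_mem (h𝓒 : IsAbelianSubcategory 𝓒) {A N : PreModule p} (hA : 𝓒 A)
    {z : GrothendieckGroup 𝓒} (hN : HasClass 𝓒 N z) {K C : PreModule p} {k : K.V →ₗ[ℂ] A.V}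
    {f : A.V →ₗ[ℂ] N.V} {c : N.V →ₗ[ℂ] C.V} (h : IsExactFour K A N C k f c) :
    ∃ (hK : 𝓒 K) (w : GrothendieckGroup 𝓒), HasClass 𝓒 C w ∧ cls A hA + w = z + cls K hK := by
  induction hN generalizing K C with
  | zero N hN =>
    obtain ⟨hK, hC, e⟩ := cls_exactFour h𝓒 h hA (h𝓒.zero N hN)
    exact ⟨hK, _, of_mem hC, by rw [e, cls_of_subsingleton _ hN]⟩
  | @ext A' N N'' i π hA' z'' hN'' h₀ ih =>
    -- `Kg` and `Cg` are the kernel and the cokernel of `A → N''`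
    obtain ⟨Kg, Cg, kg, cg, hg⟩ := (h₀.hom_right.comp h.hom).exists_exactFour
    obtain ⟨hKg, w'', hw'', e⟩ := ih hg
    obtain ⟨f', hf', ef⟩ := h₀.hom_left.exists_lift h₀.injective
      (h.hom.comp hg.hom_ker) (fun v => h₀.mem_range_iff.1 (hg.ker_iff.2 ⟨v, rfl⟩))
    obtain ⟨k', hk', ek⟩ := hg.hom_ker.exists_lift hg.injective h.hom_ker (fun v => hg.ker_iff.1 (by
      rw [LinearMap.comp_apply, h.ker_iff.2 ⟨v, rfl⟩, map_zero]))
    obtain ⟨_, C', _, c', hf''⟩ := hf'.exists_exactFour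
    -- `Kg → A'` has the same kernel as `A → N`; call its cokernel `C'`
    have h' : IsExactFour K Kg A' C' k' f' c' :=
      { hf'' with
        hom_ker := hk'
        injective := fun a b hab => h.injective (by rw [← ek, hab, ek])
        ker_iff := fun {a} => by
          constructor
          · intro ha
            have : f (kg a) = 0 := by
              rw [← LinearMap.comp_apply, ← ef, ha, map_zero]
            obtain ⟨x, hx⟩ := h.ker_iff.1 this
            exact ⟨x, hg.injective ((ek x).trans hx)⟩
          · rintro ⟨x, rfl⟩
            refine h₀.injective ?_
            rw [ef, LinearMap.comp_apply, ek, h.ker_iff.2 ⟨x, rfl⟩, map_zero] }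
    obtain ⟨hK, hC', e'⟩ := cls_exactFour h𝓒 h' hKg hA'
    obtain ⟨α, hα, eα⟩ := h'.hom_coker.exists_factor h'.surjective (h.hom_coker.comp h₀.hom_left)
      (fun v hv => by
        obtain ⟨a, rfl⟩ := h'.range_iff.1 hv
        rw [LinearMap.comp_apply, ef]
        exact h.range_iff.2 ⟨_, rfl⟩)
    obtain ⟨β, hβ, eβ⟩ := h.hom_coker.exists_factor h.surjective (hg.hom_coker.comp h₀.hom_right)
      (fun v hv => by
        obtain ⟨a, rfl⟩ := h.range_iff.1 hv
        exact hg.range_iff.2 ⟨a, rfl⟩)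
    -- the end `0 → C' → C → Cg → 0` of the snake sequence
    have hs : IsShortExact _ C _ α β := by
      refine IsShortExact.of_forall hα hβ ?_ ?_ ?_ ?_
      · rw [← LinearMap.ker_eq_bot, LinearMap.ker_eq_bot']
        intro x hx
        obtain ⟨a', rfl⟩ := h'.surjective x
        rw [eα] at hx
        obtain ⟨a, ha⟩ := h.range_iff.1 hx
        have : (π ∘ₗ f) a = 0 := by
          rw [LinearMap.comp_apply, ha]
          exact h₀.apply_apply a'
        obtain ⟨y, rfl⟩ := hg.ker_iff.1 this
        refine h'.range_iff.2 ⟨y, h₀.injective ?_⟩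
        rw [ef]
        exact ha
      · intro x
        obtain ⟨n, rfl⟩ := hg.surjective x
        obtain ⟨n, rfl⟩ := h₀.surjective n
        exact ⟨_, eβ n⟩
      · intro x
        obtain ⟨a', rfl⟩ := h'.surjective x
        rw [eα, LinearMap.comp_apply, eβ, LinearMap.comp_apply, h₀.apply_apply, map_zero]
      · intro x hx
        obtain ⟨n, rfl⟩ := h.surjective x
        rw [eβ] at hx
        obtain ⟨a, ha⟩ := hg.range_iff.1 hx
        obtain ⟨a', ha'⟩ := (h₀.mem_range_iff (b := n - f a)).1 (by
          rw [map_sub, sub_eq_zero]; exact ha.symm)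
        refine ⟨c' a', (eα a').trans ?_⟩
        rw [LinearMap.comp_apply, ha', map_sub, h.range_iff.2 ⟨a, rfl⟩, sub_zero]
    refine ⟨hK, _, ext hC' hw'' hs, ?_⟩
    calc cls A hA + (cls _ hC' + w'') = (cls A hA + w'') + cls _ hC' := by abel
      _ = z'' + (cls _ hKg + cls _ hC') := by rw [e, add_assoc]
      _ = _ := by rw [e']; abel

/-- The kernel and the cokernel of a homomorphism `M → N` of filtered modules are filtered, with
`[M] + [C] = [N] + [K]`. This is proved by induction on the filtration of `M`: for a bottom piece
`A` with quotient `M'`, one passes to the induced map `M' → N / f(A)`. -/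
theorem exactFour (h𝓒 : IsAbelianSubcategory 𝓒) {M N : PreModule p} {x z : GrothendieckGroup 𝓒}
    (hM : HasClass 𝓒 M x) (hN : HasClass 𝓒 N z) {K C : PreModule p} {k : K.V →ₗ[ℂ] M.V}
    {f : M.V →ₗ[ℂ] N.V} {c : N.V →ₗ[ℂ] C.V} (h : IsExactFour K M N C k f c) :
    ∃ y w, HasClass 𝓒 K y ∧ HasClass 𝓒 C w ∧ x + w = z + y := by
  induction hM generalizing N z K C with
  | zero M hM =>
    refine ⟨0, z, zero _ h.injective.subsingleton, hN.iso (Iso.of_bijective h.hom_coker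
      ⟨?_, h.surjective⟩), by abel⟩
    rw [← LinearMap.ker_eq_bot, LinearMap.ker_eq_bot']
    intro n hn
    obtain ⟨m, rfl⟩ := h.range_iff.1 hn
    rw [Subsingleton.elim m 0, map_zero]
  | @ext A M M' i π hA x' hM' h₀ ih =>
    -- `Kg` is the kernel of `A → N`, and `N₁` is the quotient of `N` by the image of `A`
    obtain ⟨Kg, N₁, kg, q, hg⟩ := (h.hom.comp h₀.hom_left).exists_exactFour
    obtain ⟨hKg, w₁, hw₁, e⟩ := exactFour_of_mem h𝓒 hA hN hg
    obtain ⟨f', hf', ef⟩ := h₀.hom_right.exists_factor h₀.surjective (hg.hom_coker.comp h.hom)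
      (fun v hv => by
        obtain ⟨a, rfl⟩ := h₀.mem_range_iff.1 hv
        exact hg.range_iff.2 ⟨a, rfl⟩)
    obtain ⟨c', hc', ec⟩ := hg.hom_coker.exists_factor hg.surjective h.hom_coker (fun v hv => by
        obtain ⟨a, rfl⟩ := hg.range_iff.1 hv
        exact h.range_iff.2 ⟨i a, rfl⟩)
    obtain ⟨K', _, k', _, hf''⟩ := hf'.exists_exactFour
    -- `M' → N₁` has the same cokernel as `M → N`; call its kernel `K'`
    have h' : IsExactFour K' M' N₁ C k' f' c' :=
      { hf'' with
        hom_coker := hc'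
        surjective := fun x => by
          obtain ⟨n, rfl⟩ := h.surjective x
          exact ⟨_, ec n⟩
        range_iff := fun {b} => by
          obtain ⟨n, rfl⟩ := hg.surjective b
          rw [ec, h.range_iff]
          constructor
          · rintro ⟨m, rfl⟩
            exact ⟨π m, ef m⟩
          · rintro ⟨m', hm'⟩
            obtain ⟨m, rfl⟩ := h₀.surjective m'
            rw [ef, LinearMap.comp_apply, ← sub_eq_zero, ← map_sub] at hm'
            obtain ⟨a, ha⟩ := hg.range_iff.1 hm'
            refine ⟨m - i a, ?_⟩
            rw [map_sub]
            rw [LinearMap.comp_apply] at ha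
            rw [ha, sub_sub_cancel] }
    obtain ⟨y', w', hy', hw', e'⟩ := ih hw₁ h'
    obtain ⟨α, hα, eα⟩ := h.hom_ker.exists_lift h.injective (h₀.hom_left.comp hg.hom_ker)
      (fun v => h.ker_iff.1 (hg.ker_iff.2 ⟨v, rfl⟩))
    obtain ⟨β, hβ, eβ⟩ := h'.hom_ker.exists_lift h'.injective (h₀.hom_right.comp h.hom_ker)
      (fun v => h'.ker_iff.1 (by
        rw [LinearMap.comp_apply, ef, LinearMap.comp_apply, h.ker_iff.2 ⟨v, rfl⟩, map_zero]))
    -- the beginning `0 → Kg → K → K' → 0` of the snake sequence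
    have hs : IsShortExact _ K _ α β := by
      refine IsShortExact.of_forall hα hβ ?_ ?_ ?_ ?_
      · intro a b hab
        refine hg.injective (h₀.injective ?_)
        have := congrArg k hab
        rw [eα, eα] at this
        exact this
      · intro x
        have hx := h'.ker_iff.2 ⟨x, rfl⟩
        obtain ⟨m, hm⟩ := h₀.surjective (k' x)
        rw [← hm, ef] at hx
        obtain ⟨a, ha⟩ := hg.range_iff.1 hx
        obtain ⟨y, hy⟩ := (h.ker_iff (a := m - i a)).1 (by
          rw [map_sub, sub_eq_zero]; exact ha.symm)
        refine ⟨y, h'.injective ?_⟩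
        rw [eβ, LinearMap.comp_apply, hy, map_sub, h₀.apply_apply, sub_zero, hm]
      · intro x
        refine h'.injective ?_
        rw [eβ, LinearMap.comp_apply, eα, LinearMap.comp_apply, h₀.apply_apply, map_zero]
      · intro y hy
        have h1 : π (k y) = 0 := by
          have := eβ y
          rw [hy, map_zero] at this
          exact this.symm
        obtain ⟨a, ha⟩ := h₀.mem_range_iff.1 h1
        obtain ⟨x, hx⟩ := (hg.ker_iff (a := a)).1 (by
          rw [LinearMap.comp_apply, ha]; exact h.ker_iff.2 ⟨y, rfl⟩)
        refine ⟨x, h.injective ?_⟩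
        rw [eα, LinearMap.comp_apply, hx, ha]
    refine ⟨_, w', ext hKg hy' hs, hw', ?_⟩
    rw [add_assoc, e', ← add_assoc, e]
    abel

/-- The class of a filtered module does not depend on the filtration: compare two filtrations by
the identity map, whose kernel and cokernel vanish. -/
theorem unique (h𝓒 : IsAbelianSubcategory 𝓒) {M : PreModule p} {x y : GrothendieckGroup 𝓒}
    (hx : HasClass 𝓒 M x) (hy : HasClass 𝓒 M y) : x = y := by
  obtain ⟨_, _, _, _, h⟩ := (IsHom.id M).exists_exactFour
  obtain ⟨a, b, ha, hb, e⟩ := exactFour h𝓒 hx hy h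
  have h1 : a = 0 := ha.eq_zero ⟨fun a b => h.injective ((h.ker_iff.2 ⟨a, rfl⟩).trans
    (h.ker_iff.2 ⟨b, rfl⟩).symm)⟩
  have h2 : b = 0 := hb.eq_zero ⟨fun a b => by
    obtain ⟨a, rfl⟩ := h.surjective a
    obtain ⟨b, rfl⟩ := h.surjective b
    exact (h.range_iff.2 ⟨a, rfl⟩).trans (h.range_iff.2 ⟨b, rfl⟩).symm⟩
  simpa [h1, h2] using e

/-- In an exact sequence `A → B → C → D → E`, the middle term is an extension of the kernel of
`D → E` by the cokernel of `A → B`. -/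
theorem of_exact {A B C D E K Q : PreModule p} {φ : A.V →ₗ[ℂ] B.V} {ψ : B.V →ₗ[ℂ] C.V}
    {χ : C.V →ₗ[ℂ] D.V} {η : D.V →ₗ[ℂ] E.V} {j : K.V →ₗ[ℂ] D.V} {c : B.V →ₗ[ℂ] Q.V}
    (hψ : IsHom B C ψ) (hχ : IsHom C D χ) (_hη : IsHom D E η) (hj : IsHom K D j) (hc : IsHom B Q c)
    (hji : Function.Injective j) (hcs : Function.Surjective c)
    (h₁ : ∀ b, c b = 0 ↔ ∃ a, φ a = b) (h₂ : LinearMap.range φ = LinearMap.ker ψ)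
    (h₃ : LinearMap.range ψ = LinearMap.ker χ) (h₄ : LinearMap.range χ = LinearMap.ker η)
    (h₅ : ∀ d, η d = 0 ↔ ∃ x, j x = d) {x y : GrothendieckGroup 𝓒}
    (hQ : HasClass 𝓒 Q x) (hK : HasClass 𝓒 K y) : HasClass 𝓒 C (x + y) := by
  have h₂' : ∀ b, ψ b = 0 ↔ c b = 0 := fun b => by
    rw [h₁, ← LinearMap.mem_ker, ← h₂, LinearMap.mem_range]
  obtain ⟨α, hα, eα⟩ := hc.exists_factor hcs hψ (fun v hv => (h₂' v).2 hv)
  obtain ⟨β, hβ, eβ⟩ := hj.exists_lift hji hχ (fun v => (h₅ _).1 (by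
    rw [← LinearMap.mem_ker, ← h₄]; exact ⟨v, rfl⟩))
  refine extension hQ hK (f := α) (g := β) (IsShortExact.of_forall hα hβ ?_ ?_ ?_ ?_)
  · rw [← LinearMap.ker_eq_bot, LinearMap.ker_eq_bot']
    intro q hq
    obtain ⟨b, rfl⟩ := hcs q
    rw [eα] at hq
    exact (h₂' b).1 hq
  · intro x
    have : j x ∈ LinearMap.range χ := h₄ ▸ (h₅ _).2 ⟨x, rfl⟩
    obtain ⟨c, hc⟩ := this
    exact ⟨c, hji (by rw [eβ, hc])⟩
  · intro q
    obtain ⟨b, rfl⟩ := hcs q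
    have : ψ b ∈ LinearMap.ker χ := h₃ ▸ ⟨b, rfl⟩
    exact hji (by rw [eβ, eα, map_zero]; exact this)
  · intro v hv
    have : v ∈ LinearMap.range ψ := by
      rw [h₃, LinearMap.mem_ker, ← eβ, hv, map_zero]
    obtain ⟨b, rfl⟩ := this
    exact ⟨c b, eα b⟩

end HasClass

/-! ### Euler characteristics of cohomology in the extension closure -/

/-- `HasEulerChar hr 𝓛 M x`: all the `Hⁿ(𝔲; M)` are filtered by objects of `𝓛`, and
`x = ∑ₙ (-1)ⁿ [Hⁿ(𝔲; M)]` in `K(𝓛)`. Since `𝓛` need not be closed under extensions, the middle term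
of a long exact sequence with the other terms in `𝓛` may lie outside `𝓛`; filtered modules have the
two-out-of-three property (`HasEulerChar.right`, `HasEulerChar.middle`). -/
def HasEulerChar {r : Subpair P} (hr : r ≤ p) (𝓛 : PreModule r → Prop) (M : PreModule p)
    (x : GrothendieckGroup 𝓛) : Prop :=
  ∃ c : ℕ → GrothendieckGroup 𝓛, (∀ n, HasClass 𝓛 ((M.cohomology n).res hr) (c n)) ∧
    x = ∑ n ∈ Finset.range (Module.finrank ℂ p.nilRad + 1), (-1 : ℤ) ^ n • c n

theorem PreModule.subsingleton_cohomology_of_subsingleton (M : PreModule p) (h : Subsingleton M.V)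
    (n : ℕ) : Subsingleton (M.cohomology n).V := by
  refine ⟨fun y y' => ?_⟩
  obtain ⟨z, hz, rfl⟩ := M.coh_surj n y
  obtain ⟨z', hz', rfl⟩ := M.coh_surj n y'
  obtain rfl : z = z' := ev_ext fun v => Subsingleton.elim _ _
  rfl

theorem PreModule.IsHom.exists_res_exactFour {r : Subpair P} (hr : r ≤ p) {A B : PreModule p}
    {f : A.V →ₗ[ℂ] B.V} (hf : IsHom A B f) : ∃ (K C : PreModule r) (k : K.V →ₗ[ℂ] (A.res hr).V)
      (c : (B.res hr).V →ₗ[ℂ] C.V), IsExactFour K (A.res hr) (B.res hr) C k f c :=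
  (hf.res hr).exists_exactFour

namespace HasEulerChar

open GrothendieckGroup

variable {r : Subpair P} {hr : r ≤ p} {𝓛 : PreModule r → Prop}

theorem unique (h𝓛 : IsAbelianSubcategory 𝓛) {M : PreModule p} {x y : GrothendieckGroup 𝓛}
    (hx : HasEulerChar hr 𝓛 M x) (hy : HasEulerChar hr 𝓛 M y) : x = y := by
  obtain ⟨c, hc, rfl⟩ := hx
  obtain ⟨c', hc', rfl⟩ := hy
  exact Finset.sum_congr rfl fun n _ => by rw [(hc n).unique h𝓛 (hc' n)]

theorem of_subsingleton (M : PreModule p) (h : Subsingleton M.V) : HasEulerChar hr 𝓛 M 0 :=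
  ⟨0, fun n => HasClass.zero _ (M.subsingleton_cohomology_of_subsingleton h n), by simp⟩

/-- `H^{d+1}(𝔲; M) = 0` for `d = dim 𝔲`. -/
theorem class_eq_zero {M : PreModule p} {c : ℕ → GrothendieckGroup 𝓛}
    (hc : ∀ n, HasClass 𝓛 ((M.cohomology n).res hr) (c n)) :
    c (Module.finrank ℂ p.nilRad + 1) = 0 :=
  (hc _).eq_zero (M.subsingleton_cohomology (Nat.lt_succ_self _))

variable {A B C : PreModule p} {f : A.V →ₗ[ℂ] B.V} {g : B.V →ₗ[ℂ] C.V}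

/-- The quotient in a short exact sequence. Here `Hⁿ(𝔲; C)` is an extension of the kernel, with
class `y (n + 1)`, of `Hⁿ⁺¹(𝔲; A) → Hⁿ⁺¹(𝔲; B)` by the cokernel, with class `w n`, of
`Hⁿ(𝔲; A) → Hⁿ(𝔲; B)`. -/
theorem right (h𝓛 : IsAbelianSubcategory 𝓛) (h : IsShortExact A B C f g)
    {x y : GrothendieckGroup 𝓛} (hA : HasEulerChar hr 𝓛 A x) (hB : HasEulerChar hr 𝓛 B y) :
    HasEulerChar hr 𝓛 C (y - x) := by
  obtain ⟨a, ha, rfl⟩ := hA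
  obtain ⟨b, hb, rfl⟩ := hB
  choose δ hδ hδ₁ hδ₂ using fun n => long_exact h n
  choose K Q k q hkq using fun n => (cohMap_isHom h.hom_left n).exists_res_exactFour hr
  choose y w hy hw e using fun n => (ha n).exactFour h𝓛 (hb n) (hkq n)
  refine ⟨fun n => w n + y (n + 1), fun n => ?_, ?_⟩
  · exact HasClass.of_exact ((cohMap_isHom h.hom_right n).res hr) ((hδ n).res hr)
      ((cohMap_isHom h.hom_left (n + 1)).res hr) (hkq (n + 1)).hom_ker (hkq n).hom_coker
      (hkq (n + 1)).injective (hkq n).surjective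
      (fun _ => (hkq n).range_iff) (cohMap_exact h n) (hδ₁ n) (hδ₂ n)
      (fun _ => (hkq (n + 1)).ker_iff) (hw n) (hy (n + 1))
  · have y0 : y 0 = 0 := (hy 0).eq_zero ⟨fun s t => (hkq 0).injective (by
      have h0 := cohMap_zero_injective h
      rw [LinearMap.ker_eq_bot'] at h0
      rw [h0 _ ((hkq 0).ker_iff.2 ⟨s, rfl⟩), h0 _ ((hkq 0).ker_iff.2 ⟨t, rfl⟩)])⟩
    have yN : y (Module.finrank ℂ p.nilRad + 1) = 0 := (hy _).eq_zero
      (have : Subsingleton ((A.cohomology (Module.finrank ℂ p.nilRad + 1)).res hr).V :=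
        A.subsingleton_cohomology (Nat.lt_succ_self _)
      (hkq _).injective.subsingleton)
    -- `a n + w n = b n + y n` makes the sum telescope, and `y` vanishes at both ends
    have tele : ∀ N : ℕ, ∑ n ∈ Finset.range N, (-1 : ℤ) ^ n • (w n + y (n + 1)) =
        ∑ n ∈ Finset.range N, (-1 : ℤ) ^ n • b n - ∑ n ∈ Finset.range N, (-1 : ℤ) ^ n • a n +
          y 0 - (-1 : ℤ) ^ N • y N := by
      intro N
      induction N with
      | zero => simp
      | succ N ih =>
        simp only [Finset.sum_range_succ, ih]
        have : w N = b N + y N - a N := eq_sub_of_add_eq (by rw [add_comm]; exact e N)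
        rw [this, pow_succ]
        module
    rw [tele, y0, yN]
    simp

/-- The middle term of a short exact sequence. Here `Hⁿ(𝔲; B)` is an extension of the kernel, with
class `y n`, of the connecting map `Hⁿ(𝔲; C) → Hⁿ⁺¹(𝔲; A)` by the cokernel of the preceding one. -/
theorem middle (h𝓛 : IsAbelianSubcategory 𝓛) (h : IsShortExact A B C f g)
    {x z : GrothendieckGroup 𝓛} (hA : HasEulerChar hr 𝓛 A x) (hC : HasEulerChar hr 𝓛 C z) :
    HasEulerChar hr 𝓛 B (x + z) := by
  obtain ⟨a, ha, rfl⟩ := hA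
  obtain ⟨c, hc, rfl⟩ := hC
  choose δ hδ hδ₁ hδ₂ using fun n => long_exact h n
  choose K Q k q hkq using fun n => (hδ n).exists_res_exactFour hr
  choose y w hy hw e using fun n => (hc n).exactFour h𝓛 (ha (n + 1)) (hkq n)
  -- in degree `0` there is no preceding connecting map, and its cokernel is replaced by `H⁰(𝔲; A)`
  refine ⟨fun n => (Nat.casesOn n (a 0) w : GrothendieckGroup 𝓛) + y n, fun n => ?_, ?_⟩
  · cases n with
    | zero =>
      refine HasClass.of_exact (A := (A.cohomology 0).res hr) (B := (A.cohomology 0).res hr)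
        (φ := 0) ((cohMap_isHom h.hom_left 0).res hr) ((cohMap_isHom h.hom_right 0).res hr)
        ((hδ 0).res hr) (hkq 0).hom_ker (IsHom.id _) (hkq 0).injective Function.surjective_id
        (fun b => ⟨fun hb => ⟨0, hb.symm⟩, by rintro ⟨_, rfl⟩; rfl⟩) ?_ (cohMap_exact h 0) (hδ₁ 0)
        (fun _ => (hkq 0).ker_iff) (ha 0) (hy 0)
      exact LinearMap.range_zero.trans (cohMap_zero_injective h).symm
    | succ n =>
      exact HasClass.of_exact ((cohMap_isHom h.hom_left (n + 1)).res hr)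
        ((cohMap_isHom h.hom_right (n + 1)).res hr) ((hδ (n + 1)).res hr) (hkq (n + 1)).hom_ker
        (hkq n).hom_coker
        (hkq (n + 1)).injective (hkq n).surjective (fun _ => (hkq n).range_iff) (hδ₂ n)
        (cohMap_exact h (n + 1)) (hδ₁ (n + 1)) (fun _ => (hkq (n + 1)).ker_iff) (hw n) (hy (n + 1))
  · have aN := class_eq_zero ha
    have wN : w (Module.finrank ℂ p.nilRad) = 0 := (hw _).eq_zero
      (have : Subsingleton ((A.cohomology (Module.finrank ℂ p.nilRad + 1)).res hr).V :=
        A.subsingleton_cohomology (Nat.lt_succ_self _)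
      (hkq _).surjective.subsingleton)
    -- `c n + w n = a (n + 1) + y n` makes the sum telescope
    have tele : ∀ N : ℕ, ∑ n ∈ Finset.range (N + 1), (-1 : ℤ) ^ n •
        ((Nat.casesOn n (a 0) w : GrothendieckGroup 𝓛) + y n) =
        ∑ n ∈ Finset.range (N + 1), (-1 : ℤ) ^ n • a n +
        ∑ n ∈ Finset.range (N + 1), (-1 : ℤ) ^ n • c n
          + (-1 : ℤ) ^ N • (w N - a (N + 1)) := by
      intro N
      induction N with
      | zero =>
        have : y 0 = c 0 + w 0 - a 1 := eq_sub_of_add_eq (by rw [add_comm]; exact (e 0).symm)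
        simp [this]
        abel
      | succ N ih =>
        rw [Finset.sum_range_succ, ih]
        have : y (N + 1) = c (N + 1) + w (N + 1) - a (N + 2) :=
          eq_sub_of_add_eq (by rw [add_comm]; exact (e (N + 1)).symm)
        simp only [Finset.sum_range_succ _ (N + 1), this, pow_succ]
        module
    rw [tele, aN, wN]
    simp

theorem iso (h𝓛 : IsAbelianSubcategory 𝓛) {M N : PreModule p} {x : GrothendieckGroup 𝓛}
    (h : HasEulerChar hr 𝓛 M x) (e : M.Iso N) : HasEulerChar hr 𝓛 N x := by
  obtain ⟨e, he⟩ := e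
  obtain ⟨c, hc⟩ := he.exists_shortExact_coker e.injective
  have := middle h𝓛 hc h (of_subsingleton _ ⟨fun s t => by
    obtain ⟨s, rfl⟩ := hc.surjective s
    obtain ⟨t, rfl⟩ := hc.surjective t
    obtain ⟨s, rfl⟩ := e.surjective s
    obtain ⟨t, rfl⟩ := e.surjective t
    exact (hc.apply_apply s).trans (hc.apply_apply t).symm⟩)
  rwa [add_zero] at this

end HasEulerChar

/-! ### Tensor products -/

section Linear

variable {U X Y : Type*} [AddCommGroup U] [Module ℂ U] [AddCommGroup X] [Module ℂ X]
  [AddCommGroup Y] [Module ℂ Y] {n : ℕ}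

/-- The map `X ⊗ Alt(Uⁿ, Y) → Alt(Uⁿ, X ⊗ Y)`, `x ⊗ f ↦ (v ↦ x ⊗ f(v))`. -/
def altTensor (U X Y : Type*) [AddCommGroup U] [Module ℂ U] [AddCommGroup X] [Module ℂ X]
    [AddCommGroup Y] [Module ℂ Y] (n : ℕ) :
    X ⊗[ℂ] (U [⋀^Fin n]→ₗ[ℂ] Y) →ₗ[ℂ] U [⋀^Fin n]→ₗ[ℂ] (X ⊗[ℂ] Y) :=
  TensorProduct.lift (LinearMap.mk₂ ℂ
    (fun x f => (TensorProduct.mk ℂ X Y x).compAlternatingMap f)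
    (fun x x' f => by ext v; simp)
    (fun c x f => by ext v; simp [TensorProduct.smul_tmul'])
    (fun x f f' => by ext v; simp)
    (fun c x f => by ext v; simp))

@[simp] theorem altTensor_tmul (x : X) (f : U [⋀^Fin n]→ₗ[ℂ] Y) :
    altTensor U X Y n (x ⊗ₜ f) = (TensorProduct.mk ℂ X Y x).compAlternatingMap f := by
  simp [altTensor]

theorem altTensor_bijective [FiniteDimensional ℂ U] :
    Function.Bijective (altTensor U X Y n) := by
  have e : altTensor U X Y n =
      ((exteriorPower.alternatingMapLinearEquiv (R := ℂ) (n := n) (M := U) (N := X ⊗[ℂ] Y)).symm.toLinearMap ∘ₗ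
      (lTensorHomEquivHomLTensor ℂ (⋀[ℂ]^n U) X Y).toLinearMap) ∘ₗ
      (TensorProduct.congr (LinearEquiv.refl ℂ X)
        (exteriorPower.alternatingMapLinearEquiv (R := ℂ) (n := n) (M := U) (N := Y))).toLinearMap := by
    refine TensorProduct.ext' fun x f => ?_
    ext v
    simp
  rw [e]
  simp only [LinearMap.coe_comp, LinearEquiv.coe_coe]
  exact ((LinearEquiv.bijective _).comp (LinearEquiv.bijective _)).comp (LinearEquiv.bijective _)

end Linear

namespace PreModule

/-- Pure tensors in `M ⊗ N`. -/
def tmul {M N : PreModule p} (a : M.V) (b : N.V) : (M.tensor N).V := a ⊗ₜ[ℂ] b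

theorem tensor_ext {M N : PreModule p} {X : Type*} [AddCommGroup X] [Module ℂ X]
    {φ ψ : (M.tensor N).V →ₗ[ℂ] X} (h : ∀ a b, φ (tmul a b) = ψ (tmul a b)) : φ = ψ :=
  TensorProduct.ext' (R := ℂ) (M := M.V) (N := N.V) h

theorem tensor_lie_tmul {M N : PreModule p} (x : p.alg) (a : M.V) (b : N.V) :
    (M.tensor N).lie x (tmul a b) = tmul (M.lie x a) b + tmul a (N.lie x b) := rfl

theorem tensor_rep_tmul {M N : PreModule p} (k : p.grp) (a : M.V) (b : N.V) :
    (M.tensor N).rep k (tmul a b) = tmul (M.rep k a) (N.rep k b) := rfl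

/-- A linear map out of a tensor product is a homomorphism if it is equivariant on pure tensors. -/
theorem IsHom.of_tmul {M N O : PreModule p} {φ : (M.tensor N).V →ₗ[ℂ] O.V}
    (h₁ : ∀ x (a : M.V) (b : N.V), φ (tmul (M.lie x a) b) + φ (tmul a (N.lie x b)) =
      O.lie x (φ (tmul a b)))
    (h₂ : ∀ k (a : M.V) (b : N.V), φ (tmul (M.rep k a) (N.rep k b)) = O.rep k (φ (tmul a b))) :
    IsHom (M.tensor N) O φ where
  lie x := LinearMap.congr_fun (tensor_ext (φ := φ ∘ₗ (M.tensor N).lie x) (ψ := O.lie x ∘ₗ φ)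
    fun a b => by
      rw [LinearMap.comp_apply, tensor_lie_tmul, map_add, h₁]; rfl)
  rep k := LinearMap.congr_fun (tensor_ext (φ := φ ∘ₗ (M.tensor N).rep k) (ψ := O.rep k ∘ₗ φ)
    fun a b => by
      rw [LinearMap.comp_apply, tensor_rep_tmul, h₂]; rfl)

/-- The map `F ⊗ M → F ⊗ N` induced by `f : M → N`. -/
def lMap (F : PreModule p) {M N : PreModule p} (f : M.V →ₗ[ℂ] N.V) :
    (F.tensor M).V →ₗ[ℂ] (F.tensor N).V := f.lTensor F.V

theorem lMap_tmul (F : PreModule p) {M N : PreModule p} (f : M.V →ₗ[ℂ] N.V) (a : F.V) (b : M.V) :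
    lMap F f (tmul a b) = tmul a (f b) := rfl

theorem lMap_lMap (F : PreModule p) {M N O : PreModule p} (g : N.V →ₗ[ℂ] O.V) (f : M.V →ₗ[ℂ] N.V)
    (t : (F.tensor M).V) : lMap F g (lMap F f t) = lMap F (g ∘ₗ f) t :=
  LinearMap.congr_fun (LinearMap.lTensor_comp F.V g f).symm t

theorem lMap_zero (F : PreModule p) {M N : PreModule p} (t : (F.tensor M).V) :
    lMap F (0 : M.V →ₗ[ℂ] N.V) t = 0 :=
  LinearMap.congr_fun (LinearMap.lTensor_zero F.V (N := M.V) (P := N.V)) t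

theorem lMap_injective (F : PreModule p) {M N : PreModule p} {f : M.V →ₗ[ℂ] N.V}
    (hf : Function.Injective f) : Function.Injective (lMap F f) :=
  Module.Flat.lTensor_preserves_injective_linearMap f hf

theorem IsHom.lMap {M N : PreModule p} {f : M.V →ₗ[ℂ] N.V} (hf : IsHom M N f) (F : PreModule p) :
    IsHom (F.tensor M) (F.tensor N) (lMap F f) :=
  IsHom.of_tmul
    (fun x a b => by simp only [lMap_tmul, tensor_lie_tmul, hf.lie])
    (fun k a b => by simp only [lMap_tmul, tensor_rep_tmul, hf.rep])

theorem shortExact_lMap {A B C : PreModule p} {f : A.V →ₗ[ℂ] B.V} {g : B.V →ₗ[ℂ] C.V}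
    (h : IsShortExact A B C f g) (F : PreModule p) :
    IsShortExact (F.tensor A) (F.tensor B) (F.tensor C) (lMap F f) (lMap F g) :=
  ⟨h.hom_left.lMap F, h.hom_right.lMap F, lMap_injective F h.injective,
    (LinearMap.exact_iff.1 (lTensor_exact F.V (LinearMap.exact_iff.2 h.exact.symm)
      h.surjective)).symm, LinearMap.lTensor_surjective F.V h.surjective⟩

theorem tensor_comm_iso (M N : PreModule p) : (M.tensor N).Iso (N.tensor M) :=
  ⟨TensorProduct.comm ℂ M.V N.V, IsHom.of_tmul
    (fun x a b => add_comm (tmul b (M.lie x a)) (tmul (N.lie x b) a)) (fun _ _ _ => rfl)⟩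

theorem tensor_triv_iso (M : PreModule p) : (M.tensor (triv p)).Iso M := by
  refine ⟨(TensorProduct.congr (LinearEquiv.refl ℂ M.V)
    (ULift.moduleEquiv : ULift.{u} ℂ ≃ₗ[ℂ] ℂ)).trans (TensorProduct.rid ℂ M.V),
    IsHom.of_tmul (fun x (a : M.V) (b : ULift.{u} ℂ) => ?_) (fun k a b => ?_)⟩
  · change b.down • M.lie x a + (0 : ℂ) • a = M.lie x (b.down • a)
    simp
  · exact (map_smul (M.rep k) (ULift.down b) a).symm

theorem Iso.tensor_left {M N : PreModule p} (F : PreModule p) (h : M.Iso N) :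
    (F.tensor M).Iso (F.tensor N) := by
  obtain ⟨e, he⟩ := h
  exact ⟨TensorProduct.congr (LinearEquiv.refl ℂ F.V) e, he.lMap F⟩

theorem Iso.cochain {M N : PreModule p} (h : M.Iso N) (n : ℕ) :
    (M.cochain n).Iso (N.cochain n) := by
  obtain ⟨e, he⟩ := h
  exact Iso.of_bijective (cochainMap_isHom he n)
    ⟨cochainMap_injective e.injective n, cochainMap_surjective e.surjective n⟩

theorem tensor_assoc_iso (M N O : PreModule p) :
    (M.tensor (N.tensor O)).Iso ((M.tensor N).tensor O) := by
  let e := (TensorProduct.assoc ℂ M.V N.V O.V).symm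
  have key : ∀ (a : M.V) {φ ψ : (N.tensor O).V →ₗ[ℂ] ((M.tensor N).tensor O).V},
      (∀ b c, φ (tmul b c) = ψ (tmul b c)) → ∀ t, φ t = ψ t :=
    fun a φ ψ h => LinearMap.congr_fun (tensor_ext h)
  let m (a : M.V) : (N.tensor O).V →ₗ[ℂ] ((M.tensor N).tensor O).V :=
    e.toLinearMap ∘ₗ TensorProduct.mk ℂ M.V (N.V ⊗[ℂ] O.V) a
  refine ⟨e, IsHom.of_tmul (fun x a => ?_) (fun k a => ?_)⟩
  · refine key a (φ := m (M.lie x a) + m a ∘ₗ (N.tensor O).lie x)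
      (ψ := ((M.tensor N).tensor O).lie x ∘ₗ m a) fun b c => ?_
    have h1 : ∀ a, m a (tmul b c) = tmul (tmul a b) c := fun _ => rfl
    have h2 : ∀ a b c, m a (tmul b c) = tmul (tmul a b) c := fun _ _ _ => rfl
    rw [LinearMap.add_apply, LinearMap.comp_apply, LinearMap.comp_apply, h1, h1, tensor_lie_tmul,
      tensor_lie_tmul, tensor_lie_tmul, map_add, h2, h2]
    have h3 : ∀ (s t : (M.tensor N).V) (c : O.V), tmul (s + t) c = tmul s c + tmul t c :=
      fun s t c => TensorProduct.add_tmul (R := ℂ) s t c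
    rw [h3, add_assoc]
  · exact key (M.rep k a) (φ := m (M.rep k a) ∘ₗ (N.tensor O).rep k)
      (ψ := ((M.tensor N).tensor O).rep k ∘ₗ m a) fun b c => rfl

theorem ev_lie {M : PreModule p} {n : ℕ} (x : p.alg) (f : (M.cochain n).V)
    (v : Fin n → p.nilRad) : ev ((M.cochain n).lie x f) v =
      M.lie x (ev f v) - ∑ k, ev f (Function.update v k ⁅x, v k⁆) := by
  exact congrArg (fun t => M.lie x (ev f v) - t)
    (altDeriv_apply (V := M.V) (CE.ad p.nilRad x) (n := n) f v)

theorem ev_rep {M : PreModule p} {n : ℕ} (k : p.grp) (f : (M.cochain n).V)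
    (v : Fin n → p.nilRad) : ev ((M.cochain n).rep k f) v =
      M.rep k (ev f (fun i => p.actRad k⁻¹ (v i))) := rfl

/-- The map `M ⊗ Hom(⋀ⁿ𝔲, N) → Hom(⋀ⁿ𝔲, M ⊗ N)`. -/
def cochainTensor (M N : PreModule p) (n : ℕ) :
    (M.tensor (N.cochain n)).V →ₗ[ℂ] ((M.tensor N).cochain n).V :=
  altTensor p.nilRad M.V N.V n

theorem ev_cochainTensor {M N : PreModule p} {n : ℕ} (a : M.V) (f : (N.cochain n).V)
    (v : Fin n → p.nilRad) : ev (cochainTensor M N n (tmul a f)) v = tmul a (ev f v) :=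
  DFunLike.congr_fun (altTensor_tmul (U := p.nilRad) (X := M.V) (Y := N.V) a f) v

theorem cochainTensor_bijective (M N : PreModule p) (n : ℕ) :
    Function.Bijective (cochainTensor M N n) :=
  altTensor_bijective (U := p.nilRad) (X := M.V) (Y := N.V)

theorem cochainTensor_isHom (M N : PreModule p) (n : ℕ) :
    IsHom (M.tensor (N.cochain n)) ((M.tensor N).cochain n) (cochainTensor M N n) := by
  refine IsHom.of_tmul (fun x a f => ?_) (fun k a f => ?_)
  · refine ev_ext fun v => ?_
    have h1 : ∀ c c' : ((M.tensor N).cochain n).V, ev (c + c') v = ev c v + ev c' v :=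
      fun _ _ => rfl
    have h2 : ∀ (a : M.V) (s t : N.V), tmul a (s - t) = tmul a s - tmul a t :=
      fun a s t => TensorProduct.tmul_sub (R := ℂ) a s t
    have h3 : ∀ (a : M.V) (s : Fin n → N.V), tmul a (∑ k, s k) = ∑ k, tmul a (s k) :=
      fun a s => TensorProduct.tmul_sum (R := ℂ) a _ s
    rw [ev_lie]
    simp only [ev_cochainTensor, h1, ev_lie, tensor_lie_tmul, h2, h3]
    abel
  · refine ev_ext fun v => ?_
    simp only [ev_cochainTensor, ev_rep, tensor_rep_tmul]

theorem tensor_cochain_iso (M N : PreModule p) (n : ℕ) :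
    (M.tensor (N.cochain n)).Iso ((M.tensor N).cochain n) :=
  Iso.of_bijective (cochainTensor_isHom M N n) (cochainTensor_bijective M N n)

/-- `Hom(⋀ⁿ𝔲, M) ≅ M ⊗ ⋀ⁿ𝔲^*`. -/
theorem cochain_iso_tensor (M : PreModule p) (n : ℕ) :
    (M.tensor ((triv p).cochain n)).Iso (M.cochain n) :=
  (tensor_cochain_iso M (triv p) n).trans ((tensor_triv_iso M).cochain n)

end PreModule

/-! ### Cohomology with coefficients in a tensor product with a trivial `𝔲`-module -/

namespace CE

variable {L V : Type*} [LieRing L] [LieAlgebra ℂ L] {I : LieIdeal ℂ L}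
  [AddCommGroup V] [Module ℂ V]

/-- The differential of an ideal commutes with maps of coefficients that are equivariant under the
ideal only. -/
theorem d_comp_of_ideal (ρ : L →ₗ[ℂ] Module.End ℂ V) (n : ℕ) {V' : Type*} [AddCommGroup V']
    [Module ℂ V'] (ρ' : L →ₗ[ℂ] Module.End ℂ V')
    (g : V →ₗ[ℂ] V') (hg : ∀ (x : I) v, g (ρ x v) = ρ' x (g v)) (f : I [⋀^Fin n]→ₗ[ℂ] V) :
    g.compAlternatingMap (d ρ n f) = d ρ' n (g.compAlternatingMap f) := by
  ext v
  simp only [d_eq, AlternatingMap.sub_apply, AlternatingMap.smul_apply,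
    AlternatingMap.alternatizeUncurryFin_apply, LinearMap.compAlternatingMap_apply, map_sub,
    map_smul, map_sum, map_zsmul, valueAct_apply, argAct_apply, altDeriv_compAlternatingMap, hg]

end CE

namespace PreModule

/-- The nilpotent radical acts by zero. -/
def IsTrivialRad (N : PreModule p) : Prop := ∀ (x : p.nilRad) (v : N.V), N.lie (x : p.alg) v = 0

/-- If `𝔲` acts trivially on `N`, the differential of `N ⊗ M` is `id ⊗ d`. -/
theorem d_cochainTensor {N : PreModule p} (hN : N.IsTrivialRad) (M : PreModule p) (n : ℕ)
    (t : (N.tensor (M.cochain n)).V) :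
    (N.tensor M).d n (cochainTensor N M n t) = cochainTensor N M (n + 1) (lMap N (M.d n) t) := by
  refine LinearMap.congr_fun (tensor_ext (φ := (N.tensor M).d n ∘ₗ cochainTensor N M n)
    (ψ := cochainTensor N M (n + 1) ∘ₗ lMap N (M.d n)) fun a f => ?_) t
  let g : M.V →ₗ[ℂ] (N.tensor M).V := TensorProduct.mk ℂ N.V M.V a
  have h1 : ∀ n f, cochainTensor N M n (tmul a f) = cochainMap (B := N.tensor M) g n f :=
    fun n f => ev_ext fun v => ev_cochainTensor a f v
  rw [LinearMap.comp_apply, LinearMap.comp_apply, lMap_tmul, h1, h1]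
  refine (CE.d_comp_of_ideal M.lie n (N.tensor M).lie g (fun x v => ?_) f).symm
  change tmul a (M.lie x v) = (N.tensor M).lie x (tmul a v)
  rw [tensor_lie_tmul, hN]
  exact ((congrArg (· + tmul a (M.lie (x : p.alg) v))
    (TensorProduct.zero_tmul (R := ℂ) N.V v)).trans (zero_add _)).symm

/-- The inclusion of the cocycles. -/
def cocycleι (M : PreModule p) (n : ℕ) : (M.cocycle n).V →ₗ[ℂ] (M.cochain n).V :=
  (LinearMap.ker (M.d n)).subtype

theorem cocycleι_isHom (M : PreModule p) (n : ℕ) :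
    IsHom (M.cocycle n) (M.cochain n) (M.cocycleι n) := (M.cochain n).isHom_subtype _

theorem cocycleι_injective (M : PreModule p) (n : ℕ) : Function.Injective (M.cocycleι n) :=
  Subtype.val_injective

theorem d_cocycleι (M : PreModule p) (n : ℕ) (z : (M.cocycle n).V) :
    M.d n (M.cocycleι n z) = 0 := z.2

theorem exists_cocycleι (M : PreModule p) (n : ℕ) {z : (M.cochain n).V} (hz : M.d n z = 0) :
    ∃ z', M.cocycleι n z' = z := ⟨⟨z, hz⟩, rfl⟩

/-- The projection of the cocycles to cohomology. -/
def cohπ (M : PreModule p) (n : ℕ) : (M.cocycle n).V →ₗ[ℂ] (M.cohomology n).V :=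
  ((M.coboundaries n).comap (LinearMap.ker (M.d n)).subtype).mkQ

theorem cohπ_isHom (M : PreModule p) (n : ℕ) :
    IsHom (M.cocycle n) (M.cohomology n) (M.cohπ n) := isHom_mkQ _ _

theorem cohπ_surjective (M : PreModule p) (n : ℕ) : Function.Surjective (M.cohπ n) := by
  intro y
  obtain ⟨z, hz, rfl⟩ := M.coh_surj n y
  exact ⟨⟨z, hz⟩, rfl⟩

theorem cohπ_eq_zero_iff (M : PreModule p) (n : ℕ) (z : (M.cocycle n).V) :
    M.cohπ n z = 0 ↔ M.cocycleι n z ∈ M.coboundaries n := Submodule.Quotient.mk_eq_zero _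

/-- The module of coboundaries. -/
def coboundary (M : PreModule p) (n : ℕ) : PreModule p :=
  (M.cochain n).sub (M.coboundaries n) (M.stable_coboundaries n)

/-- The inclusion of the coboundaries. -/
def coboundaryι (M : PreModule p) (n : ℕ) : (M.coboundary n).V →ₗ[ℂ] (M.cochain n).V :=
  (M.coboundaries n).subtype

theorem coboundaryι_injective (M : PreModule p) (n : ℕ) : Function.Injective (M.coboundaryι n) :=
  Subtype.val_injective

theorem exists_shortExact_cochain (M : PreModule p) (n : ℕ) :
    ∃ δ, IsShortExact (M.cocycle n) (M.cochain n) (M.coboundary (n + 1)) (M.cocycleι n) δ ∧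
      M.coboundaryι (n + 1) ∘ₗ δ = M.d n :=
  ⟨(M.d n).rangeRestrict,
    ⟨M.cocycleι_isHom n, (M.d_isHom n).codRestrict _ _, Subtype.val_injective,
    (Submodule.range_subtype _).trans (LinearMap.ker_rangeRestrict _).symm,
    LinearMap.surjective_rangeRestrict _⟩, rfl⟩

theorem exists_shortExact_cocycle (M : PreModule p) (n : ℕ) :
    ∃ i, IsShortExact (M.coboundary n) (M.cocycle n) (M.cohomology n) i (M.cohπ n) ∧
      M.cocycleι n ∘ₗ i = M.coboundaryι n := by
  have hd : ∀ b : (M.coboundary n).V, M.d n b.1 = 0 := by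
    rintro ⟨b, hb⟩
    cases n with
    | zero => obtain rfl : b = 0 := hb; exact map_zero _
    | succ n => obtain ⟨b, rfl⟩ := hb; exact M.d_d n b
  have hi : IsHom (M.coboundary n) (M.cochain n) (M.coboundaryι n) :=
    (M.cochain n).isHom_subtype _
  obtain ⟨i, hi', e⟩ := (M.cocycleι_isHom n).exists_lift (M.cocycleι_injective n) hi
    fun b => M.exists_cocycleι n (hd b)
  refine ⟨i, IsShortExact.of_forall hi' (M.cohπ_isHom n) (fun a b hab => ?_) (M.cohπ_surjective n)
    (fun a => ?_) (fun z hz => ?_), LinearMap.ext e⟩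
  · have := congrArg (M.cocycleι n) hab
    rw [e, e] at this
    exact Subtype.ext this
  · rw [cohπ_eq_zero_iff, e]
    exact a.2
  · exact ⟨⟨_, (M.cohπ_eq_zero_iff n z).1 hz⟩, M.cocycleι_injective n (e _)⟩

theorem lMap_d_eq_zero_iff (N M : PreModule p) (n : ℕ) (t : (N.tensor (M.cochain n)).V) :
    lMap N (M.d n) t = 0 ↔ ∃ s, lMap N (M.cocycleι n) s = t := by
  obtain ⟨δ, h, e⟩ := M.exists_shortExact_cochain n
  rw [← (shortExact_lMap h N).mem_range_iff, ← e, ← lMap_lMap,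
    map_eq_zero_iff _ (lMap_injective N (M.coboundaryι_injective _))]

/-- `N ⊗ Hⁿ(𝔲; M) ≅ Hⁿ(𝔲; N ⊗ M)` if `𝔲` acts trivially on `N`. -/
theorem cohomology_tensor_iso {N : PreModule p} (hN : N.IsTrivialRad) (M : PreModule p) (n : ℕ) :
    (N.tensor (M.cohomology n)).Iso ((N.tensor M).cohomology n) := by
  have hκ := cochainTensor_bijective N M
  obtain ⟨φ, hφ, eφ⟩ := ((N.tensor M).cocycleι_isHom n).exists_lift
    ((N.tensor M).cocycleι_injective n)
    ((cochainTensor_isHom N M n).comp ((M.cocycleι_isHom n).lMap N)) fun s =>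
      (N.tensor M).exists_cocycleι n (by
        rw [LinearMap.comp_apply, d_cochainTensor hN, (lMap_d_eq_zero_iff N M n _).2 ⟨s, rfl⟩,
          map_zero])
  obtain ⟨i, hi, ei⟩ := M.exists_shortExact_cocycle n
  have hs := shortExact_lMap hi N
  -- a cocycle of `N ⊗ M` that comes from `s` is a coboundary if and only if `s` vanishes in
  -- `N ⊗ Hⁿ(𝔲; M)`
  have key : ∀ s, (N.tensor M).cohπ n (φ s) = 0 ↔ lMap N (M.cohπ n) s = 0 := by
    intro s
    rw [cohπ_eq_zero_iff, eφ]
    cases n with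
    | zero =>
      have hB : ∀ s', s' = s → lMap N (M.cohπ 0) s' = 0 → s = 0 := by
        rintro s' rfl hs'
        obtain ⟨b, rfl⟩ := hs.mem_range_iff.1 hs'
        have : i = 0 := LinearMap.ext fun b => by
          have hb : b = 0 := Subtype.ext b.2
          rw [hb, map_zero, map_zero]
        rw [this, lMap_zero]
      constructor
      · intro h
        have h0 : (cochainTensor N M 0 ∘ₗ lMap N (M.cocycleι 0)) s = 0 := h
        rw [LinearMap.comp_apply, map_eq_zero_iff _ (hκ 0).1,
          map_eq_zero_iff _ (lMap_injective N (M.cocycleι_injective 0))] at h0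
        rw [h0, map_zero]
      · intro h
        obtain ⟨b, rfl⟩ := hs.mem_range_iff.1 h
        have : i = 0 := LinearMap.ext fun b => by
          rw [show b = 0 from Subtype.ext b.2, map_zero, map_zero]
        rw [this, lMap_zero, map_zero]
        exact Submodule.zero_mem _
    | succ n =>
      obtain ⟨d', hd', ed⟩ := (M.cocycleι_isHom (n + 1)).exists_lift (M.cocycleι_injective _)
        (M.d_isHom n) fun f => M.exists_cocycleι _ (M.d_d n f)
      have ed' : M.cocycleι (n + 1) ∘ₗ d' = M.d n := LinearMap.ext ed
      have hd0 : M.cohπ (n + 1) ∘ₗ d' = 0 := LinearMap.ext fun f =>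
        (M.cohπ_eq_zero_iff _ _).2 (by rw [ed]; exact ⟨f, rfl⟩)
      constructor
      · rintro ⟨c', hc'⟩
        obtain ⟨t, rfl⟩ := (hκ n).2 c'
        rw [d_cochainTensor hN] at hc'
        have h1 := (hκ (n + 1)).1 hc'
        rw [← ed', ← lMap_lMap] at h1
        rw [← lMap_injective N (M.cocycleι_injective _) h1, lMap_lMap, hd0, lMap_zero]
      · intro h
        obtain ⟨b, rfl⟩ := hs.mem_range_iff.1 h
        obtain ⟨δ, h', e⟩ := M.exists_shortExact_cochain n
        obtain ⟨t, rfl⟩ := (shortExact_lMap h' N).surjective b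
        refine ⟨cochainTensor N M n t, ?_⟩
        rw [d_cochainTensor hN, LinearMap.comp_apply, lMap_lMap, ei, lMap_lMap, e]
  obtain ⟨Φ, hΦ, eΦ⟩ := hs.hom_right.exists_factor hs.surjective
    (((N.tensor M).cohπ_isHom n).comp hφ) fun s hs => (key s).2 hs
  refine Iso.of_bijective hΦ ⟨?_, fun y => ?_⟩
  · rw [← LinearMap.ker_eq_bot, LinearMap.ker_eq_bot']
    intro y hy
    obtain ⟨s, rfl⟩ := hs.surjective y
    rw [eΦ] at hy
    exact (key s).1 hy
  · obtain ⟨c, rfl⟩ := (N.tensor M).cohπ_surjective n y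
    obtain ⟨t, ht⟩ := (hκ n).2 ((N.tensor M).cocycleι n c)
    have h0 : lMap N (M.d n) t = 0 := (hκ (n + 1)).1 (by
      rw [← d_cochainTensor hN, ht, d_cocycleι, map_zero])
    obtain ⟨s, rfl⟩ := (lMap_d_eq_zero_iff N M n t).1 h0
    refine ⟨lMap N (M.cohπ n) s, (eΦ s).trans ?_⟩
    refine congrArg ((N.tensor M).cohπ n) ((N.tensor M).cocycleι_injective n ?_)
    rw [eφ, ← ht]; rfl

end PreModule

/-! ### The nilpotent radical on finite-dimensional modules -/

/-- The nilpotent radical `[L, rad L]` kills a nonzero vector of every nonzero finite-dimensional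
`L`-module: by Lie's theorem `rad L` has a weight `χ` whose weight space is an `L`-submodule, and
`χ` vanishes on `[L, rad L]` because commutators have trace zero. -/
theorem exists_ne_zero_forall_nilpotentRadical {L V : Type*} [LieRing L] [LieAlgebra ℂ L]
    [FiniteDimensional ℂ L] [AddCommGroup V] [Module ℂ V] [FiniteDimensional ℂ V] [Nontrivial V]
    [LieRingModule L V] [LieModule ℂ L V] :
    ∃ v : V, v ≠ 0 ∧ ∀ x ∈ nilpotentRadical L, ⁅x, v⁆ = 0 := by
  let A := LieAlgebra.radical ℂ L
  obtain ⟨χ, hχ⟩ := LieModule.exists_nontrivial_weightSpace_of_isSolvable ℂ A V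
  let W : LieSubmodule ℂ L V := LieModule.weightSpaceOfIsLieTower ℂ V χ
  have hW : ∀ v ∈ W, ∀ a : A, ⁅(a : L), v⁆ = χ a • v := fun v hv a =>
    (LieModule.mem_weightSpace (χ := χ) (M := V) v).1 hv a
  have hWn : Nontrivial W := hχ
  have h0 : ∀ (y : L) (a : A), χ ⁅y, a⁆ = 0 := by
    intro y a
    have h1 : LieModule.toEnd ℂ L W ⁅y, (a : L)⁆ = χ ⁅y, a⁆ • LinearMap.id := by
      ext v
      exact hW v.1 v.2 ⁅y, a⁆
    have h2 : LinearMap.trace ℂ W (LieModule.toEnd ℂ L W ⁅y, (a : L)⁆) = 0 := by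
      have h3 : LieModule.toEnd ℂ L W ⁅y, (a : L)⁆ =
          LieModule.toEnd ℂ L W y * LieModule.toEnd ℂ L W a -
            LieModule.toEnd ℂ L W a * LieModule.toEnd ℂ L W y :=
        LinearMap.ext fun w => lie_lie y (a : L) w
      rw [h3, map_sub, LinearMap.trace_mul_comm, sub_self]
    rw [h1, map_smul, LinearMap.trace_id, smul_eq_mul] at h2
    rcases mul_eq_zero.1 h2 with h | h
    · exact h
    · exact absurd (Nat.cast_eq_zero.1 h) (Module.finrank_pos).ne'
  obtain ⟨v, hv⟩ := exists_ne (0 : W)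
  refine ⟨v, fun h => hv (Subtype.ext h), fun x hx => ?_⟩
  have hx' : x ∈ (nilpotentRadical L).toSubmodule := hx
  rw [LieSubmodule.lieIdeal_oper_eq_linear_span'] at hx'
  let ψ : L →ₗ[ℂ] V := (LinearMap.applyₗ (v : V)).comp
    (LieModule.toEnd ℂ L V : L →ₗ[ℂ] Module.End ℂ V)
  refine (Submodule.span_le (p := LinearMap.ker ψ)).2 ?_ hx'
  rintro _ ⟨y, -, a, ha, rfl⟩
  change ⁅⁅y, a⁆, (v : V)⁆ = 0
  rw [show ⁅y, a⁆ = ((⁅y, (⟨a, ha⟩ : A)⁆ : A) : L) from rfl, hW v v.2, h0, zero_smul]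

/-- A linear map that vanishes on commutators vanishes on the nilpotent radical. -/
theorem map_nilpotentRadical_eq_zero {L X : Type*} [LieRing L] [LieAlgebra ℂ L] [AddCommGroup X]
    [Module ℂ X] (ψ : L →ₗ[ℂ] X) (hψ : ∀ x y : L, ψ ⁅x, y⁆ = 0) {x : L}
    (hx : x ∈ nilpotentRadical L) : ψ x = 0 := by
  have hx' : x ∈ (nilpotentRadical L).toSubmodule := hx
  rw [LieSubmodule.lieIdeal_oper_eq_linear_span'] at hx'
  refine (Submodule.span_le (p := LinearMap.ker ψ)).2 ?_ hx'
  rintro _ ⟨y, -, a, -, rfl⟩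
  exact hψ y a

instance Subpair.finiteDimensional (p : Subpair P) : FiniteDimensional ℂ p.alg :=
  inferInstanceAs (FiniteDimensional ℂ p.alg.toSubmodule)

namespace PreModule

/-- The invariants of the nilpotent radical. -/
def radInvariants (F : PreModule p) : Submodule ℂ F.V where
  carrier := {v | ∀ x : p.nilRad, F.lie (x : p.alg) v = 0}
  zero_mem' := by simp
  add_mem' := by intro a b ha hb x; rw [map_add, ha, hb, add_zero]
  smul_mem' := by intro c a ha x; rw [map_smul, ha, smul_zero]

theorem stable_radInvariants (F : PreModule p) : F.IsStable F.radInvariants where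
  lie x v hv y := by
    have h := F.lie_lie (y : p.alg) x v
    have h1 : F.lie ⁅(y : p.alg), x⁆ v = 0 :=
      hv ⟨⁅(y : p.alg), x⁆, lie_mem_left ℂ p.alg p.nilRad _ _ y.2⟩
    rw [h1, hv y, map_zero, sub_zero] at h
    exact h.symm
  rep k v hv y := by
    have h := F.compat k (p.act k⁻¹ y) v
    have h1 : F.lie (p.act k⁻¹ y) v = 0 := hv ⟨_, p.act_mem_nilRad k⁻¹ y.2⟩
    rw [h1, map_zero, p.act_inv_act] at h
    exact h.symm

/-- A nonzero finite-dimensional module has nonzero `𝔲`-invariants, since `𝔲 = [𝔮, rad 𝔮]`. -/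
theorem radInvariants_ne_bot (F : PreModule p) [FiniteDimensional ℂ F.V] [Nontrivial F.V] :
    F.radInvariants ≠ ⊥ := by
  let : LieRingModule p.alg F.V :=
    { bracket := fun x v => F.lie x v
      add_lie := fun x y v => by simp [map_add]
      lie_add := fun x v w => by simp
      leibniz_lie := fun x y v => by
        change F.lie x (F.lie y v) = F.lie ⁅x, y⁆ v + F.lie y (F.lie x v)
        rw [F.lie_lie, sub_add_cancel] }
  let : LieModule ℂ p.alg F.V :=
    { smul_lie := fun c x v => by
        change F.lie (c • x) v = c • F.lie x v
        simp
      lie_smul := fun c x v => map_smul (F.lie x) c v }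
  obtain ⟨v, hv, h⟩ := exists_ne_zero_forall_nilpotentRadical (L := p.alg) (V := F.V)
  exact (Submodule.ne_bot_iff _).2 ⟨v, fun x => h x x.2, hv⟩

end PreModule

/-! ### Euler characteristics of tensor products with finite-dimensional modules -/

theorem IsAbelianSubcategory.of_shortExact_right {𝓒 : PreModule p → Prop}
    (h𝓒 : IsAbelianSubcategory 𝓒) {A B C : PreModule p} {f : A.V →ₗ[ℂ] B.V} {g : B.V →ₗ[ℂ] C.V}
    (h : IsShortExact A B C f g) (hA : 𝓒 A) (hB : 𝓒 B) : 𝓒 C := by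
  obtain ⟨N, _, k, _, h'⟩ := h.hom_left.exists_exactFour
  have h4 : IsExactFour N A B C k f g :=
    { h' with
      hom_coker := h.hom_right
      range_iff := fun {_} => h.mem_range_iff
      surjective := h.surjective }
  exact (GrothendieckGroup.cls_exactFour h𝓒 h4 hA hB).2.1

theorem IsShortExact.res {r : Subpair P} (hr : r ≤ p) {A B C : PreModule p} {f : A.V →ₗ[ℂ] B.V}
    {g : B.V →ₗ[ℂ] C.V} (h : IsShortExact A B C f g) :
    IsShortExact (A.res hr) (B.res hr) (C.res hr) f g :=
  ⟨h.hom_left.res hr, h.hom_right.res hr, h.injective, h.exact, h.surjective⟩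

namespace PreModule

theorem subsingleton_tensor_left {M : PreModule p} (h : Subsingleton M.V) (N : PreModule p) :
    Subsingleton (M.tensor N).V := by
  have h0 : ∀ t : M.V ⊗[ℂ] N.V, t = 0 := fun t => by
    induction t with
    | zero => rfl
    | add a b ha hb => rw [ha, hb, add_zero]
    | tmul a b => rw [Subsingleton.elim a 0, TensorProduct.zero_tmul]
  exact ⟨fun s t => (h0 s).trans (h0 t).symm⟩

theorem subsingleton_tensor_right {M : PreModule p} (h : Subsingleton M.V) (N : PreModule p) :
    Subsingleton (N.tensor M).V := by
  obtain ⟨e, -⟩ := tensor_comm_iso N M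
  have := subsingleton_tensor_left h N
  exact e.toEquiv.subsingleton

theorem shortExact_rTensor {A B C : PreModule p} {f : A.V →ₗ[ℂ] B.V} {g : B.V →ₗ[ℂ] C.V}
    (h : IsShortExact A B C f g) (F : PreModule p) :
    IsShortExact (A.tensor F) (B.tensor F) (C.tensor F) (f.rTensor F.V) (g.rTensor F.V) :=
  ⟨h.hom_left.rTensor F, h.hom_right.rTensor F,
    Module.Flat.rTensor_preserves_injective_linearMap f h.injective,
    (LinearMap.exact_iff.1 (rTensor_exact F.V (LinearMap.exact_iff.2 h.exact.symm)
      h.surjective)).symm, LinearMap.rTensor_surjective F.V h.surjective⟩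

/-- The homomorphism `F → Hom(𝔲, F)` given by the action of `𝔲`; its kernel consists of the
invariants of `𝔲`. -/
theorem exists_radAction (F : PreModule p) : ∃ j : F.V →ₗ[ℂ] (F.cochain 1).V,
    IsHom F (F.cochain 1) j ∧ ∀ v, j v = 0 ↔ v ∈ F.radInvariants := by
  let c : F.V →ₗ[ℂ] (F.cochain 0).V :=
    (AlternatingMap.constLinearEquivOfIsEmpty (R' := ℂ) (M'' := p.nilRad)
      (N'' := F.V) (ι := Fin 0)).toLinearMap
  have hc : ∀ v w, ev (c v) w = v := fun _ _ => rfl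
  have hc' : IsHom F (F.cochain 0) c :=
    ⟨fun x v => ev_ext fun w => by rw [ev_lie, hc, hc]; simp, fun k v => ev_ext fun w => by
      rw [ev_rep, hc, hc]⟩
  have hj : ∀ v w, ev (F.d 0 (c v)) w = F.lie (w 0 : p.alg) v := fun v w =>
    CE.d_apply_zero (V := F.V) F.lie (c v) w
  refine ⟨F.d 0 ∘ₗ c, (F.d_isHom 0).comp hc', fun v => ⟨fun h x => ?_, fun h => ?_⟩⟩
  · rw [← hj v fun _ => x]
    exact congrArg (fun f => ev f _) h
  · exact ev_ext fun w => (hj v w).trans (h (w 0))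

end PreModule

section Tensor

open GrothendieckGroup

variable {r : Subpair P} {hr : r ≤ p} {𝓛 : PreModule r → Prop}

/-- If `𝓛` is closed under tensoring with `F` and with `𝔲^*`, then it is closed under tensoring with
the invariants `F^𝔲` and with `F / F^𝔲`: the functor `N ⊗ -` maps `F^𝔲` to the kernel of
`N ⊗ F → N ⊗ F ⊗ 𝔲^*`. -/
theorem tensor_radInvariants_mem (h𝓛 : IsAbelianSubcategory 𝓛)
    (hT : ∀ N, 𝓛 N → 𝓛 (N.tensor (((triv p).cochain 1).res hr))) (F : PreModule p)
    (hF : ∀ N, 𝓛 N → 𝓛 (N.tensor (F.res hr))) {N : PreModule r} (hN : 𝓛 N) :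
    𝓛 (N.tensor ((F.sub _ F.stable_radInvariants).res hr)) ∧
      𝓛 (N.tensor ((F.quot _ F.stable_radInvariants).res hr)) := by
  obtain ⟨i, g, j, hs, hj, hji⟩ : ∃
      (i : ((F.sub _ F.stable_radInvariants).res hr).V →ₗ[ℂ] (F.res hr).V)
      (g : (F.res hr).V →ₗ[ℂ] ((F.quot _ F.stable_radInvariants).res hr).V)
      (j : ((F.quot _ F.stable_radInvariants).res hr).V →ₗ[ℂ] ((F.cochain 1).res hr).V),
      IsShortExact _ _ _ i g ∧ IsHom _ _ j ∧ Function.Injective j := by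
    obtain ⟨j, hj, hjk⟩ := F.exists_radAction
    have hs := F.shortExact_sub_quot _ F.stable_radInvariants
    obtain ⟨j', hj', ej⟩ := hs.hom_right.exists_factor hs.surjective hj fun v hv =>
      (hjk v).2 (by obtain ⟨a, rfl⟩ := hs.mem_range_iff.1 hv; exact a.2)
    suffices hj'i : ∀ y, j' y = 0 → y = 0 by
      have := (injective_iff_map_eq_zero j').2 hj'i
      exact ⟨_, _, j', hs.res hr, hj'.res hr, this⟩
    intro y hy
    obtain ⟨v, rfl⟩ := hs.surjective y
    exact hs.mem_range_iff.2 ⟨⟨v, (hjk v).1 ((ej v).symm.trans hy)⟩, rfl⟩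
  have hsN := shortExact_lMap hs N
  have hC : 𝓛 (N.tensor ((F.cochain 1).res hr)) :=
    h𝓛.iso _ _ ((tensor_assoc_iso N (F.res hr) (((triv p).cochain 1).res hr)).symm.trans
      (((cochain_iso_tensor F 1).res hr).tensor_left N)) (hT _ (hF N hN))
  obtain ⟨_, C, _, q, h⟩ := ((hj.lMap N).comp hsN.hom_right).exists_exactFour
  -- `0 → N ⊗ F^𝔲 → N ⊗ F → N ⊗ Hom(𝔲, F)` is exact, and the last two terms lie in `𝓛`
  have h4 : IsExactFour _ _ _ C (lMap N i) (lMap N j ∘ₗ lMap N g) q :=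
    { h with
      hom_ker := hsN.hom_left
      injective := hsN.injective
      ker_iff := fun {t} => by
        rw [← hsN.mem_range_iff, LinearMap.comp_apply, map_eq_zero_iff _ (lMap_injective N hji)] }
  have h0 := (cls_exactFour h𝓛 h4 (hF N hN) hC).1
  exact ⟨h0, h𝓛.of_shortExact_right hsN h0 (hF N hN)⟩

/-- `H(F ⊗ X) = F · H(X)` for finite-dimensional `F`. If `𝔲` acts trivially on `F`, this holds for
each cohomology module. In general, one uses induction on `dim F` and the submodule `F^𝔲 ≠ 0`. -/
theorem HasEulerChar.tensor (h𝓛 : IsAbelianSubcategory 𝓛)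
    (hT : ∀ N, 𝓛 N → 𝓛 (N.tensor (((triv p).cochain 1).res hr))) (X : PreModule p)
    (hX : ∀ n, 𝓛 ((X.cohomology n).res hr)) (F : PreModule p) [FiniteDimensional ℂ F.V]
    (hF : ∀ N, 𝓛 N → 𝓛 (N.tensor (F.res hr))) :
    HasEulerChar hr 𝓛 (F.tensor X) (∑ n ∈ Finset.range (Module.finrank ℂ p.nilRad + 1),
      (-1 : ℤ) ^ n • cls _ (hF _ (hX n))) := by
  induction hd : Module.finrank ℂ F.V using Nat.strong_induction_on generalizing F with
  | _ d ih =>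
    rcases subsingleton_or_nontrivial F.V with h | h
    · have : ∀ n, cls _ (hF _ (hX n)) = 0 := fun n =>
        cls_of_subsingleton _ (subsingleton_tensor_right (M := F.res hr) h _)
      simp only [this, smul_zero, Finset.sum_const_zero]
      exact of_subsingleton _ (subsingleton_tensor_left h _)
    · have hs := F.shortExact_sub_quot _ F.stable_radInvariants
      have hF₀ := fun N hN => (tensor_radInvariants_mem h𝓛 hT F hF (N := N) hN).1
      have hF₁ := fun N hN => (tensor_radInvariants_mem h𝓛 hT F hF (N := N) hN).2
      have : FiniteDimensional ℂ (F.quot _ F.stable_radInvariants).V :=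
        inferInstanceAs (FiniteDimensional ℂ (F.V ⧸ F.radInvariants))
      have e₁ := ih (Module.finrank ℂ (F.quot _ F.stable_radInvariants).V) (by
        rw [← hd]
        change Module.finrank ℂ (F.V ⧸ F.radInvariants) < _
        have h1 := F.radInvariants.finrank_quotient_add_finrank
        have h2 := Submodule.one_le_finrank_iff.2 F.radInvariants_ne_bot
        omega) (F.quot _ F.stable_radInvariants) hF₁ rfl
      have ht : (F.sub _ F.stable_radInvariants).IsTrivialRad := fun x v => Subtype.ext (v.2 x)
      have e₀ : HasEulerChar hr 𝓛 ((F.sub _ F.stable_radInvariants).tensor X)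
          (∑ n ∈ Finset.range (Module.finrank ℂ p.nilRad + 1),
            (-1 : ℤ) ^ n • cls _ (hF₀ _ (hX n))) :=
        ⟨fun n => cls _ (hF₀ _ (hX n)), fun n => (HasClass.of_mem (hF₀ _ (hX n))).iso
          ((tensor_comm_iso _ _).trans ((cohomology_tensor_iso ht X n).res hr)), rfl⟩
      have hsX := shortExact_rTensor hs X
      convert middle h𝓛 hsX e₀ e₁ using 1
      rw [← Finset.sum_add_distrib]
      refine Finset.sum_congr rfl fun n _ => ?_
      rw [← smul_add, cls_add (hF₀ _ (hX n)) _ (hF₁ _ (hX n))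
        (shortExact_lMap (IsShortExact.res hr hs) ((X.cohomology n).res hr))]

end Tensor

/-! ### Euler characteristics computed from cochains -/

/-- The telescoping identity behind the invariance of Euler characteristics: `c n`, `h n`, `b n`
stand for the classes of the cochains, the cohomology and the coboundaries in degree `n`. -/
theorem sum_neg_one_pow_smul_eq {A : Type*} [AddCommGroup A] {c h b : ℕ → A} (N : ℕ)
    (hc : ∀ n, c n = b n + h n + b (n + 1)) (h0 : b 0 = 0) (hN : b N = 0) :
    ∑ n ∈ Finset.range N, (-1 : ℤ) ^ n • c n = ∑ n ∈ Finset.range N, (-1 : ℤ) ^ n • h n := by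
  have key : ∀ N, ∑ n ∈ Finset.range N, (-1 : ℤ) ^ n • c n =
      ∑ n ∈ Finset.range N, (-1 : ℤ) ^ n • h n - (-1 : ℤ) ^ N • b N := by
    intro N
    induction N with
    | zero => simp [h0]
    | succ N ih =>
      rw [Finset.sum_range_succ, Finset.sum_range_succ, ih, hc, pow_succ]
      module
  rw [key, hN, smul_zero, sub_zero]

namespace PreModule

theorem subsingleton_cochain (M : PreModule p) {n : ℕ} (hn : Module.finrank ℂ p.nilRad < n) :
    Subsingleton (M.cochain n).V := by
  have e : ∀ c : (M.cochain n).V, c = 0 := fun c => ev_ext fun v =>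
    AlternatingMap.map_linearDependent (K := ℂ) (M := p.nilRad) (N := M.V) c v fun hv => by
      have := hv.fintype_card_le_finrank
      rw [Fintype.card_fin] at this
      omega
  exact ⟨fun c c' => (e c).trans (e c').symm⟩

theorem subsingleton_coboundary_zero (M : PreModule p) : Subsingleton (M.coboundary 0).V :=
  ⟨fun a b => Subtype.ext
    ((Submodule.mem_bot ℂ).1 a.2 |>.trans ((Submodule.mem_bot ℂ).1 b.2).symm)⟩

theorem subsingleton_coboundary (M : PreModule p) {n : ℕ} (hn : Module.finrank ℂ p.nilRad < n) :
    Subsingleton (M.coboundary n).V :=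
  have := M.subsingleton_cochain hn
  (M.coboundaryι_injective n).subsingleton

instance finiteDimensional_cochain_triv (n : ℕ) : FiniteDimensional ℂ ((triv p).cochain n).V :=
  Module.Finite.equiv (exteriorPower.alternatingMapLinearEquiv (R := ℂ) (n := n) (M := p.nilRad)
    (N := ULift.{u} ℂ)).symm

/-- The nilpotent radical acts trivially on its own cohomology, by Cartan's formula. -/
theorem isTrivialRad_cohomology (M : PreModule p) (n : ℕ) : (M.cohomology n).IsTrivialRad := by
  intro x y
  obtain ⟨z, hz, rfl⟩ := M.coh_surj n y
  rw [coh_lie, coh_eq_zero_iff]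
  have hx : (M.cochain n).lie (x : p.alg) z = CE.act p.nilRad M.lie n x z := rfl
  rw [hx]
  cases n with
  | zero =>
    have h := CE.curryLeft_d_zero (I := p.nilRad) (V := M.V) M.lie z x
    have hz' : CE.d (I := p.nilRad) M.lie 0 z = 0 := hz
    rw [hz'] at h
    exact h.symm
  | succ n =>
    have h := CE.curryLeft_d (I := p.nilRad) (V := M.V) M.lie n z x
    have hz' : CE.d (I := p.nilRad) M.lie (n + 1) z = 0 := hz
    rw [hz'] at h
    exact ⟨_, (sub_eq_zero.1 h.symm).symm⟩

end PreModule

section EulerChar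

open GrothendieckGroup

variable {r : Subpair P} {hr : r ≤ p} {𝓛 : PreModule r → Prop}

/-- The Euler characteristic of the cohomology equals that of the complex. -/
theorem sum_cls_cochain_eq_eulerChar (h𝓛 : IsAbelianSubcategory 𝓛) (M : PreModule p)
    (hC : ∀ n, 𝓛 ((M.cochain n).res hr)) (hH : ∀ n, 𝓛 ((M.cohomology n).res hr)) :
    ∑ n ∈ Finset.range (Module.finrank ℂ p.nilRad + 1), (-1 : ℤ) ^ n • cls _ (hC n) =
      eulerChar hr 𝓛 M hH := by
  have hZ : ∀ n, 𝓛 ((M.cocycle n).res hr) := fun n =>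
    h𝓛.ker _ _ _ ((M.d_isHom n).res hr) (hC n) (hC (n + 1))
  choose δ hδ _ using fun n => M.exists_shortExact_cochain n
  choose i hi _ using fun n => M.exists_shortExact_cocycle n
  have hB : ∀ n, 𝓛 ((M.coboundary n).res hr) := by
    rintro (_ | n)
    · exact h𝓛.zero _ M.subsingleton_coboundary_zero
    · exact h𝓛.of_shortExact_right ((hδ n).res hr) (hZ n) (hC n)
  refine sum_neg_one_pow_smul_eq (b := fun n => cls _ (hB n)) _ (fun n => ?_)
    (cls_of_subsingleton _ M.subsingleton_coboundary_zero)
    (cls_of_subsingleton _ (M.subsingleton_coboundary (Nat.lt_succ_self _)))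
  rw [cls_add (hZ n) (hC n) (hB (n + 1)) ((hδ n).res hr),
    cls_add (hB n) (hZ n) (hH n) ((hi n).res hr)]

/-- The Künneth-type formula
`W · ∑ₙ (-1)ⁿ [Hⁿ(𝔲; M ⊗ N)] = ∑ₙ ∑ₘ (-1)^{m+n} [Hᵐ(𝔲; M) ⊗ Hⁿ(𝔲; N)]`. Both sides are the
alternating sum over `n` of the Euler characteristics of `M ⊗ Hom(⋀ⁿ𝔲, N)`, where the complex
`Hom(⋀^•𝔲, N)` of `𝔲`-modules has cohomology with trivial action of `𝔲`. -/
theorem sum_eulerChar_tensor (h𝓛 : IsAbelianSubcategory 𝓛)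
    (hT : ∀ n N, 𝓛 N → 𝓛 (N.tensor (((triv p).cochain n).res hr))) (M N : PreModule p)
    (hMN : ∀ n, 𝓛 (((M.tensor N).cohomology n).res hr))
    (hP : ∀ m n, 𝓛 (((M.cohomology m).res hr).tensor ((N.cohomology n).res hr))) :
    ∑ n ∈ Finset.range (Module.finrank ℂ p.nilRad + 1), (-1 : ℤ) ^ n •
        tensorHom _ (hT n) (eulerChar hr 𝓛 (M.tensor N) hMN) =
      ∑ n ∈ Finset.range (Module.finrank ℂ p.nilRad + 1), (-1 : ℤ) ^ n •
        ∑ m ∈ Finset.range (Module.finrank ℂ p.nilRad + 1), (-1 : ℤ) ^ m • cls _ (hP m n) := by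
  -- the terms `M ⊗ Hom(⋀ⁿ𝔲, N) ≅ ⋀ⁿ𝔲^* ⊗ (M ⊗ N)` of the complex
  have hw : ∀ n, HasEulerChar hr 𝓛 (M.tensor (N.cochain n))
      (tensorHom _ (hT n) (eulerChar hr 𝓛 (M.tensor N) hMN)) := fun n => by
    have h := (HasEulerChar.tensor h𝓛 (hT 1) _ hMN ((triv p).cochain n) (hT n)).iso h𝓛
      ((tensor_comm_iso _ _).trans ((tensor_assoc_iso _ _ _).symm.trans
        ((cochain_iso_tensor N n).tensor_left M)))
    simp only [eulerChar, map_sum, map_zsmul]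
    simp only [tensorHom, lift_cls]
    exact h
  -- its cohomology `M ⊗ Hⁿ(𝔲; N)`
  have hs : ∀ n, HasEulerChar hr 𝓛 (M.tensor (N.cohomology n))
      (∑ m ∈ Finset.range (Module.finrank ℂ p.nilRad + 1), (-1 : ℤ) ^ m • cls _ (hP m n)) :=
    fun n => HasEulerChar.iso h𝓛
      ⟨_, fun m => (HasClass.of_mem (hP m n)).iso ((tensor_comm_iso _ _).trans
        ((cohomology_tensor_iso (N.isTrivialRad_cohomology n) M m).res hr)), rfl⟩
      (tensor_comm_iso _ _)
  choose δ hδ _ using fun n => N.exists_shortExact_cochain n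
  choose i hi _ using fun n => N.exists_shortExact_cocycle n
  -- the Euler characteristics of `M ⊗ Bⁿ` for the coboundaries `Bⁿ` are found recursively from
  -- `0 → Bⁿ → Zⁿ → Hⁿ → 0` and `0 → Zⁿ → Cⁿ → Bⁿ⁺¹ → 0`, starting with `B⁰ = 0`
  have hstep : ∀ n b, HasEulerChar hr 𝓛 (M.tensor (N.coboundary n)) b →
      HasEulerChar hr 𝓛 (M.tensor (N.coboundary (n + 1)))
        (tensorHom _ (hT n) (eulerChar hr 𝓛 (M.tensor N) hMN) - (b +
          ∑ m ∈ Finset.range (Module.finrank ℂ p.nilRad + 1), (-1 : ℤ) ^ m • cls _ (hP m n))) :=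
    fun n b hb => ((hb.middle h𝓛 (shortExact_lMap (hi n) M) (hs n))).right h𝓛
      (shortExact_lMap (hδ n) M) (hw n)
  let b : ℕ → GrothendieckGroup 𝓛 := Nat.rec 0 fun n b =>
    tensorHom _ (hT n) (eulerChar hr 𝓛 (M.tensor N) hMN) - (b +
      ∑ m ∈ Finset.range (Module.finrank ℂ p.nilRad + 1), (-1 : ℤ) ^ m • cls _ (hP m n))
  have hb : ∀ n, HasEulerChar hr 𝓛 (M.tensor (N.coboundary n)) (b n) := by
    intro n
    induction n with
    | zero => exact .of_subsingleton _ (subsingleton_tensor_right N.subsingleton_coboundary_zero M)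
    | succ n ih => exact hstep n _ ih
  refine sum_neg_one_pow_smul_eq (b := b) _ (fun n => ?_) rfl
    ((hb _).unique h𝓛 (.of_subsingleton _ (subsingleton_tensor_right
      (N.subsingleton_coboundary (Nat.lt_succ_self _)) M)))
  have : b (n + 1) = _ - (b n + _) := rfl
  rw [this, add_sub_cancel]

end EulerChar

/-! ### Contraction of alternating forms with tuples of vectors -/

section Contract

variable {U V : Type*} [AddCommGroup U] [Module ℂ U] [AddCommGroup V] [Module ℂ V] {n m N : ℕ}

/-- The tuple `(u₁, …, uₙ, w₁, …, wₘ)` of length `N = n + m`. -/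
def joinTuple {X : Type*} (h : n + m = N) (u : Fin n → X) (w : Fin m → X) : Fin N → X :=
  Fin.append u w ∘ Fin.cast h.symm

theorem joinTuple_update_left {X : Type*} (h : n + m = N) (u : Fin n → X) (w : Fin m → X)
    (i : Fin n) (x : X) : joinTuple h (Function.update u i x) w =
      Function.update (joinTuple h u w) (Fin.cast h (i.castAdd m)) x := by
  subst h
  ext j
  refine Fin.addCases (fun j => ?_) (fun j => ?_) j
  · rcases eq_or_ne j i with rfl | hj
    · simp [joinTuple]
    · have : j.castAdd m ≠ i.castAdd m := fun e => hj (Fin.castAdd_injective _ _ e)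
      simp [joinTuple, hj, this]
  · have : j.natAdd n ≠ i.castAdd m := by
      rw [Ne, Fin.ext_iff]; simp; omega
    simp [joinTuple, this]

theorem joinTuple_update_right {X : Type*} (h : n + m = N) (u : Fin n → X) (w : Fin m → X)
    (i : Fin m) (x : X) : joinTuple h u (Function.update w i x) =
      Function.update (joinTuple h u w) (Fin.cast h (i.natAdd n)) x := by
  subst h
  ext j
  refine Fin.addCases (fun j => ?_) (fun j => ?_) j
  · have : j.castAdd m ≠ i.natAdd n := by
      rw [Ne, Fin.ext_iff]; simp; omega
    simp [joinTuple, this]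
  · rcases eq_or_ne j i with rfl | hj
    · simp [joinTuple]
    · have : j.natAdd n ≠ i.natAdd n := fun e => hj (Fin.natAdd_injective _ _ e)
      simp [joinTuple, hj, this]

theorem joinTuple_left {X : Type*} (h : n + m = N) (u : Fin n → X) (w : Fin m → X) (i : Fin n) :
    joinTuple h u w (Fin.cast h (i.castAdd m)) = u i := by
  simp [joinTuple]

theorem joinTuple_right {X : Type*} (h : n + m = N) (u : Fin n → X) (w : Fin m → X) (i : Fin m) :
    joinTuple h u w (Fin.cast h (i.natAdd n)) = w i := by
  simp [joinTuple]

theorem joinTuple_snoc {X : Type*} (h : n + 1 + m = N) (h' : n + (m + 1) = N) (u : Fin n → X)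
    (x : X) (w : Fin m → X) :
    joinTuple h (Fin.snoc u x : Fin (n + 1) → X) w = joinTuple h' u (Matrix.vecCons x w) := by
  subst h
  rw [joinTuple, joinTuple, Fin.append_left_snoc]
  rfl

theorem comp_joinTuple {X Y : Type*} (h : n + m = N) (f : X → Y) (u : Fin n → X) (w : Fin m → X) :
    (fun i => f (joinTuple h u w i)) = joinTuple h (fun i => f (u i)) fun i => f (w i) := by
  subst h
  ext j
  refine Fin.addCases (fun j => ?_) (fun j => ?_) j <;> simp [joinTuple]

theorem altMap_sum_apply {ι : Type*} (s : Finset ι) (f : ι → U [⋀^Fin n]→ₗ[ℂ] V) (v : Fin n → U) :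
    (∑ i ∈ s, f i) v = ∑ i ∈ s, f i v :=
  map_sum ({ toFun := fun f => f v, map_zero' := rfl, map_add' := fun _ _ => rfl } :
    (U [⋀^Fin n]→ₗ[ℂ] V) →+ V) f s

/-- The contraction `(u₁, …, uₙ) ↦ η(u₁, …, uₙ, -)` of an alternating form of degree `N = n + m`. -/
def contract (η : U [⋀^Fin N]→ₗ[ℂ] V) (h : n + m = N) :
    U [⋀^Fin n]→ₗ[ℂ] (U [⋀^Fin m]→ₗ[ℂ] V) where
  toFun u :=
    { toFun := fun w => η (joinTuple h u w)
      map_update_add' w i x y := by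
        rename_i inst
        obtain rfl : inst = instDecidableEqFin m := Subsingleton.elim _ _
        simp only [joinTuple_update_right, η.map_update_add]
      map_update_smul' w i c x := by
        rename_i inst
        obtain rfl : inst = instDecidableEqFin m := Subsingleton.elim _ _
        simp only [joinTuple_update_right, η.map_update_smul]
      map_eq_zero_of_eq' := fun w i j hw hij => η.map_eq_zero_of_eq _
        (i := Fin.cast h (i.natAdd n)) (j := Fin.cast h (j.natAdd n))
        (by simpa only [joinTuple_right] using hw) (by simpa using hij) }
  map_update_add' u i x y := by
    rename_i inst
    obtain rfl : inst = instDecidableEqFin n := Subsingleton.elim _ _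
    ext w
    exact (by simp only [joinTuple_update_left, η.map_update_add] :
      η (joinTuple h (Function.update u i (x + y)) w) =
        η (joinTuple h (Function.update u i x) w) + η (joinTuple h (Function.update u i y) w))
  map_update_smul' u i c x := by
    rename_i inst
    obtain rfl : inst = instDecidableEqFin n := Subsingleton.elim _ _
    ext w
    exact (by simp only [joinTuple_update_left, η.map_update_smul] :
      η (joinTuple h (Function.update u i (c • x)) w) =
        c • η (joinTuple h (Function.update u i x) w))
  map_eq_zero_of_eq' u i j hu hij := by
    ext w
    exact η.map_eq_zero_of_eq (joinTuple h u w)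
      (i := Fin.cast h (i.castAdd m)) (j := Fin.cast h (j.castAdd m))
      (by simpa only [joinTuple_left] using hu) (by simpa using hij)

theorem contract_apply (η : U [⋀^Fin N]→ₗ[ℂ] V) (h : n + m = N) (u : Fin n → U) (w : Fin m → U) :
    contract η h u w = η (joinTuple h u w) := rfl

theorem contract_snoc (η : U [⋀^Fin N]→ₗ[ℂ] V) (h : n + 1 + m = N) (h' : n + (m + 1) = N)
    (u : Fin n → U) (x : U) :
    contract η h (Fin.snoc u x : Fin (n + 1) → U) = (contract η h' u).curryLeft x := by
  ext w
  rw [contract_apply, joinTuple_snoc h h']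
  rfl

/-- A derivation acts on a contraction through both groups of arguments. -/
theorem contract_altDeriv (T : U →ₗ[ℂ] U) (η : U [⋀^Fin N]→ₗ[ℂ] V) (h : n + m = N)
    (u : Fin n → U) : contract (altDeriv T η) h u =
      altDeriv T (contract η h) u + altDeriv T (contract η h u) := by
  ext w
  rw [contract_apply, altDeriv_apply, altDeriv_apply, AlternatingMap.add_apply, altDeriv_apply,
    ← Equiv.sum_comp (finCongr h), Fin.sum_univ_add]
  congr 1
  · rw [altMap_sum_apply]
    refine Finset.sum_congr rfl fun i _ => ?_
    rw [contract_apply, joinTuple_update_left]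
    simp only [finCongr_apply, joinTuple_left]
  · refine Finset.sum_congr rfl fun i _ => ?_
    rw [contract_apply, joinTuple_update_right]
    simp only [finCongr_apply, joinTuple_right]

theorem map_snoc_eq (f : U [⋀^Fin (n + 1)]→ₗ[ℂ] V) (u : Fin n → U) (x : U) :
    f (Fin.snoc u x : Fin (n + 1) → U) = (-1 : ℂ) ^ n • f.curryLeft x u := by
  have h := f.map_insertNth (Fin.last n) x u
  rw [Fin.insertNth_last', Fin.val_last] at h
  rw [h, AlternatingMap.curryLeft_apply_apply]
  rcases Nat.even_or_odd n with hn | hn <;> simp [hn.neg_one_pow]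

/-- Contractions of a nonzero form `η` of top degree span all the forms of a given degree `m`: if
`xᵢ` and `εᵢ` are dual bases, then `∑ᵢ ι(xᵢ)(εᵢ ∧ S) = (N - m) S`. -/
theorem span_range_contract {ι : Type*} [Fintype ι] (b : Module.Basis ι ℂ U)
    (hN : Fintype.card ι = N) {η : U [⋀^Fin N]→ₗ[ℂ] ℂ} (hη : η ≠ 0) (n : ℕ) :
    ∀ (m : ℕ) (h : n + m = N), Submodule.span ℂ (Set.range (contract η h)) = ⊤ := by
  induction n with
  | zero =>
    intro m h
    obtain rfl : m = N := by omega
    obtain ⟨e⟩ : Nonempty (ι ≃ Fin m) := ⟨Fintype.equivFinOfCardEq hN⟩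
    have h1 : ∀ S : U [⋀^Fin m]→ₗ[ℂ] ℂ, S = S (b.reindex e) • (b.reindex e).det :=
      fun S => S.eq_smul_basis_det _
    have h2 : contract η h ![] = η := by
      ext w
      rw [contract_apply]
      congr 1
      ext i
      have := joinTuple_right h (![] : Fin 0 → U) w i
      rw [← this]; congr 1; ext; simp
    have h3 : η (b.reindex e) ≠ 0 := fun h0 => hη (by rw [h1 η, h0, zero_smul])
    refine eq_top_iff.2 fun S _ => ?_
    have h4 : S = (S (b.reindex e) / η (b.reindex e)) • contract η h ![] := by
      rw [h2, h1 S, h1 η, smul_smul]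
      simp only [AlternatingMap.smul_apply, Module.Basis.det_self, smul_eq_mul, mul_one]
      rw [div_mul_cancel₀ _ h3]
    rw [h4]
    exact Submodule.smul_mem _ _ (Submodule.subset_span ⟨_, rfl⟩)
  | succ n ih =>
    intro m h
    have h' : n + (m + 1) = N := by omega
    have hcl : ∀ (x : U) (T : U [⋀^Fin (m + 1)]→ₗ[ℂ] ℂ),
        T.curryLeft x ∈ Submodule.span ℂ (Set.range (contract η h)) := by
      intro x T
      have hT : T ∈ Submodule.span ℂ (Set.range (contract η h')) := ih (m + 1) h' ▸ trivial
      induction hT using Submodule.span_induction with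
      | mem T hT =>
        obtain ⟨u, rfl⟩ := hT
        rw [← contract_snoc η h h']
        exact Submodule.subset_span ⟨_, rfl⟩
      | zero => exact Submodule.zero_mem _
      | add T T' _ _ hT hT' => exact Submodule.add_mem _ hT hT'
      | smul c T _ hT => exact Submodule.smul_mem _ c hT
    refine eq_top_iff.2 fun S _ => ?_
    let g : ι → U →ₗ[ℂ] U [⋀^Fin m]→ₗ[ℂ] ℂ := fun i => (b.coord i).smulRight S
    -- `ι(xᵢ)(εᵢ ∧ S) = S - εᵢ ∧ ι(xᵢ)S`, and `∑ᵢ εᵢ ∧ ι(xᵢ)S = m S`; here `N - m = n + 1`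
    have key : ∑ i, (AlternatingMap.alternatizeUncurryFin (g i)).curryLeft (b i) =
        ((n + 1 : ℕ) : ℂ) • S := by
      cases m with
      | zero =>
        have h1 : ∀ i, (AlternatingMap.alternatizeUncurryFin (g i)).curryLeft (b i) = S := by
          intro i
          ext v
          rw [AlternatingMap.curryLeft_apply_apply, AlternatingMap.alternatizeUncurryFin_apply]
          simp only [Fin.sum_univ_succ, g]
          simp
        simp only [h1, Finset.sum_const, Finset.card_univ, hN]
        rw [← Nat.cast_smul_eq_nsmul ℂ]
        congr 2
        omega
      | succ m =>
        have h1 : ∀ i, (AlternatingMap.alternatizeUncurryFin (g i)).curryLeft (b i) =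
            S - AlternatingMap.alternatizeUncurryFinLM
              ((AlternatingMap.curryLeftLinearMap.flip (b i)) ∘ₗ g i) := by
          intro i
          rw [curryLeft_alternatize]
          simp [g]
        have h2 : ∑ i, (AlternatingMap.curryLeftLinearMap.flip (b i)) ∘ₗ g i =
            S.curryLeft ∘ₗ LinearMap.id := by
          ext1 y
          simp only [LinearMap.sum_apply, LinearMap.comp_apply, g, LinearMap.smulRight_apply,
            map_smul,
            LinearMap.flip_apply, AlternatingMap.curryLeftLinearMap_apply, LinearMap.id_apply,
            Module.Basis.coord_apply]
          conv_rhs => rw [← b.sum_repr y]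
          simp only [map_sum, map_smul]
        have h3 : altDeriv LinearMap.id S = ((m + 1 : ℕ) : ℂ) • S := by
          ext v
          rw [altDeriv_apply]
          simp [Function.update_eq_self]
        simp only [h1, Finset.sum_sub_distrib, ← map_sum, h2]
        rw [AlternatingMap.alternatizeUncurryFinLM_apply, ← altDeriv_eq_alternatize, h3]
        simp only [Finset.sum_const, Finset.card_univ, hN]
        rw [← Nat.cast_smul_eq_nsmul ℂ, ← sub_smul]
        congr 1
        rw [← h]
        push_cast
        ring
    have hn : ((n + 1 : ℕ) : ℂ) ≠ 0 := Nat.cast_ne_zero.2 n.succ_ne_zero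
    have hS : S = ((n + 1 : ℕ) : ℂ)⁻¹ •
        ∑ i, (AlternatingMap.alternatizeUncurryFin (g i)).curryLeft (b i) := by
      rw [key, smul_smul, inv_mul_cancel₀ hn, one_smul]
    rw [hS]
    exact Submodule.smul_mem _ _ (Submodule.sum_mem _ fun i _ => hcl _ _)

end Contract

/-! ### The duality between forms of complementary degrees -/

section Star

variable {U V : Type*} [AddCommGroup U] [Module ℂ U] [AddCommGroup V] [Module ℂ V] {n m N : ℕ}

/-- The bilinear map `(S, v) ↦ S ⊗ v` from scalar forms and vectors to vector-valued forms. -/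
def smulForm (U V : Type*) [AddCommGroup U] [Module ℂ U] [AddCommGroup V] [Module ℂ V] (m : ℕ) :
    (U [⋀^Fin m]→ₗ[ℂ] ℂ) →ₗ[ℂ] V →ₗ[ℂ] (U [⋀^Fin m]→ₗ[ℂ] V) :=
  LinearMap.mk₂ ℂ (fun S v => (LinearMap.toSpanSingleton ℂ V v).compAlternatingMap S)
    (fun S S' v => by ext w; simp) (fun c S v => by ext w; simp)
    (fun S v v' => by ext w; simp) (fun c S v => by ext w; simp [smul_comm c])

theorem smulForm_apply (S : U [⋀^Fin m]→ₗ[ℂ] ℂ) (v : V) (w : Fin m → U) :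
    smulForm U V m S v w = S w • v := by
  simp [smulForm]

/-- For a form `η` of degree `N = n + m`, the map sending `(u₁, …, uₙ)` to
`v ↦ η(u₁, …, uₙ, -) ⊗ v`. -/
def star (V : Type*) [AddCommGroup V] [Module ℂ V] (η : U [⋀^Fin N]→ₗ[ℂ] ℂ) (h : n + m = N) :
    U [⋀^Fin n]→ₗ[ℂ] (V →ₗ[ℂ] (U [⋀^Fin m]→ₗ[ℂ] V)) :=
  (smulForm U V m).compAlternatingMap (contract η h)

theorem star_eq (η : U [⋀^Fin N]→ₗ[ℂ] ℂ) (h : n + m = N) (u : Fin n → U) (v : V) :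
    star V η h u v = smulForm U V m (contract η h u) v := rfl

theorem star_apply (η : U [⋀^Fin N]→ₗ[ℂ] ℂ) (h : n + m = N) (u : Fin n → U) (v : V)
    (w : Fin m → U) : star V η h u v w = η (joinTuple h u w) • v := by
  rw [star_eq, smulForm_apply, contract_apply]

theorem star_snoc (η : U [⋀^Fin N]→ₗ[ℂ] ℂ) (h : n + 1 + m = N) (h' : n + (m + 1) = N)
    (u : Fin n → U) (x : U) (v : V) :
    star V η h (Fin.snoc u x : Fin (n + 1) → U) v = (star V η h' u v).curryLeft x := by
  ext w
  rw [star_apply, joinTuple_snoc h h', AlternatingMap.curryLeft_apply_apply, star_apply]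

theorem star_map (η : U [⋀^Fin N]→ₗ[ℂ] ℂ) (h : n + m = N) (r : V →ₗ[ℂ] V) (u : Fin n → U) (v : V) :
    r.compAlternatingMap (star V η h u v) = star V η h u (r v) := by
  ext w
  rw [LinearMap.compAlternatingMap_apply, star_apply, star_apply, map_smul]

/-- `star` is equivariant under derivations of `U` acting on `η` and on both groups of arguments. -/
theorem star_altDeriv (T : U →ₗ[ℂ] U) (η : U [⋀^Fin N]→ₗ[ℂ] ℂ) (h : n + m = N) (u : Fin n → U)
    (v : V) : star V (altDeriv T η) h u v =
      altDeriv T (star V η h) u v + altDeriv T (star V η h u v) := by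
  have h1 : altDeriv T (star V η h) = (smulForm U V m).compAlternatingMap
    (altDeriv T (contract η h)) := altDeriv_compAlternatingMap T _ _
  have h2 : altDeriv T (star V η h u v) = smulForm U V m (altDeriv T (contract η h u)) v := by
    ext w
    rw [altDeriv_apply, smulForm_apply, altDeriv_apply, Finset.sum_smul]
    exact Finset.sum_congr rfl fun i _ => smulForm_apply _ _ _
  rw [star_eq, contract_altDeriv, h1, h2, map_add]
  rfl

/-- The duality map `Hom(⋀ᵐU, V)^* → Hom(⋀ⁿU, V^*)` defined by a form `η` of degree `N = n + m`. It
sends `φ` to `(u₁, …, uₙ) ↦ (v ↦ φ(η(u₁, …, uₙ, -) ⊗ v))`. -/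
def poincare (η : U [⋀^Fin N]→ₗ[ℂ] ℂ) (h : n + m = N) :
    Module.Dual ℂ (U [⋀^Fin m]→ₗ[ℂ] V) →ₗ[ℂ] U [⋀^Fin n]→ₗ[ℂ] Module.Dual ℂ V where
  toFun φ := (LinearMap.compRight ℂ φ).compAlternatingMap (star V η h)
  map_add' φ ψ := by ext u v; rfl
  map_smul' c φ := by ext u v; rfl

theorem poincare_apply (η : U [⋀^Fin N]→ₗ[ℂ] ℂ) (h : n + m = N)
    (φ : Module.Dual ℂ (U [⋀^Fin m]→ₗ[ℂ] V)) (u : Fin n → U) (v : V) :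
    poincare η h φ u v = φ (star V η h u v) := rfl

theorem poincare_smul (c : ℂ) (η : U [⋀^Fin N]→ₗ[ℂ] ℂ) (h : n + m = N)
    (φ : Module.Dual ℂ (U [⋀^Fin m]→ₗ[ℂ] V)) : poincare (c • η) h φ = c • poincare η h φ := by
  ext u v
  rw [poincare_apply, AlternatingMap.smul_apply, LinearMap.smul_apply, poincare_apply, ← map_smul]
  congr 1
  ext w
  rw [star_apply, AlternatingMap.smul_apply, AlternatingMap.smul_apply, star_apply, smul_smul,
    smul_eq_mul]

/-- `V ⊗ Alt(Uᵐ, ℂ) ≅ Alt(Uᵐ, V)` for finite-dimensional `U`. -/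
theorem exists_smulForm_equiv (U V : Type*) [AddCommGroup U] [Module ℂ U] [AddCommGroup V]
    [Module ℂ V] [FiniteDimensional ℂ U] (m : ℕ) :
    ∃ e : V ⊗[ℂ] (U [⋀^Fin m]→ₗ[ℂ] ℂ) ≃ₗ[ℂ] U [⋀^Fin m]→ₗ[ℂ] V,
      ∀ v S, e (v ⊗ₜ S) = smulForm U V m S v := by
  let r : (U [⋀^Fin m]→ₗ[ℂ] V ⊗[ℂ] ℂ) →ₗ[ℂ] U [⋀^Fin m]→ₗ[ℂ] V :=
    (TensorProduct.rid ℂ V).toLinearMap.compAlternatingMapₗ (R := ℂ) (S := ℂ) (M := U) (ι := Fin m)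
  have hr : ∀ f w, r f w = TensorProduct.rid ℂ V (f w) := fun _ _ => rfl
  have hb : Function.Bijective (r ∘ₗ altTensor U V ℂ m) := by
    rw [LinearMap.coe_comp]
    refine Function.Bijective.comp ⟨fun f g hfg => ?_, fun f => ?_⟩ altTensor_bijective
    · ext1 w
      have := DFunLike.congr_fun hfg w
      rw [hr, hr] at this
      exact (TensorProduct.rid ℂ V).injective this
    · refine ⟨(TensorProduct.rid ℂ V).symm.toLinearMap.compAlternatingMap f, ?_⟩
      ext w
      rw [hr, LinearMap.compAlternatingMap_apply]
      exact (TensorProduct.rid ℂ V).apply_symm_apply _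
  refine ⟨LinearEquiv.ofBijective _ hb, fun v S => ?_⟩
  ext w
  rw [LinearEquiv.ofBijective_apply, LinearMap.comp_apply, hr, altTensor_tmul, smulForm_apply]
  exact TensorProduct.rid_tmul _ _

/-- Contraction of a nonzero top form identifies `⋀ⁿU` with `Alt(Uᵐ, ℂ)`. -/
theorem bijective_contract [FiniteDimensional ℂ U] {η : U [⋀^Fin N]→ₗ[ℂ] ℂ} (h : n + m = N)
    (hN : Module.finrank ℂ U = N) (hη : η ≠ 0) :
    Function.Bijective (exteriorPower.alternatingMapLinearEquiv (contract η h)) := by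
  have hs : Function.Surjective (exteriorPower.alternatingMapLinearEquiv (contract η h)) := by
    rw [← LinearMap.range_eq_top, eq_top_iff,
      ← span_range_contract (Module.finBasis ℂ U) (by simpa using hN) hη n m h, Submodule.span_le]
    rintro _ ⟨u, rfl⟩
    exact ⟨exteriorPower.ιMulti ℂ n u, exteriorPower.alternatingMapLinearEquiv_apply_ιMulti _ _⟩
  have : FiniteDimensional ℂ (U [⋀^Fin m]→ₗ[ℂ] ℂ) :=
    Module.Finite.equiv (exteriorPower.alternatingMapLinearEquiv (R := ℂ) (n := m) (M := U)
      (N := ℂ)).symm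
  refine ⟨(LinearMap.injective_iff_surjective_of_finrank_eq_finrank ?_).2 hs, hs⟩
  rw [(exteriorPower.alternatingMapLinearEquiv (R := ℂ) (n := m) (M := U) (N := ℂ)).finrank_eq,
    Module.finrank_linearMap, Module.finrank_self, mul_one, exteriorPower.finrank_eq,
    exteriorPower.finrank_eq, hN]
  exact Nat.choose_symm_of_eq_add h.symm

/-- `Hom(⋀ᵐU, V)^* ≅ Hom(⋀ⁿU, V^*)`: both sides are `(⋀ⁿU ⊗ V)^*`, as `Hom(⋀ᵐU, V) ≅ ⋀ⁿU ⊗ V` by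
contraction with `η`. -/
theorem poincare_bijective [FiniteDimensional ℂ U] {η : U [⋀^Fin N]→ₗ[ℂ] ℂ} (h : n + m = N)
    (hN : Module.finrank ℂ U = N) (hη : η ≠ 0) :
    Function.Bijective (poincare (V := V) η h) := by
  let c := LinearEquiv.ofBijective _ (bijective_contract h hN hη)
  have hc : ∀ u, c (exteriorPower.ιMulti ℂ n u) = contract η h u := fun u =>
    exteriorPower.alternatingMapLinearEquiv_apply_ιMulti _ _
  obtain ⟨e, he⟩ := exists_smulForm_equiv U V m
  refine ⟨(injective_iff_map_eq_zero _).2 fun φ hφ => ?_, fun ψ => ?_⟩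
  · have h0 : φ ∘ₗ e.toLinearMap = 0 := by
      refine TensorProduct.ext' fun v S => ?_
      have h1 : (LinearMap.applyₗ v ∘ₗ LinearMap.compRight ℂ φ ∘ₗ smulForm U V m) ∘ₗ
          c.toLinearMap = 0 := by
        refine exteriorPower.linearMap_ext ?_
        ext u
        change φ (smulForm U V m (c (exteriorPower.ιMulti ℂ n u)) v) = 0
        rw [hc, ← star_eq, ← poincare_apply, hφ]
        rfl
      have h2 := LinearMap.congr_fun h1 (c.symm S)
      change φ (smulForm U V m (c (c.symm S)) v) = 0 at h2
      rw [c.apply_symm_apply] at h2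
      change φ (e (v ⊗ₜ S)) = 0
      rw [he, h2]
    ext f
    have := LinearMap.congr_fun h0 (e.symm f)
    change φ (e (e.symm f)) = 0 at this
    rwa [e.apply_symm_apply] at this
  · let g := exteriorPower.alternatingMapLinearEquiv ψ ∘ₗ c.symm.toLinearMap
    refine ⟨TensorProduct.lift g.flip ∘ₗ e.symm.toLinearMap, ?_⟩
    ext u v
    rw [poincare_apply, star_eq, ← he, ← hc]
    change TensorProduct.lift g.flip (e.symm (e _)) = _
    rw [e.symm_apply_apply, TensorProduct.lift.tmul]
    change exteriorPower.alternatingMapLinearEquiv ψ (c.symm (c _)) v = _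
    rw [c.symm_apply_apply, exteriorPower.alternatingMapLinearEquiv_apply_ιMulti]

end Star

namespace CE

variable {L V : Type*} [LieRing L] [LieAlgebra ℂ L] {I : LieIdeal ℂ L}
  [AddCommGroup V] [Module ℂ V] {n m N : ℕ}

/-- The contragredient action on linear maps `V → X` through the source. -/
def homAct (ρ : L →ₗ[ℂ] Module.End ℂ V) (X : Type*) [AddCommGroup X] [Module ℂ X] :
    L →ₗ[ℂ] Module.End ℂ (V →ₗ[ℂ] X) :=
  LinearMap.mk₂ ℂ (fun x ζ => -(ζ ∘ₗ ρ x))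
    (fun x y ζ => by ext v; simp; abel) (fun c x ζ => by ext v; simp)
    (fun x ζ ζ' => by ext v; simp; abel) (fun c x ζ => by ext v; simp)

theorem homAct_apply (ρ : L →ₗ[ℂ] Module.End ℂ V) {X : Type*} [AddCommGroup X] [Module ℂ X] (x : L)
    (ζ : V →ₗ[ℂ] X) (v : V) : homAct ρ X x ζ v = -ζ (ρ x v) := rfl

theorem homAct_compRight (ρ : L →ₗ[ℂ] Module.End ℂ V) {X Y : Type*} [AddCommGroup X] [Module ℂ X]
    [AddCommGroup Y] [Module ℂ Y] (g : X →ₗ[ℂ] Y) (x : L) (ζ : V →ₗ[ℂ] X) :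
    LinearMap.compRight ℂ g (homAct ρ X x ζ) = homAct ρ Y x (LinearMap.compRight ℂ g ζ) := by
  ext v
  change g (-ζ (ρ x v)) = -g (ζ (ρ x v))
  rw [map_neg]

/-- The differential applied to the values of `star V η`, for a top form `η` invariant under `I`.
This is proved by induction on the number of contracted vectors with Cartan's formula. -/
theorem d_star (ρ : L →ₗ[ℂ] Module.End ℂ V) {η : I [⋀^Fin N]→ₗ[ℂ] ℂ}
    (hη : ∀ x : I, altDeriv (ad I (x : L)) η = 0) (htop : ∀ ψ : I [⋀^Fin (N + 1)]→ₗ[ℂ] V, ψ = 0)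
    (n : ℕ) : ∀ (m : ℕ) (h : n + 1 + m = N) (h' : n + (m + 1) = N) (u : Fin (n + 1) → I) (v : V),
    d ρ m (star V η h u v) = (-1 : ℂ) ^ (n + 1) • d (homAct ρ _) n (star V η h') u v := by
  have h0 : ∀ {n m : ℕ} (h : n + m = N) (x : I) (u : Fin n → I) (v : V),
      altDeriv (ad I (x : L)) (star V η h) u v + altDeriv (ad I (x : L)) (star V η h u v) = 0 := by
    intro n m h x u v
    rw [← star_altDeriv, hη]
    ext w
    rw [star_apply]
    simp
  induction n with
  | zero =>
    intro m h h' u v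
    obtain rfl : m + 1 = N := by omega
    obtain ⟨u', x, rfl⟩ : ∃ (u' : Fin 0 → I) (x : I), u = (Fin.snoc u' x : Fin 1 → I) :=
      ⟨_, _, (Fin.snoc_init_self u).symm⟩
    -- Cartan's formula for `star V η h' u' v`, which is `η ⊗ v` and hence closed of top degree
    have h1 := curryLeft_d ρ m (star V η h' u' v) x
    rw [htop (d ρ (m + 1) (star V η h' u' v)), act_apply, star_map] at h1
    have h2 := h0 h' x u' v
    rw [altDeriv_apply] at h2
    simp only [Finset.univ_eq_empty, Finset.sum_empty, LinearMap.zero_apply, zero_add] at h2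
    rw [h2, sub_zero] at h1
    change 0 = _ at h1
    rw [star_snoc η h h', ← sub_eq_zero.1 h1.symm, d_apply_zero, homAct_apply]
    have h3 : (Fin.snoc u' x : Fin 1 → I) 0 = x := Fin.snoc_last (α := fun _ => I) x u'
    rw [h3, Subsingleton.elim ![] u']
    simp
  | succ n ih =>
    intro m h h' u v
    obtain ⟨u', x, rfl⟩ : ∃ (u' : Fin (n + 1) → I) (x : I),
        u = (Fin.snoc u' x : Fin (n + 1 + 1) → I) := ⟨_, _, (Fin.snoc_init_self u).symm⟩
    have h'' : n + (m + 1 + 1) = N := by omega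
    -- `star` of `(u', x)` is the contraction with `x` of `star` of `u'`; Cartan's formula is
    -- applied to the form `star V η h' u' v` and to the form `star V η h'` in `u'`
    have h1 := curryLeft_d ρ m (star V η h' u' v) x
    rw [ih (m + 1) h' h'' u' v, act_apply, star_map] at h1
    let g : (I [⋀^Fin (m + 1 + 1)]→ₗ[ℂ] V) →ₗ[ℂ] (I [⋀^Fin (m + 1)]→ₗ[ℂ] V) :=
      AlternatingMap.curryLeftLinearMap.flip x
    have hg : (LinearMap.compRight ℂ g).compAlternatingMap (star V η h'') =
        (-1 : ℂ) ^ n • (star V η h').curryLeft x := by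
      ext1 u''
      rw [AlternatingMap.smul_apply, ← map_snoc_eq]
      ext1 v
      exact (star_snoc η h' h'' u'' x v).symm
    -- contraction of the values with `x` commutes with the differential in `u'`
    have h2 : (d (homAct ρ (I [⋀^Fin (m + 1 + 1)]→ₗ[ℂ] V)) n (star V η h'') u' v).curryLeft x =
        (-1 : ℂ) ^ n •
          d (homAct ρ (I [⋀^Fin (m + 1)]→ₗ[ℂ] V)) n ((star V η h').curryLeft x) u' v := by
      have := d_comp (I := I) (homAct ρ (I [⋀^Fin (m + 1 + 1)]→ₗ[ℂ] V)) n
        (homAct ρ (I [⋀^Fin (m + 1)]→ₗ[ℂ] V)) (LinearMap.compRight ℂ g)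
        (homAct_compRight ρ g) (star V η h'')
      rw [hg, map_smul] at this
      exact LinearMap.congr_fun (DFunLike.congr_fun this u') v
    have h3 := LinearMap.congr_fun (DFunLike.congr_fun
      (curryLeft_d (homAct ρ _) n (star V η h') x) u') v
    rw [act_apply] at h3
    simp only [AlternatingMap.sub_apply, LinearMap.sub_apply, LinearMap.compAlternatingMap_apply,
      homAct_apply] at h3
    rw [star_snoc η h h', map_snoc_eq]
    simp only [LinearMap.smul_apply, smul_smul]
    rw [h3]
    have h4 : ((-1 : ℂ) ^ (n + 1) • d (homAct ρ _) n (star V η h'') u' v).curryLeft x =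
        - d (homAct ρ _) n ((star V η h').curryLeft x) u' v := by
      have : ((-1 : ℂ) ^ (n + 1) • d (homAct ρ _) n (star V η h'') u' v).curryLeft x =
        (-1 : ℂ) ^ (n + 1) • (d (homAct ρ _) n (star V η h'') u' v).curryLeft x := rfl
      rw [this, h2, smul_smul, ← pow_add, show n + 1 + n = 2 * n + 1 by ring, pow_succ, pow_mul]
      simp
    rw [h4] at h1
    have h5 := eq_neg_of_add_eq_zero_right (h0 h' x u' v)
    rw [h5] at h1
    have h6 : (-1 : ℂ) ^ (n + 1 + 1) * (-1 : ℂ) ^ (n + 1) = -1 := by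
      rw [← pow_add, show n + 1 + 1 + (n + 1) = 2 * (n + 1) + 1 by ring, pow_succ, pow_mul]
      simp
    rw [h6]
    rw [sub_neg_eq_add, eq_sub_iff_add_eq] at h1
    rw [neg_one_smul, ← sub_eq_zero, ← sub_eq_zero.2 h1]
    abel

/-- For an invariant top form, the duality maps commute with the differentials up to sign. -/
theorem d_poincare (ρ : L →ₗ[ℂ] Module.End ℂ V) {η : I [⋀^Fin N]→ₗ[ℂ] ℂ}
    (hη : ∀ x : I, altDeriv (ad I (x : L)) η = 0) (htop : ∀ ψ : I [⋀^Fin (N + 1)]→ₗ[ℂ] V, ψ = 0)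
    (h : n + 1 + m = N) (h' : n + (m + 1) = N) (φ : Module.Dual ℂ (I [⋀^Fin (m + 1)]→ₗ[ℂ] V)) :
    d (homAct ρ ℂ) n (poincare η h' φ) = (-1 : ℂ) ^ (n + 1) • poincare η h (φ ∘ₗ d ρ m) := by
  ext u v
  have h1 := d_comp (I := I) (homAct ρ (I [⋀^Fin (m + 1)]→ₗ[ℂ] V)) n (homAct ρ ℂ)
    (LinearMap.compRight ℂ φ)
    (homAct_compRight ρ φ) (star V η h')
  have h2 := d_star ρ hη htop n m h h' u v
  refine (LinearMap.congr_fun (DFunLike.congr_fun h1.symm u) v).trans ?_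
  change φ (d (homAct ρ _) n (star V η h') u v) = (-1 : ℂ) ^ (n + 1) • φ (d ρ m (star V η h u v))
  rw [h2, map_smul, smul_smul, ← mul_pow]
  simp

/-- Equivariance of `(φ, η) ↦ poincare η h φ` under the Lie algebra `L`, which acts on `η` by its
adjoint action on the ideal `I`. -/
theorem act_poincare (ρ : L →ₗ[ℂ] Module.End ℂ V) (η : I [⋀^Fin N]→ₗ[ℂ] ℂ) (h : n + m = N) (x : L)
    (φ : Module.Dual ℂ (I [⋀^Fin m]→ₗ[ℂ] V)) :
    act I (homAct ρ ℂ) n x (poincare η h φ) =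
      poincare η h (-(φ ∘ₗ act I ρ m x)) + poincare (-altDeriv (ad I x) η) h φ := by
  have h1 : altDeriv (ad I x) (poincare η h φ) =
      (LinearMap.compRight ℂ φ).compAlternatingMap (altDeriv (ad I x) (star V η h)) :=
    altDeriv_compAlternatingMap _ _ _
  have h2 : poincare (-altDeriv (ad I x) η) h φ = - poincare (altDeriv (ad I x) η) h φ := by
    have := poincare_smul (-1 : ℂ) (altDeriv (ad I x) η) h φ
    rw [neg_one_smul] at this
    rw [this]
    ext u v
    exact neg_one_mul (poincare (altDeriv (ad I x) η) h φ u v)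
  rw [act_apply, h1, h2]
  ext u v
  change -φ (star V η h u (ρ x v)) - φ (altDeriv (ad I x) (star V η h) u v) =
    -φ (act I ρ m x (star V η h u v)) + -φ (star V (altDeriv (ad I x) η) h u v)
  rw [star_altDeriv, act_apply, star_map, map_sub, map_add]
  ring

/-- Equivariance of `(φ, η) ↦ poincare η h φ` under group elements, which act by `a` on `I` and by
`r` on `V`. -/
theorem twist_poincare (a a' : I →ₗ[ℂ] I) (ha : ∀ x, a (a' x) = x) (r : Module.End ℂ V)
    (η : I [⋀^Fin N]→ₗ[ℂ] ℂ) (h : n + m = N) (φ : Module.Dual ℂ (I [⋀^Fin m]→ₗ[ℂ] V)) :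
    twist n a (Module.Dual.transpose r) (poincare η h φ) =
      poincare (η.compLinearMap a) h (φ ∘ₗ twist m a' r) := by
  ext u v
  change φ (star V η h (fun i => a (u i)) (r v)) =
    φ (twist m a' r (star V (η.compLinearMap a) h u v))
  congr 1
  rw [twist_apply]
  ext w
  rw [star_apply, LinearMap.compAlternatingMap_apply, AlternatingMap.compLinearMap_apply,
    star_apply, map_smul, AlternatingMap.compLinearMap_apply]
  congr 2
  have := comp_joinTuple h a u fun i => a' (w i)
  simp only [ha] at this
  exact this.symm

end CE

/-! ### Averaging over compact groups -/

section ContSpan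

variable {H X Y Z : Type*} [TopologicalSpace H] [AddCommGroup X] [Module ℂ X] [AddCommGroup Y]
  [Module ℂ Y] [AddCommGroup Z] [Module ℂ Z]

/-- The functions `H → X` of finite rank with continuous coefficients, i.e. the finite sums
`h ↦ ∑ᵢ cᵢ(h) bᵢ` with continuous `cᵢ : H → ℂ` and `bᵢ ∈ X`. -/
def contSpan (H X : Type*) [TopologicalSpace H] [AddCommGroup X] [Module ℂ X] :
    Submodule ℂ (H → X) :=
  Submodule.span ℂ {g | ∃ c : H → ℂ, Continuous c ∧ ∃ b : X, g = fun h => c h • b}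

theorem smul_mem_contSpan {c : H → ℂ} (hc : Continuous c) (b : X) :
    (fun h => c h • b) ∈ contSpan H X := Submodule.subset_span ⟨c, hc, b, rfl⟩

theorem comp_mem_contSpan (T : X →ₗ[ℂ] Y) {g : H → X} (hg : g ∈ contSpan H X) :
    (fun h => T (g h)) ∈ contSpan H Y := by
  have : contSpan H X ≤ (contSpan H Y).comap (T.compLeft H) := by
    refine Submodule.span_le.2 ?_
    rintro _ ⟨c, hc, b, rfl⟩
    refine (congrArg (· ∈ contSpan H Y) (funext fun h => ?_)).mpr (smul_mem_contSpan hc (T b))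
    exact map_smul T (c h) b
  exact this hg

theorem bilin_mem_contSpan (β : X →ₗ[ℂ] Y →ₗ[ℂ] Z) {g : H → X} {g' : H → Y}
    (hg : g ∈ contSpan H X) (hg' : g' ∈ contSpan H Y) :
    (fun h => β (g h) (g' h)) ∈ contSpan H Z := by
  let L : (H → X) →ₗ[ℂ] (H → Y) →ₗ[ℂ] (H → Z) := LinearMap.mk₂ ℂ (fun g g' h => β (g h) (g' h))
    (fun _ _ _ => funext fun _ => by simp) (fun _ _ _ => funext fun _ => by simp)
    (fun _ _ _ => funext fun _ => by simp) (fun _ _ _ => funext fun _ => by simp)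
  have h1 : Submodule.map₂ L (contSpan H X) (contSpan H Y) ≤ contSpan H Z := by
    rw [contSpan, contSpan, Submodule.map₂_span_span]
    refine Submodule.span_le.2 ?_
    rintro _ ⟨_, ⟨c, hc, b, rfl⟩, _, ⟨c', hc', b', rfl⟩, rfl⟩
    refine (congrArg (· ∈ contSpan H Z) (funext fun h => ?_)).mpr
      (smul_mem_contSpan (hc.mul hc') (β b b'))
    change β (c h • b) (c' h • b') = _
    simp [smul_smul, mul_comm]
  exact h1 (Submodule.apply_mem_map₂ L hg hg')

/-- `h ↦ T(h)(g(h))` is continuous if `g` has finite rank with continuous coefficients and `T` is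
pointwise continuous. -/
theorem continuous_of_mem_contSpan {g : H → X} (hg : g ∈ contSpan H X) (T : H → X →ₗ[ℂ] ℂ)
    (hT : ∀ b, Continuous fun h => T h b) : Continuous fun h => T h (g h) := by
  induction hg using Submodule.span_induction with
  | zero => simp only [Pi.zero_apply, map_zero]; exact continuous_const
  | add a b _ _ ha hb => simp only [Pi.add_apply, map_add]; exact ha.add hb
  | smul a g _ h => simp only [Pi.smul_apply, map_smul]; exact h.const_smul a
  | mem g hg =>
    obtain ⟨c, hc, b, rfl⟩ := hg
    simp only [map_smul, smul_eq_mul]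
    exact hc.mul (hT b)

theorem mem_contSpan_comp {σ : H → H} (hσ : Continuous σ) {g : H → X} (hg : g ∈ contSpan H X) :
    g ∘ σ ∈ contSpan H X := by
  induction hg using Submodule.span_induction with
  | zero => exact (contSpan H X).zero_mem
  | add a b _ _ ha hb => exact (contSpan H X).add_mem ha hb
  | smul a g _ h => exact (contSpan H X).smul_mem a h
  | mem g hg =>
    obtain ⟨c, hc, b, rfl⟩ := hg
    exact smul_mem_contSpan (hc.comp hσ) b

/-- A function with values in a finite-dimensional subspace lies in `contSpan` if it is weakly
continuous. -/
theorem mem_contSpan_of_forall {g : H → X} (W : Submodule ℂ X) [FiniteDimensional ℂ W]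
    (hW : ∀ h, g h ∈ W) (hg : ∀ φ : X →ₗ[ℂ] ℂ, Continuous fun h => φ (g h)) :
    g ∈ contSpan H X := by
  let b := Module.finBasis ℂ W
  choose φ hφ using fun i => LinearMap.exists_extend (b.coord i)
  have e : g = ∑ i, fun h => φ i (g h) • (b i : X) := by
    ext h
    have h1 : ∀ i, φ i (g h) = b.repr ⟨g h, hW h⟩ i := fun i =>
      LinearMap.congr_fun (hφ i) ⟨g h, hW h⟩
    have h2 := congrArg Subtype.val (b.sum_repr ⟨g h, hW h⟩)
    rw [Finset.sum_apply]
    simp only [h1]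
    exact h2.symm.trans (by simp only [Submodule.coe_sum, Submodule.coe_smul])
  rw [e]
  exact Submodule.sum_mem _ fun i _ => smul_mem_contSpan (hg (φ i)) _

end ContSpan

namespace PreModule

/-- The action of `H` is locally finite and continuous: every orbit map `h ↦ h v` is a function of
finite rank with continuous coefficients. -/
def IsContinuous (M : PreModule p) : Prop :=
  ∀ v : M.V, (fun k : p.grp => M.rep k v) ∈ contSpan p.grp M.V

theorem IsHC.isContinuous_res {q : Subpair P} (h : p ≤ q) {M : PreModule q} (hM : M.IsHC) :
    (M.res h).IsContinuous := fun v =>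
  have : FiniteDimensional ℂ (M.orbitSpan v) := hM.locallyFinite v
  mem_contSpan_of_forall (X := M.V) (M.orbitSpan v)
    (fun k => M.rep_mem_orbitSpan (Subgroup.inclusion h.2 k) v)
    fun φ => (hM.continuous v φ).comp (continuous_inclusion h.2)

theorem IsContinuous.iso {M N : PreModule p} (h : M.IsContinuous) (e : M.Iso N) :
    N.IsContinuous := by
  obtain ⟨e, he⟩ := e
  intro v
  have h1 : ∀ k, N.rep k v = e (M.rep k (e.symm v)) := fun k => by
    have := he.rep k (e.symm v)
    simpa using this.symm
  simp only [h1]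
  exact comp_mem_contSpan e.toLinearMap (h _)

theorem IsContinuous.tensor {M N : PreModule p} (hM : M.IsContinuous) (hN : N.IsContinuous) :
    (M.tensor N).IsContinuous := by
  intro (t : M.V ⊗[ℂ] N.V)
  induction t with
  | zero =>
    refine (congrArg (· ∈ contSpan p.grp (M.tensor N).V) ?_).mpr (zero_mem _)
    exact funext fun k => map_zero ((M.tensor N).rep k)
  | add a b ha hb =>
    have := (contSpan p.grp (M.tensor N).V).add_mem ha hb
    refine (congrArg (· ∈ contSpan p.grp (M.tensor N).V) ?_).mpr this
    exact funext fun k => map_add ((M.tensor N).rep k) a b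
  | tmul a b => exact bilin_mem_contSpan (TensorProduct.mk ℂ M.V N.V) (hM a) (hN b)

/-- The elements of the locally finite dual `M^*` as linear forms on `M`. -/
def dualForm (M : PreModule p) : M.dual.V →ₗ[ℂ] Module.Dual ℂ M.V :=
  Submodule.subtype M.fullDual.finiteVectors

theorem dualForm_injective (M : PreModule p) : Function.Injective M.dualForm :=
  Subtype.val_injective

theorem dualForm_mem (M : PreModule p) (φ : M.dual.V) :
    FiniteDimensional ℂ (M.fullDual.orbitSpan (M.dualForm φ)) := φ.2

theorem exists_dualForm (M : PreModule p) (χ : Module.Dual ℂ M.V)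
    (h : FiniteDimensional ℂ (M.fullDual.orbitSpan χ)) : ∃ φ, M.dualForm φ = χ :=
  ⟨⟨χ, h⟩, rfl⟩

/-- If `H` is compact and acts locally finitely and continuously on `N`, then `H`-finite functionals
on submodules extend to `H`-finite functionals on `N`. Indeed, for a linear retraction `q` of the
inclusion, `μ ↦ (v ↦ ∫ μ(h q(h⁻¹ v)) dh)` is an equivariant extension operator. -/
theorem exists_finite_extension [IsTopologicalGroup p.grp] [CompactSpace p.grp] {A N : PreModule p}
    (hN : N.IsContinuous) {f : A.V →ₗ[ℂ] N.V} (hf : IsHom A N f) (hi : Function.Injective f)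
    (φ : A.dual.V) : ∃ ψ : N.dual.V, ∀ a, N.dualForm ψ (f a) = A.dualForm φ a := by
  obtain ⟨q, hq⟩ := LinearMap.exists_leftInverse_of_injective f (LinearMap.ker_eq_bot.2 hi)
  have hq' : ∀ a, q (f a) = a := fun a => LinearMap.congr_fun hq a
  let _ : MeasurableSpace p.grp := borel _
  have : BorelSpace p.grp := ⟨rfl⟩
  let μ : MeasureTheory.Measure p.grp := MeasureTheory.Measure.haarMeasure ⊤
  have hμ : μ.real Set.univ = 1 := by
    have := MeasureTheory.Measure.haarMeasure_self
      (K₀ := (⊤ : TopologicalSpace.PositiveCompacts p.grp))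
    rw [TopologicalSpace.PositiveCompacts.coe_top] at this
    rw [MeasureTheory.measureReal_def, this, ENNReal.toReal_one]
  have hA : ∀ (χ : Module.Dual ℂ A.V) (a : A.V), Continuous fun k => χ (A.rep k a) := by
    intro χ a
    have h := continuous_of_mem_contSpan (hN (f a)) (fun _ => χ ∘ₗ q) fun _ => continuous_const
    simpa only [LinearMap.comp_apply, ← hf.rep, hq'] using h
  have hc : ∀ (χ : Module.Dual ℂ A.V) (v : N.V),
      Continuous fun k => χ (A.rep k (q (N.rep k⁻¹ v))) :=
    fun χ v => continuous_of_mem_contSpan (mem_contSpan_comp continuous_inv (hN v))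
      (fun k => χ ∘ₗ A.rep k ∘ₗ q) fun b => hA χ (q b)
  have hint : ∀ (χ : Module.Dual ℂ A.V) (v : N.V),
      MeasureTheory.Integrable (fun k => χ (A.rep k (q (N.rep k⁻¹ v)))) μ := fun χ v =>
    (hc χ v).integrable_of_hasCompactSupport (HasCompactSupport.of_compactSpace _)
  let e : Module.Dual ℂ A.V →ₗ[ℂ] Module.Dual ℂ N.V := LinearMap.mk₂ ℂ
    (fun χ v => ∫ k, χ (A.rep k (q (N.rep k⁻¹ v))) ∂μ)
    (fun χ χ' v => MeasureTheory.integral_add (hint χ v) (hint χ' v))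
    (fun c χ v => MeasureTheory.integral_smul c _)
    (fun χ v w => by
      simp only [map_add]; exact MeasureTheory.integral_add (hint χ v) (hint χ w))
    (fun c χ v => by
      simp only [map_smul]; exact MeasureTheory.integral_smul c _)
  have he : ∀ χ v, e χ v = ∫ k, χ (A.rep k (q (N.rep k⁻¹ v))) ∂μ := fun _ _ => rfl
  have hrep : ∀ (k : p.grp) (χ : Module.Dual ℂ A.V),
      e (A.fullDual.rep k χ) = N.fullDual.rep k (e χ) := by
    intro k χ
    refine LinearMap.ext fun v => ?_
    change ∫ h, χ (A.rep k⁻¹ (A.rep h (q (N.rep h⁻¹ v)))) ∂μ =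
      ∫ h, χ (A.rep h (q (N.rep h⁻¹ (N.rep k⁻¹ v)))) ∂μ
    rw [← MeasureTheory.integral_mul_left_eq_self _ k]
    refine MeasureTheory.integral_congr_ae (Filter.Eventually.of_forall fun h => ?_)
    simp only [← Module.End.mul_apply, ← map_mul, mul_inv_rev, inv_mul_cancel_left]
  obtain ⟨ψ, hψ⟩ := N.exists_dualForm (e (A.dualForm φ)) (by
    let S : Submodule ℂ (Module.Dual ℂ A.V) := A.fullDual.orbitSpan (A.dualForm φ)
    have h1 : FiniteDimensional ℂ S := A.dualForm_mem φ
    have h2 : FiniteDimensional ℂ (S.map e) :=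
      Module.Finite.iff_fg.2 ((Module.Finite.iff_fg.1 h1).map e)
    exact @Submodule.finiteDimensional_of_le ℂ N.fullDual.V _ _ _ _ (S.map e) h2
      (N.fullDual.orbitSpan_le fun k =>
        ⟨_, A.fullDual.rep_mem_orbitSpan k (A.dualForm φ), hrep k _⟩))
  refine ⟨ψ, fun a => ?_⟩
  rw [hψ, he]
  simp only [← hf.rep, hq', ← Module.End.mul_apply, ← map_mul, mul_inv_cancel, map_one,
    Module.End.one_apply]
  rw [MeasureTheory.integral_const, hμ, one_smul]

end PreModule

/-! ### Continuity of the adjoint action -/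

namespace ReductivePair

theorem continuous_adC (P : ReductivePair E K 𝔤₀) (ψ : (ℂ ⊗[ℝ] 𝔤₀) →ₗ[ℂ] ℂ) (x : ℂ ⊗[ℝ] 𝔤₀) :
    Continuous fun k => ψ (P.adC k x) := by
  induction x with
  | zero => simpa using continuous_const
  | add x y hx hy => simp only [map_add]; exact hx.add hy
  | tmul z y =>
    let T : 𝔤₀ →ₗ[ℝ] ℂ := (ψ.restrictScalars ℝ) ∘ₗ TensorProduct.mk ℝ ℂ 𝔤₀ 1
    have h1 : ∀ k, ψ (P.adC k (z ⊗ₜ y)) = z * (((Complex.reLm ∘ₗ T) (P.Ad k y) : ℝ) +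
        ((Complex.imLm ∘ₗ T) (P.Ad k y) : ℝ) * Complex.I) := by
      intro k
      rw [P.adC_tmul, show z ⊗ₜ[ℝ] P.Ad k y = z • ((1 : ℂ) ⊗ₜ[ℝ] P.Ad k y) by
        rw [TensorProduct.smul_tmul', smul_eq_mul, mul_one], map_smul, smul_eq_mul]
      exact congrArg (z * ·) (Complex.re_add_im (T (P.Ad k y))).symm
    simp only [h1]
    have h2 : ∀ φ : 𝔤₀ →ₗ[ℝ] ℝ, Continuous fun k => φ (P.Ad k y) := fun φ =>
      (P.Ad_smooth y φ).continuous
    exact continuous_const.mul ((Complex.continuous_ofReal.comp (h2 _)).add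
      ((Complex.continuous_ofReal.comp (h2 _)).mul continuous_const))

end ReductivePair

/-- Normalizers of subspaces of `𝔤` are closed in `K`. -/
theorem isClosed_setNormalizer (P : ReductivePair E K 𝔤₀) [IsTopologicalGroup K]
    (W : Submodule ℂ (ℂ ⊗[ℝ] 𝔤₀)) : IsClosed (setNormalizer P (W : Set (ℂ ⊗[ℝ] 𝔤₀)) : Set K) := by
  have h1 : ∀ x, IsClosed {k : K | P.adC k x ∈ W} := by
    intro x
    have : {k : K | P.adC k x ∈ W} = ⋂ φ ∈ W.dualAnnihilator, {k | φ (P.adC k x) = 0} := by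
      ext k
      simp only [Set.mem_ofPred_eq, Set.mem_iInter]
      exact (Subspace.forall_mem_dualAnnihilator_apply_eq_zero_iff W _).symm
    rw [this]
    exact isClosed_biInter fun φ _ => isClosed_eq (P.continuous_adC φ x) continuous_const
  have h2 : (setNormalizer P (W : Set (ℂ ⊗[ℝ] 𝔤₀)) : Set K) =
      ⋂ x ∈ W, {k : K | P.adC k x ∈ W} ∩ (fun k => k⁻¹) ⁻¹' {k : K | P.adC k x ∈ W} := by
    ext k
    simp only [Set.mem_iInter, Set.mem_inter_iff, Set.mem_ofPred_eq, Set.mem_preimage]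
    constructor
    · exact fun hk x hx => ⟨(hk x).2 hx, ((setNormalizer P _).inv_mem hk x).2 hx⟩
    · intro hk x
      refine ⟨fun hx => ?_, fun hx => (hk x hx).1⟩
      have := (hk _ hx).2
      rwa [← P.adC_mul, inv_mul_cancel, P.adC_one] at this
  rw [h2]
  exact isClosed_biInter fun x _ => (h1 x).inter ((h1 x).preimage continuous_inv)

/-- `L ∩ K` is a closed subgroup of the compact group `K`. -/
theorem GermaneParabolic.compactSpace_leviGroup (Q : GermaneParabolic P) :
    CompactSpace Q.leviGroup := by
  have : IsTopologicalGroup K := topologicalGroup_of_lieGroup 𝓘(ℝ, E) ∞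
  refine isCompact_iff_compactSpace.1 (IsClosed.isCompact ?_)
  rw [GermaneParabolic.leviGroup, Subgroup.coe_inf, Subgroup.coe_inf]
  refine ((isClosed_setNormalizer P Q.𝔮.toSubmodule).inter ?_).inter
    (isClosed_setNormalizer P Q.𝔩.toSubmodule)
  have := isClosed_setNormalizer P (Q.𝔮.toSubmodule.map (P.thetaC : (ℂ ⊗[ℝ] 𝔤₀) →ₗ[ℂ] ℂ ⊗[ℝ] 𝔤₀))
  rwa [Submodule.map_coe] at this

namespace PreModule

/-- Expansion of a cochain in a basis of `𝔲`. -/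
theorem ev_eq_sum {M : PreModule p} {n : ℕ} {ι : Type*} [Fintype ι]
    (b : Module.Basis ι ℂ p.nilRad) (f : (M.cochain n).V) (w : Fin n → p.nilRad) :
    ev f w = ∑ j : Fin n → ι, (∏ i, b.repr (w i) (j i)) • ev f fun i => b (j i) := by
  let F : MultilinearMap ℂ (fun _ : Fin n => p.nilRad) M.V :=
    AlternatingMap.toMultilinearMap (R := ℂ) (M := p.nilRad) (N := M.V) (ι := Fin n) f
  have h : w = fun i => ∑ j, b.repr (w i) j • b j := funext fun i => (b.sum_repr _).symm
  refine (congrArg F h).trans ((MultilinearMap.map_sum F _).trans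
    (Finset.sum_congr rfl fun j _ => MultilinearMap.map_smul_univ F _ _))

/-- The `H`-module `⋀ⁿ𝔲^*` is continuous. -/
theorem isContinuous_cochain_triv (p : Subpair P) [IsTopologicalGroup p.grp] (n : ℕ) :
    ((triv p).cochain n).IsContinuous := by
  intro f
  let b := Module.finBasis ℂ p.nilRad
  have hU : ∀ (φ : p.nilRad →ₗ[ℂ] ℂ) (x : p.nilRad), Continuous fun k => φ (p.actRad k x) := by
    intro φ x
    obtain ⟨φ', hφ'⟩ := LinearMap.exists_extend (p := p.nilRad.toSubmodule) φ
    obtain ⟨ψ, hψ⟩ := LinearMap.exists_extend (p := p.alg.toSubmodule) φ'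
    have h1 : ∀ k, φ (p.actRad k x) = ψ (P.adC k x) := fun k =>
      (LinearMap.congr_fun hφ' (p.actRad k x)).symm.trans
        (LinearMap.congr_fun hψ (p.actRad k x : p.alg)).symm
    simp only [h1]
    exact (P.continuous_adC ψ x).comp continuous_subtype_val
  have hev : ∀ w : Fin n → p.nilRad, Continuous fun k : p.grp =>
      (ev ((((triv p).cochain n).rep k) f) w).down := by
    intro w
    have hc : ∀ i j, Continuous fun k : p.grp => b.repr (p.actRad k⁻¹ (w i)) j := fun i j =>
      (hU (b.coord j) (w i)).comp continuous_inv
    have h0 : ∀ k : p.grp, (ev ((((triv p).cochain n).rep k) f) w).down =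
        ∑ j : Fin n → Fin (Module.finrank ℂ p.nilRad),
          (∏ i, b.repr (p.actRad k⁻¹ (w i)) (j i)) * (ev f fun i => b (j i)).down := by
      intro k
      let D : (triv p).V →ₗ[ℂ] ℂ :=
        { toFun := ULift.down
          map_add' := fun _ _ => rfl
          map_smul' := fun _ _ => rfl }
      have h := congrArg D (ev_eq_sum b f fun i => p.actRad k⁻¹ (w i))
      rw [map_sum] at h
      exact h
    simp only [h0]
    exact continuous_finsetSum _ fun j _ =>
      (continuous_finsetProd _ fun i _ => hc i (j i)).mul continuous_const
  let T : ((triv p).cochain n).V →ₗ[ℂ] ((Fin n → Fin (Module.finrank ℂ p.nilRad)) → ℂ) :=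
    LinearMap.pi fun j =>
      { toFun := fun f => (ev f fun i => b (j i)).down
        map_add' := fun _ _ => rfl
        map_smul' := fun _ _ => rfl }
  have hT : Function.Injective T := by
    refine (injective_iff_map_eq_zero T).2 fun f hf => ?_
    refine Module.Basis.ext_alternating (R' := ℂ) (N₁ := p.nilRad) (N₂ := ULift.{u} ℂ) b
      fun j _ => ?_
    exact ULift.ext _ _ (congrFun hf j)
  obtain ⟨s, hs⟩ := LinearMap.exists_leftInverse_of_injective T (LinearMap.ker_eq_bot.2 hT)
  have h1 : (fun k : p.grp => T (((triv p).cochain n).rep k f)) ∈ contSpan p.grp _ :=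
    mem_contSpan_of_forall ⊤ (fun _ => trivial) fun φ => by
      have : ∀ y : (Fin n → Fin (Module.finrank ℂ p.nilRad)) → ℂ, φ y =
          ∑ j, y j * φ (Pi.single j 1) := fun y =>
        (LinearMap.pi_apply_eq_sum_univ φ y).trans (Finset.sum_congr rfl fun j _ => by
          rw [smul_eq_mul]; congr 2; ext i; simp [Pi.single_apply, eq_comm])
      have h0 : ∀ k, φ (T (((triv p).cochain n).rep k f)) = _ := fun k => this _
      simp only [h0]
      exact continuous_finsetSum _ fun j _ => (hev _).mul continuous_const
  have h2 := comp_mem_contSpan s h1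
  have h3 : ∀ k, s (T (((triv p).cochain n).rep k f)) = ((triv p).cochain n).rep k f :=
    fun k => LinearMap.congr_fun hs _
  simpa only [h3] using h2

theorem IsContinuous.cochain [IsTopologicalGroup p.grp] {M : PreModule p} (hM : M.IsContinuous)
    (n : ℕ) : (M.cochain n).IsContinuous :=
  (hM.tensor (isContinuous_cochain_triv p n)).iso (cochain_iso_tensor M n)

end PreModule

/-! ### Poincaré duality for `𝔲`-cohomology -/

/-- `poincare` as a bilinear map. -/
def poincareLM {U : Type*} (V : Type*) [AddCommGroup U] [Module ℂ U] [AddCommGroup V] [Module ℂ V]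
    {n m N : ℕ} (h : n + m = N) :
    Module.Dual ℂ (U [⋀^Fin m]→ₗ[ℂ] V) →ₗ[ℂ] (U [⋀^Fin N]→ₗ[ℂ] ℂ) →ₗ[ℂ]
      U [⋀^Fin n]→ₗ[ℂ] Module.Dual ℂ V :=
  LinearMap.mk₂ ℂ (fun φ η => poincare η h φ)
    (fun φ φ' η => map_add _ _ _) (fun c φ η => map_smul _ _ _)
    (fun φ η η' => by
      ext u v
      change φ _ = φ _ + φ _
      rw [← map_add]
      congr 1
      ext w
      refine (star_apply (η + η') h u v w).trans ((add_smul (η _) (η' _) v).trans ?_)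
      exact congrArg₂ (· + ·) (star_apply η h u v w).symm (star_apply η' h u v w).symm)
    (fun c φ η => poincare_smul c η h φ)

namespace PreModule

/-- Elements of `⋀ⁿ𝔲^*` as scalar-valued forms. -/
def scalarForm (p : Subpair P) (n : ℕ) :
    ((triv p).cochain n).V →ₗ[ℂ] (p.nilRad [⋀^Fin n]→ₗ[ℂ] ℂ) :=
  ({ toFun := ULift.down
     map_add' := fun _ _ => rfl
     map_smul' := fun _ _ => rfl } : (triv p).V →ₗ[ℂ] ℂ).compAlternatingMapₗ
      (R := ℂ) (S := ℂ) (M := p.nilRad) (ι := Fin n)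

theorem scalarForm_apply {n : ℕ} (f : ((triv p).cochain n).V) (w : Fin n → p.nilRad) :
    scalarForm p n f w = (ev f w).down := rfl

theorem scalarForm_injective (n : ℕ) : Function.Injective (scalarForm p n) := fun _ _ h =>
  ev_ext fun w => ULift.ext _ _ (DFunLike.congr_fun h w)

theorem scalarForm_surjective (n : ℕ) : Function.Surjective (scalarForm p n) := fun f =>
  ⟨({ toFun := ULift.up
      map_add' := fun _ _ => rfl
      map_smul' := fun _ _ => rfl } : ℂ →ₗ[ℂ] (triv p).V).compAlternatingMap f, rfl⟩

theorem scalarForm_lie {n : ℕ} (x : p.alg) (f : ((triv p).cochain n).V) :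
    scalarForm p n (((triv p).cochain n).lie x f) =
      -altDeriv (CE.ad p.nilRad x) (scalarForm p n f) := by
  ext w
  rw [AlternatingMap.neg_apply, altDeriv_apply, scalarForm_apply, ev_lie]
  have h : (triv p).lie x (ev f w) = 0 := rfl
  rw [h, zero_sub]
  refine congrArg Neg.neg ?_
  exact map_sum ({ toFun := ULift.down
                   map_zero' := rfl
                   map_add' := fun _ _ => rfl } : (triv p).V →+ ℂ) _ _

/-- `⋀^N 𝔲^*` is one-dimensional for `N = dim 𝔲`. -/
theorem exists_topForm {N : ℕ} (hN : Module.finrank ℂ p.nilRad = N) :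
    ∃ τ : ((triv p).cochain N).V, τ ≠ 0 ∧ ∀ y : ((triv p).cochain N).V, ∃ c : ℂ, y = c • τ := by
  let b := Module.finBasisOfFinrankEq ℂ p.nilRad hN
  obtain ⟨τ, hτ⟩ := scalarForm_surjective N b.det
  refine ⟨τ, ?_, fun y => ⟨scalarForm p N y b, scalarForm_injective N ?_⟩⟩
  · rintro rfl
    have h1 := b.det_self
    rw [← hτ, map_zero] at h1
    exact zero_ne_one h1
  · rw [map_smul, hτ]
    exact AlternatingMap.eq_smul_basis_det b _

/-- `𝔲` acts trivially on `⋀^N𝔲^*`: endomorphisms of a line commute, so commutators act by zero. -/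
theorem altDeriv_topForm {N : ℕ} (hN : Module.finrank ℂ p.nilRad = N) (η : ((triv p).cochain N).V)
    (x : p.nilRad) : altDeriv (CE.ad p.nilRad (x : p.alg)) (scalarForm p N η) = 0 := by
  obtain ⟨τ, -, h⟩ := exists_topForm hN
  have hc : ∀ x y : p.alg, ∀ v : ((triv p).cochain N).V, ((triv p).cochain N).lie x
      (((triv p).cochain N).lie y v) =
        ((triv p).cochain N).lie y (((triv p).cochain N).lie x v) := by
    intro x y v
    obtain ⟨a, rfl⟩ := h v
    obtain ⟨b, hb⟩ := h (((triv p).cochain N).lie x τ)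
    obtain ⟨c, hc⟩ := h (((triv p).cochain N).lie y τ)
    simp only [map_smul, hb, hc, smul_smul]
    congr 1
    ring
  have h0 : ((triv p).cochain N).lie (x : p.alg) = 0 :=
    map_nilpotentRadical_eq_zero ((triv p).cochain N).lie (fun x y => LinearMap.ext fun v => by
      rw [((triv p).cochain N).lie_lie, hc, sub_self]; rfl) x.2
  have h1 := scalarForm_lie (x : p.alg) η
  rw [h0, LinearMap.zero_apply, map_zero] at h1
  exact neg_eq_zero.1 h1.symm

section TensorLine

variable {X Λ : PreModule p} {τ : Λ.V}

theorem tmul_smul_left (c : ℂ) (x : X.V) : tmul (c • x) τ = c • tmul x τ := rfl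

theorem tmul_smul_right (c : ℂ) (x : X.V) : tmul x (c • τ) = c • tmul x τ :=
  TensorProduct.tmul_smul (R := ℂ) c x τ

/-- The map `x ↦ x ⊗ τ`. -/
def tmulRight (X : PreModule p) {Λ : PreModule p} (τ : Λ.V) : X.V →ₗ[ℂ] (X.tensor Λ).V :=
  (TensorProduct.mk ℂ X.V Λ.V).flip τ

theorem tmulRight_apply (x : X.V) : tmulRight X τ x = tmul x τ := rfl

theorem tmulRight_injective (hτ : τ ≠ 0) : Function.Injective (tmulRight X τ) := by
  obtain ⟨l, hl⟩ := Module.Projective.exists_dual_ne_zero ℂ hτ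
  let T : X.V ⊗[ℂ] Λ.V →ₗ[ℂ] X.V := TensorProduct.rid ℂ X.V ∘ₗ l.lTensor X.V
  have hT : ∀ x, T (x ⊗ₜ τ) = l τ • x := fun x => by simp [T]
  intro x y hxy
  have h1 : T (x ⊗ₜ τ) = T (y ⊗ₜ τ) := congrArg T hxy
  rw [hT, hT] at h1
  exact smul_right_injective _ hl h1

theorem tmulRight_surjective (hτ : ∀ y : Λ.V, ∃ c : ℂ, y = c • τ) :
    Function.Surjective (tmulRight X τ) := by
  intro (t : X.V ⊗[ℂ] Λ.V)
  induction t with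
  | zero => exact ⟨0, map_zero _⟩
  | add a b ha hb =>
    obtain ⟨x, hx⟩ := ha
    obtain ⟨y, hy⟩ := hb
    refine ⟨x + y, (map_add _ x y).trans ?_⟩
    rw [hx, hy]
    rfl
  | tmul x y =>
    obtain ⟨c, rfl⟩ := hτ y
    exact ⟨c • x, (map_smul _ c x).trans (tmul_smul_right c x).symm⟩

/-- If `Λ = ℂτ`, then `x` is `H`-finite if `x ⊗ τ` is. -/
theorem finite_of_tmul_right (h0 : τ ≠ 0) (hτ : ∀ y : Λ.V, ∃ c : ℂ, y = c • τ) {x : X.V}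
    (hx : FiniteDimensional ℂ ((X.tensor Λ).orbitSpan (tmul x τ))) :
    FiniteDimensional ℂ (X.orbitSpan x) := by
  obtain ⟨s, hs⟩ := LinearMap.exists_leftInverse_of_injective _
    (LinearMap.ker_eq_bot.2 (tmulRight_injective (X := X) h0))
  have hs' : ∀ y, s (tmul y τ) = y := fun y => LinearMap.congr_fun hs y
  refine Submodule.finiteDimensional_of_le (S₂ := ((X.tensor Λ).orbitSpan (tmul x τ)).map s)
    (X.orbitSpan_le fun k => ?_)
  obtain ⟨c, hc⟩ := hτ (Λ.rep k τ)
  have hc0 : c ≠ 0 := by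
    rintro rfl
    rw [zero_smul] at hc
    refine h0 ?_
    have := congrArg (Λ.rep k⁻¹) hc
    rwa [← Module.End.mul_apply, ← map_mul, inv_mul_cancel, map_one, map_zero] at this
  have h2 : tmul (X.rep k x) τ = c⁻¹ • (X.tensor Λ).rep k (tmul x τ) := by
    rw [tensor_rep_tmul, hc, tmul_smul_right, smul_smul, inv_mul_cancel₀ hc0, one_smul]
  exact ⟨_, Submodule.smul_mem _ c⁻¹ ((X.tensor Λ).rep_mem_orbitSpan k _), by rw [← h2, hs']⟩

/-- Tensoring an `H`-finite vector with a vector of a finite-dimensional module gives an `H`-finite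
vector. -/
theorem finite_tmul {x : X.V} (hx : FiniteDimensional ℂ (X.orbitSpan x))
    [FiniteDimensional ℂ Λ.V] (y : Λ.V) :
    FiniteDimensional ℂ ((X.tensor Λ).orbitSpan (tmul x y)) := by
  let W : Submodule ℂ (X.tensor Λ).V :=
    Submodule.map₂ (TensorProduct.mk ℂ X.V Λ.V) (X.orbitSpan x) ⊤
  have : FiniteDimensional ℂ W :=
    Module.Finite.iff_fg.2 (Submodule.FG.map₂ _ (Module.Finite.iff_fg.1 hx) Module.Finite.fg_top)
  exact Submodule.finiteDimensional_of_le (S₂ := W) ((X.tensor Λ).orbitSpan_le fun k =>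
    Submodule.apply_mem_map₂ _ (X.rep_mem_orbitSpan k x) trivial)

end TensorLine

theorem finite_map {M N : PreModule p} {f : M.V →ₗ[ℂ] N.V} (hf : IsHom M N f) {v : M.V}
    (hv : FiniteDimensional ℂ (M.orbitSpan v)) : FiniteDimensional ℂ (N.orbitSpan (f v)) :=
  Submodule.finiteDimensional_of_le (S₂ := (M.orbitSpan v).map f) (N.orbitSpan_le fun k =>
    ⟨_, M.rep_mem_orbitSpan k v, hf.rep k v⟩)

theorem finite_of_map {M N : PreModule p} {f : M.V →ₗ[ℂ] N.V} (hf : IsHom M N f)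
    (hi : Function.Injective f) {v : M.V} (hv : FiniteDimensional ℂ (N.orbitSpan (f v))) :
    FiniteDimensional ℂ (M.orbitSpan v) := by
  obtain ⟨s, hs⟩ := LinearMap.exists_leftInverse_of_injective f (LinearMap.ker_eq_bot.2 hi)
  exact Submodule.finiteDimensional_of_le (S₂ := (N.orbitSpan (f v)).map s) (M.orbitSpan_le fun k =>
    ⟨_, N.rep_mem_orbitSpan k _, by rw [← hf.rep]; exact LinearMap.congr_fun hs _⟩)

/-- The map `f ⊗ id`. -/
def rMap (F : PreModule p) {M N : PreModule p} (f : M.V →ₗ[ℂ] N.V) :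
    (M.tensor F).V →ₗ[ℂ] (N.tensor F).V := f.rTensor F.V

theorem rMap_tmul (F : PreModule p) {M N : PreModule p} (f : M.V →ₗ[ℂ] N.V) (a : M.V) (b : F.V) :
    rMap F f (tmul a b) = tmul (f a) b := rfl

theorem rMap_injective (F : PreModule p) {M N : PreModule p} {f : M.V →ₗ[ℂ] N.V}
    (hf : Function.Injective f) : Function.Injective (rMap F f) :=
  Module.Flat.rTensor_preserves_injective_linearMap f hf

theorem IsHom.rMap {M N : PreModule p} {f : M.V →ₗ[ℂ] N.V} (hf : IsHom M N f) (F : PreModule p) :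
    IsHom (M.tensor F) (N.tensor F) (rMap F f) := hf.rTensor F

/-! #### Duals -/

/-- The inclusion of the locally finite dual in the full dual. -/
def dualι (M : PreModule p) : M.dual.V →ₗ[ℂ] M.fullDual.V :=
  Submodule.subtype M.fullDual.finiteVectors

theorem dualι_isHom (M : PreModule p) : IsHom M.dual M.fullDual M.dualι := isHom_subtype _ _

theorem dualι_injective (M : PreModule p) : Function.Injective M.dualι := Subtype.val_injective

theorem finite_dual (M : PreModule p) (φ : M.dual.V) : FiniteDimensional ℂ (M.dual.orbitSpan φ) :=
  finite_of_map M.dualι_isHom M.dualι_injective φ.2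

theorem transpose_isHom {A B : PreModule p} {f : A.V →ₗ[ℂ] B.V} (hf : IsHom A B f) :
    IsHom B.fullDual A.fullDual (Module.Dual.transpose (R := ℂ) (M := A.V) (M' := B.V) f) where
  lie x φ := LinearMap.ext fun v =>
    congrArg (fun t => -(show Module.Dual ℂ B.V from φ) t) (hf.lie x v).symm
  rep k φ := LinearMap.ext fun v =>
    congrArg (fun t => (show Module.Dual ℂ B.V from φ) t) (hf.rep k⁻¹ v).symm

/-- The transpose of a homomorphism, on locally finite duals. -/
def dualMap {A B : PreModule p} {f : A.V →ₗ[ℂ] B.V} (hf : IsHom A B f) : B.dual.V →ₗ[ℂ] A.dual.V :=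
  LinearMap.restrict (p := B.fullDual.finiteVectors) (q := A.fullDual.finiteVectors)
    (Module.Dual.transpose (R := ℂ) (M := A.V) (M' := B.V) f)
    fun _ hv => finite_map (transpose_isHom hf) hv

theorem dualMap_isHom {A B : PreModule p} {f : A.V →ₗ[ℂ] B.V} (hf : IsHom A B f) :
    IsHom B.dual A.dual (dualMap hf) :=
  ⟨fun x φ => Subtype.ext ((transpose_isHom hf).lie x φ.1),
    fun k φ => Subtype.ext ((transpose_isHom hf).rep k φ.1)⟩

theorem dualForm_dualMap {A B : PreModule p} {f : A.V →ₗ[ℂ] B.V} (hf : IsHom A B f) (φ : B.dual.V)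
    (a : A.V) : A.dualForm (dualMap hf φ) a = B.dualForm φ (f a) := rfl

theorem dual_ext {A : PreModule p} {φ ψ : A.dual.V} (h : ∀ a, A.dualForm φ a = A.dualForm ψ a) :
    φ = ψ := A.dualForm_injective (LinearMap.ext h)

theorem dualMap_injective {A B : PreModule p} {f : A.V →ₗ[ℂ] B.V} (hf : IsHom A B f)
    (hs : Function.Surjective f) : Function.Injective (dualMap hf) :=
  fun φ ψ h => dual_ext fun b => by
  obtain ⟨a, rfl⟩ := hs b
  rw [← dualForm_dualMap hf, h, dualForm_dualMap]

/-- An `H`-finite functional that vanishes on the kernel of a surjective homomorphism factors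
through it. -/
theorem exists_dualMap_eq {A B : PreModule p} {f : A.V →ₗ[ℂ] B.V} (hf : IsHom A B f)
    (hs : Function.Surjective f) (φ : A.dual.V) (h : ∀ a, f a = 0 → A.dualForm φ a = 0) :
    ∃ ψ, dualMap hf ψ = φ := by
  obtain ⟨s, hs'⟩ := LinearMap.exists_rightInverse_of_surjective f (LinearMap.range_eq_top.2 hs)
  have h1 : ∀ a, A.dualForm φ (s (f a)) = A.dualForm φ a := fun a => by
    rw [← sub_eq_zero, ← map_sub]
    refine h _ ?_
    rw [map_sub, sub_eq_zero]
    exact LinearMap.congr_fun hs' (f a)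
  have h2 : Module.Dual.transpose (R := ℂ) (M := A.V) (M' := B.V) f (A.dualForm φ ∘ₗ s) =
      A.dualForm φ := LinearMap.ext h1
  have hinj : Function.Injective (Module.Dual.transpose (R := ℂ) (M := A.V) (M' := B.V) f) :=
    LinearMap.dualMap_injective_of_surjective hs
  obtain ⟨ψ, hψ⟩ := B.exists_dualForm (A.dualForm φ ∘ₗ s)
    (finite_of_map (transpose_isHom hf) hinj
      ((congrArg (fun t : A.fullDual.V => FiniteDimensional ℂ (A.fullDual.orbitSpan t)) h2).mpr
        (A.dualForm_mem φ)))
  exact ⟨ψ, dual_ext fun a => by rw [dualForm_dualMap, hψ]; exact h1 a⟩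

/-! #### Finiteness of cochains -/

/-- The values of an `H`-finite cochain are `H`-finite: the translates of `f(w)` lie in the span of
the values of the translates of `f` on a basis. -/
theorem finite_ev {N : PreModule p} {n : ℕ} {f : (N.cochain n).V}
    (hf : FiniteDimensional ℂ ((N.cochain n).orbitSpan f)) (w : Fin n → p.nilRad) :
    FiniteDimensional ℂ (N.orbitSpan (ev f w)) := by
  let b := Module.finBasis ℂ p.nilRad
  let evL : (Fin n → p.nilRad) → (N.cochain n).V →ₗ[ℂ] N.V := fun w =>
    { toFun := fun f => ev f w
      map_add' := fun _ _ => rfl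
      map_smul' := fun _ _ => rfl }
  let S : Submodule ℂ N.V := ⨆ j : Fin n → Fin (Module.finrank ℂ p.nilRad),
    ((N.cochain n).orbitSpan f).map (evL fun i => b (j i))
  refine Submodule.finiteDimensional_of_le (S₂ := S) (N.orbitSpan_le fun k => ?_)
  have h1 : N.rep k (ev f w) = ev ((N.cochain n).rep k f) fun i => p.actRad k (w i) := by
    rw [ev_rep]
    congr 2
    ext i
    exact congrArg Subtype.val (p.inv_act_act k (w i)).symm
  rw [h1, ev_eq_sum b]
  refine Submodule.sum_mem _ fun j _ => Submodule.smul_mem _ _ ?_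
  exact Submodule.mem_iSup_of_mem j ⟨_, (N.cochain n).rep_mem_orbitSpan k f, rfl⟩

/-- Cochains with values in a locally finite module are `H`-finite. -/
theorem finite_cochain {M : PreModule p} (hM : ∀ v, FiniteDimensional ℂ (M.orbitSpan v)) (n : ℕ)
    (f : (M.cochain n).V) : FiniteDimensional ℂ ((M.cochain n).orbitSpan f) := by
  obtain ⟨e, he⟩ := cochain_iso_tensor M n
  have h : ∀ t : M.V ⊗[ℂ] ((triv p).cochain n).V,
      t ∈ (M.tensor ((triv p).cochain n)).finiteVectors := by
    intro t
    induction t with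
    | zero => exact zero_mem _
    | add a b ha hb => exact add_mem ha hb
    | tmul a b => exact finite_tmul (hM a) b
  have := finite_map he (h (e.symm f))
  rwa [LinearEquiv.coe_coe, e.apply_symm_apply] at this

/-- A cochain with `H`-finite values in the full dual is a cochain with values in the locally finite
dual. -/
theorem exists_cochainMap_dualι {M : PreModule p} {n : ℕ} {f : (M.fullDual.cochain n).V}
    (hf : ∀ w, FiniteDimensional ℂ (M.fullDual.orbitSpan (ev f w))) :
    ∃ g : (M.dual.cochain n).V, cochainMap M.dualι n g = f := by
  have h := M.fullDual.shortExact_sub_quot _ M.fullDual.stable_finiteVectors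
  refine (cochainMap_exact M.dualι_injective h.exact n f).1 (ev_ext fun w => ?_)
  exact (Submodule.Quotient.mk_eq_zero _).2 (hf w)

/-! #### The duality for cochains -/

/-- The duality `Hom(⋀ᵐ𝔲, M)^* ⊗ ⋀^N𝔲^* → Hom(⋀ⁿ𝔲, M^*)` for `N = n + m`. -/
def poincareTensor (M : PreModule p) {n m N : ℕ} (h : n + m = N) :
    ((M.cochain m).fullDual.tensor ((triv p).cochain N)).V →ₗ[ℂ] (M.fullDual.cochain n).V :=
  TensorProduct.lift (LinearMap.mk₂ ℂ
    (fun (φ : (M.cochain m).fullDual.V) (f : ((triv p).cochain N).V) =>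
      (poincareLM (U := p.nilRad) M.V h φ (scalarForm p N f) : (M.fullDual.cochain n).V))
    (fun φ φ' _ => LinearMap.congr_fun (map_add (poincareLM (U := p.nilRad) M.V h) φ φ') _)
    (fun c φ _ => LinearMap.congr_fun (map_smul (poincareLM (U := p.nilRad) M.V h) c φ) _)
    (fun φ f f' => (congrArg (poincareLM (U := p.nilRad) M.V h φ) (map_add _ f f')).trans
      (map_add (poincareLM (U := p.nilRad) M.V h φ) _ _))
    (fun c φ f => (congrArg (poincareLM (U := p.nilRad) M.V h φ) (map_smul _ c f)).trans
      (map_smul (poincareLM (U := p.nilRad) M.V h φ) _ _)))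

theorem poincareTensor_isHom (M : PreModule p) {n m N : ℕ} (h : n + m = N) :
    IsHom ((M.cochain m).fullDual.tensor ((triv p).cochain N)) (M.fullDual.cochain n)
      (poincareTensor M h) := by
  refine IsHom.of_tmul (fun x φ η => ?_) fun k φ η => ?_
  · have h1 := CE.act_poincare (I := p.nilRad) (V := M.V) M.lie (scalarForm p N η) h x φ
    rw [← scalarForm_lie] at h1
    exact h1.symm
  · exact (CE.twist_poincare (I := p.nilRad) (V := M.V) (p.actRad k⁻¹) (p.actRad k⁻¹⁻¹)
      (fun x => Subtype.ext (p.act_inv_act k⁻¹ x)) (M.rep k⁻¹) (scalarForm p N η) h φ).symm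

theorem poincare_scalarForm_bijective (M : PreModule p) {n m N : ℕ}
    (hN : Module.finrank ℂ p.nilRad = N) (h : n + m = N) {τ : ((triv p).cochain N).V}
    (h0 : τ ≠ 0) :
    Function.Bijective (poincare (U := p.nilRad) (V := M.V) (scalarForm p N τ) h) := by
  refine poincare_bijective h hN fun h2 => h0 (scalarForm_injective N ?_)
  rw [h2, map_zero]

theorem poincareTensor_bijective (M : PreModule p) {n m N : ℕ}
    (hN : Module.finrank ℂ p.nilRad = N) (h : n + m = N) :
    Function.Bijective (poincareTensor M h) := by
  obtain ⟨τ, h0, hτ⟩ := exists_topForm hN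
  have h1 := tmulRight_injective (X := (M.cochain m).fullDual) h0
  have h2 := tmulRight_surjective (X := (M.cochain m).fullDual) hτ
  have h3 := poincare_scalarForm_bijective M hN h h0
  refine ⟨fun s t hst => ?_, fun f => ?_⟩
  · obtain ⟨φ, rfl⟩ := h2 s
    obtain ⟨ψ, rfl⟩ := h2 t
    exact congrArg (tmulRight (M.cochain m).fullDual τ) (h3.1 hst)
  · obtain ⟨φ, hφ⟩ := h3.2 f
    exact ⟨tmul (N := (triv p).cochain N) (M := (M.cochain m).fullDual) φ τ, hφ⟩

/-- The duality of cochains restricts to locally finite duals. Since it is an equivariant bijection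
for the full duals, it identifies the `H`-finite elements on both sides. On the left these are
`Hom(⋀ᵐ𝔲, M)^* ⊗ ⋀^N𝔲^*`, because `⋀^N𝔲^*` is a line, and on the right they are the cochains with
`H`-finite values. -/
theorem exists_poincareDual (M : PreModule p) {n m N : ℕ} (hN : Module.finrank ℂ p.nilRad = N)
    (h : n + m = N) :
    ∃ D : ((M.cochain m).dual.tensor ((triv p).cochain N)).V →ₗ[ℂ] (M.dual.cochain n).V,
      IsHom ((M.cochain m).dual.tensor ((triv p).cochain N)) (M.dual.cochain n) D ∧
      Function.Bijective D ∧ ∀ t, cochainMap M.dualι n (D t) =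
        poincareTensor M h (rMap ((triv p).cochain N) (M.cochain m).dualι t) := by
  obtain ⟨τ, h0, hτ⟩ := exists_topForm hN
  have hP := poincareTensor_isHom M h
  have hPb := poincareTensor_bijective M hN h
  have hι := cochainMap_isHom M.dualι_isHom n
  have hι' := cochainMap_injective M.dualι_injective n
  have hr := (M.cochain m).dualι_isHom.rMap ((triv p).cochain N)
  have hr' := rMap_injective ((triv p).cochain N) (M.cochain m).dualι_injective
  obtain ⟨D, hD, e⟩ := hι.exists_lift hι' (hP.comp hr) fun t => by
    obtain ⟨φ, rfl⟩ := tmulRight_surjective hτ t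
    have hφ := finite_map (hP.comp hr) (finite_tmul ((M.cochain m).finite_dual φ) τ)
    exact exists_cochainMap_dualι fun w => finite_ev hφ w
  refine ⟨D, hD, ⟨fun s t hst => ?_, fun g => ?_⟩, e⟩
  · exact hr' (hPb.1 ((e s).symm.trans ((congrArg _ hst).trans (e t))))
  · obtain ⟨t, ht⟩ := hPb.2 (cochainMap M.dualι n g)
    obtain ⟨χ, rfl⟩ := tmulRight_surjective hτ t
    have h1 := finite_map hι (finite_cochain M.finite_dual n g)
    rw [← ht] at h1
    obtain ⟨φ, hφ⟩ := (M.cochain m).exists_dualForm χ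
      (finite_of_tmul_right h0 hτ (finite_of_map hP hPb.1 h1))
    refine ⟨tmul φ τ, hι' ((e _).trans (Eq.trans ?_ ht))⟩
    exact congrArg (fun χ => poincareTensor M h (tmulRight (M.cochain m).fullDual τ χ)) hφ

/-- The duality isomorphism `Hom(⋀ᵐ𝔲, M)^* ⊗ ⋀^N𝔲^* ≅ Hom(⋀ⁿ𝔲, M^*)` on locally finite duals, for
`N = dim 𝔲 = n + m`. -/
def poincareDual (M : PreModule p) {n m N : ℕ} (hN : Module.finrank ℂ p.nilRad = N)
    (h : n + m = N) :
    ((M.cochain m).dual.tensor ((triv p).cochain N)).V →ₗ[ℂ] (M.dual.cochain n).V :=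
  (M.exists_poincareDual hN h).choose

section

variable (M : PreModule p) {n m N : ℕ} (hN : Module.finrank ℂ p.nilRad = N)

theorem poincareDual_isHom (h : n + m = N) :
    IsHom ((M.cochain m).dual.tensor ((triv p).cochain N)) (M.dual.cochain n)
      (M.poincareDual hN h) := (M.exists_poincareDual hN h).choose_spec.1

theorem poincareDual_bijective (h : n + m = N) : Function.Bijective (M.poincareDual hN h) :=
  (M.exists_poincareDual hN h).choose_spec.2.1

theorem cochainMap_poincareDual (h : n + m = N) (φ : (M.cochain m).dual.V)
    (η : ((triv p).cochain N).V) : cochainMap M.dualι n (M.poincareDual hN h (tmul φ η)) =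
      poincare (U := p.nilRad) (V := M.V) (scalarForm p N η) h ((M.cochain m).dualForm φ) :=
  (M.exists_poincareDual hN h).choose_spec.2.2 (tmul φ η)

/-- The duality isomorphisms commute with the differentials up to sign. -/
theorem d_poincareDual (h : n + 1 + m = N) (h' : n + (m + 1) = N) (φ : (M.cochain (m + 1)).dual.V)
    (η : ((triv p).cochain N).V) : M.dual.d n (M.poincareDual hN h' (tmul φ η)) =
      (-1 : ℂ) ^ (n + 1) • M.poincareDual hN h (tmul (dualMap (M.d_isHom m) φ) η) := by
  refine cochainMap_injective M.dualι_injective (n + 1) ?_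
  rw [cochainMap_d M.dualι_isHom, map_smul, cochainMap_poincareDual, cochainMap_poincareDual]
  exact CE.d_poincare (I := p.nilRad) (V := M.V) M.lie (η := scalarForm p N η)
    (altDeriv_topForm hN η)
    (fun ψ => (M.subsingleton_cochain (n := N + 1) (by omega)).elim ψ 0) h h'
    ((M.cochain (m + 1)).dualForm φ)

variable {τ : ((triv p).cochain N).V}

/-- The dual of a coboundary condition: `φ ⊗ τ` corresponds to a cocycle if and only if `φ` vanishes
on the coboundaries. -/
theorem d_poincareDual_eq_zero_iff (h0 : τ ≠ 0) (h : n + m = N) (φ : (M.cochain m).dual.V) :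
    M.dual.d n (M.poincareDual hN h (tmul φ τ)) = 0 ↔
      ∀ z ∈ M.coboundaries m, (M.cochain m).dualForm φ z = 0 := by
  cases m with
  | zero =>
    have := M.dual.subsingleton_cochain (n := n + 1) (by omega)
    refine iff_of_true (Subsingleton.elim _ _) ?_
    rintro _ rfl
    exact map_zero _
  | succ m =>
    have h' : n + 1 + m = N := by omega
    rw [M.d_poincareDual hN h' h, smul_eq_zero_iff_right (by simp),
      map_eq_zero_iff _ (M.poincareDual_bijective hN h').1, ← tmulRight_apply,
      map_eq_zero_iff _ (tmulRight_injective h0)]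
    constructor
    · rintro h2 _ ⟨c, rfl⟩
      rw [← dualForm_dualMap (M.d_isHom m), h2, map_zero, LinearMap.zero_apply]
    · intro h2
      refine dual_ext fun c => ?_
      rw [dualForm_dualMap, h2 _ ⟨c, rfl⟩, map_zero, LinearMap.zero_apply]

/-- The dual of a cocycle condition: `φ ⊗ τ` corresponds to a coboundary if and only if `φ` vanishes
on the cocycles. -/
theorem poincareDual_mem_coboundaries_iff [IsTopologicalGroup p.grp] [CompactSpace p.grp]
    (hM : M.IsContinuous) (h0 : τ ≠ 0) (hτ : ∀ y : ((triv p).cochain N).V, ∃ c : ℂ, y = c • τ)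
    (h : n + m = N) (φ : (M.cochain m).dual.V) :
    M.poincareDual hN h (tmul φ τ) ∈ M.dual.coboundaries n ↔
      dualMap (M.cocycleι_isHom m) φ = 0 := by
  cases n with
  | zero =>
    have := M.subsingleton_cochain (n := m + 1) (by omega)
    have hs : Function.Surjective (M.cocycleι m) := fun z =>
      M.exists_cocycleι m (Subsingleton.elim _ _)
    rw [map_eq_zero_iff _ (dualMap_injective _ hs)]
    refine (Submodule.mem_bot ℂ).trans ?_
    rw [map_eq_zero_iff _ (M.poincareDual_bijective hN h).1, ← tmulRight_apply,
      map_eq_zero_iff _ (tmulRight_injective h0)]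
  | succ n =>
    have h' : n + (m + 1) = N := by omega
    constructor
    · rintro ⟨y, hy⟩
      obtain ⟨t, rfl⟩ := (M.poincareDual_bijective hN h').2 y
      obtain ⟨ψ, rfl⟩ := tmulRight_surjective hτ t
      rw [tmulRight_apply, M.d_poincareDual hN h h', ← map_smul, ← tmul_smul_left] at hy
      have h1 := tmulRight_injective h0 ((M.poincareDual_bijective hN h).1 hy)
      refine dual_ext fun z => ?_
      rw [dualForm_dualMap, ← h1, map_smul, LinearMap.smul_apply, dualForm_dualMap,
        M.d_cocycleι, map_zero, smul_zero, map_zero, LinearMap.zero_apply]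
    · intro h1
      obtain ⟨δ, hs, e⟩ := M.exists_shortExact_cochain m
      obtain ⟨ψ₀, hψ₀⟩ := exists_dualMap_eq hs.hom_right hs.surjective φ fun c hc => by
        obtain ⟨z, rfl⟩ := hs.mem_range_iff.1 hc
        rw [← dualForm_dualMap (M.cocycleι_isHom m), h1, map_zero, LinearMap.zero_apply]
      have hB : IsHom (M.coboundary (m + 1)) (M.cochain (m + 1)) (M.coboundaryι (m + 1)) :=
        (M.cochain (m + 1)).isHom_subtype _
      obtain ⟨ψ, hψ⟩ := exists_finite_extension (hM.cochain (m + 1)) hB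
        (M.coboundaryι_injective (m + 1)) ψ₀
      have h2 : dualMap (M.d_isHom m) ψ = φ := dual_ext fun c => by
        rw [dualForm_dualMap, ← hψ₀, dualForm_dualMap, ← hψ]
        exact congrArg _ (LinearMap.congr_fun e c).symm
      refine ⟨(-1 : ℂ) ^ (n + 1) • M.poincareDual hN h' (tmul ψ τ), ?_⟩
      rw [map_smul, M.d_poincareDual hN h h', h2, smul_smul, ← mul_pow]
      simp

/-- Poincaré duality for the cohomology of the nilpotent radical. The duality for cochains sends the
cocycles of `M^*` to functionals that vanish on coboundaries; restricted to the cocycles of `M`,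
these are the functionals on the cohomology. -/
theorem cohomology_dual_iso [IsTopologicalGroup p.grp] [CompactSpace p.grp] (hM : M.IsContinuous)
    (hN : Module.finrank ℂ p.nilRad = N) (h : n + m = N) : (M.dual.cohomology n).Iso
      ((M.cohomology m).dual.tensor ((triv p).cochain N)) := by
  obtain ⟨τ, h0, hτ⟩ := exists_topForm hN
  have hD := M.poincareDual_isHom hN h
  have hDb := M.poincareDual_bijective hN h
  obtain ⟨D', hD', eD⟩ := hD.exists_lift hDb.1 (IsHom.id _) hDb.2
  have hι := (dualMap_isHom (M.cocycleι_isHom m)).rMap ((triv p).cochain N)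
  have hπ := (dualMap_isHom (M.cohπ_isHom m)).rMap ((triv p).cochain N)
  have hπi := rMap_injective ((triv p).cochain N)
    (dualMap_injective (M.cohπ_isHom m) (M.cohπ_surjective m))
  -- the form on the cochains of degree `m` that corresponds to a cocycle `z` of `M^*`
  have key : ∀ z : (M.dual.cocycle n).V, ∃ φ : (M.cochain m).dual.V,
      D' (M.dual.cocycleι n z) = tmul φ τ ∧ M.poincareDual hN h (tmul φ τ) = M.dual.cocycleι n z :=
    fun z => by
      obtain ⟨φ, hφ⟩ := tmulRight_surjective hτ (D' (M.dual.cocycleι n z))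
      exact ⟨φ, hφ.symm, (congrArg _ hφ).trans (eD _)⟩
  obtain ⟨R, hR, eR⟩ := hπ.exists_lift hπi (hι.comp (hD'.comp (M.dual.cocycleι_isHom n)))
    fun z => by
      obtain ⟨φ, h1, h2⟩ := key z
      have h3 := (M.d_poincareDual_eq_zero_iff hN h0 h φ).1 (by rw [h2, M.dual.d_cocycleι])
      obtain ⟨r, hr⟩ := exists_dualMap_eq (M.cohπ_isHom m) (M.cohπ_surjective m)
        (dualMap (M.cocycleι_isHom m) φ) fun c hc => by
          rw [dualForm_dualMap]
          exact h3 _ ((M.cohπ_eq_zero_iff m c).1 hc)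
      refine ⟨tmul r τ, ?_⟩
      rw [LinearMap.comp_apply, LinearMap.comp_apply, h1, rMap_tmul, rMap_tmul, hr]
  have eR' : ∀ z, R z = 0 ↔ M.dual.cohπ n z = 0 := fun z => by
    obtain ⟨φ, h1, h2⟩ := key z
    rw [M.dual.cohπ_eq_zero_iff, ← h2, M.poincareDual_mem_coboundaries_iff hN hM h0 hτ h,
      ← map_eq_zero_iff _ hπi, eR, LinearMap.comp_apply, LinearMap.comp_apply, h1, rMap_tmul,
      ← tmulRight_apply, map_eq_zero_iff _ (tmulRight_injective h0)]
  -- a functional on `Hᵐ(𝔲; M)` extends from the cocycles to all cochains by averaging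
  have hRs : Function.Surjective R := fun t => by
    obtain ⟨r, rfl⟩ := tmulRight_surjective hτ t
    obtain ⟨φ, hφ⟩ := exists_finite_extension (hM.cochain m) (M.cocycleι_isHom m)
      (M.cocycleι_injective m) (dualMap (M.cohπ_isHom m) r)
    have h1 := (M.d_poincareDual_eq_zero_iff hN h0 h φ).2 fun c hc => by
      obtain ⟨i, -, ei⟩ := M.exists_shortExact_cocycle m
      have h2 : M.cocycleι m (i ⟨c, hc⟩) = c := LinearMap.congr_fun ei ⟨c, hc⟩
      have h3 := (M.cohπ_eq_zero_iff m (i ⟨c, hc⟩)).2 (by rw [h2]; exact hc)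
      rw [← h2, hφ, dualForm_dualMap, h3, map_zero]
    obtain ⟨z, hz⟩ := M.dual.exists_cocycleι n h1
    refine ⟨z, hπi ((eR z).trans ?_)⟩
    have h2 : D' (M.dual.cocycleι n z) = tmul φ τ := hDb.1 ((eD _).trans hz)
    have h3 : dualMap (M.cocycleι_isHom m) φ = dualMap (M.cohπ_isHom m) r := dual_ext hφ
    rw [LinearMap.comp_apply, LinearMap.comp_apply, h2, rMap_tmul, tmulRight_apply, rMap_tmul, h3]
  obtain ⟨ψ, hψ, eψ⟩ := (M.dual.cohπ_isHom n).exists_factor (M.dual.cohπ_surjective n) hR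
    fun z hz => (eR' z).2 hz
  refine Iso.of_bijective hψ ⟨(injective_iff_map_eq_zero ψ).2 fun y hy => ?_, fun t => ?_⟩
  · obtain ⟨z, rfl⟩ := M.dual.cohπ_surjective n y
    rw [eψ] at hy
    exact (eR' z).1 hy
  · obtain ⟨z, rfl⟩ := hRs t
    exact ⟨_, eψ z⟩

end

end PreModule

/-- Poincaré duality `Hⁿ(𝔲; V') ≅ Hᵐ(𝔲; V)^* ⊗ ⋀^d 𝔲^*` for `d = dim 𝔲 = m + n`. -/
theorem GermaneParabolic.coh_localDual_iso (Q : GermaneParabolic P)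
    {V : PreModule (Subpair.full P)} (hV : V.IsHC) {m n : ℕ} (h : m + n = Q.dimU) :
    (Q.coh n (Q.localDual V)).Iso (((Q.coh m (Q.toParab V)).dual).tensor (Q.extPow Q.dimU)) := by
  have : IsTopologicalGroup K := topologicalGroup_of_lieGroup 𝓘(ℝ, E) ∞
  have : CompactSpace Q.parab.grp := Q.compactSpace_leviGroup
  have : IsTopologicalGroup Q.parab.grp := inferInstance
  exact ((Q.toParab V).cohomology_dual_iso (hV.isContinuous_res Q.parab.le_full) rfl
    ((add_comm n m).trans h)).res Q.levi_le_parab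

/-! ### Algebraic characters -/

namespace GrothendieckGroup

variable {𝓒 : PreModule p → Prop}

/-- Finite expressions indexed by arbitrary finite types yield products. -/
theorem IsProduct.of_fintype {ι κ : Type*} [Fintype ι] [Fintype κ] {X Y Z : GrothendieckGroup 𝓒}
    (a : ι → ℤ) (b : κ → ℤ) (V : ι → {M // 𝓒 M}) (W : κ → {M // 𝓒 M})
    (h : ∀ i j, 𝓒 ((V i).1.tensor (W j).1)) (hX : X = ∑ i, a i • cls (V i).1 (V i).2)
    (hY : Y = ∑ j, b j • cls (W j).1 (W j).2)
    (hZ : Z = ∑ i, ∑ j, (a i * b j) • cls _ (h i j)) : IsProduct X Y Z := by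
  let e := (Fintype.equivFin ι).symm
  let f := (Fintype.equivFin κ).symm
  refine ⟨_, _, a ∘ e, b ∘ f, V ∘ e, W ∘ f, fun i j => h _ _, ?_, ?_, ?_⟩
  · rw [hX]; exact (e.sum_comp _).symm
  · rw [hY]; exact (f.sum_comp _).symm
  · rw [hZ, ← e.sum_comp]
    exact Finset.sum_congr rfl fun i _ => (f.sum_comp _).symm

/-- Finite expressions indexed by arbitrary finite types yield duals. -/
theorem IsDual.of_fintype {ι : Type*} [Fintype ι] {X Y : GrothendieckGroup 𝓒}
    (a : ι → ℤ) (V : ι → {M // 𝓒 M}) (h : ∀ i, 𝓒 (V i).1.dual)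
    (hX : X = ∑ i, a i • cls (V i).1 (V i).2) (hY : Y = ∑ i, a i • cls _ (h i)) : IsDual X Y := by
  let e := (Fintype.equivFin ι).symm
  refine ⟨_, a ∘ e, V ∘ e, fun i => h _, ?_, ?_⟩
  · rw [hX]; exact (e.sum_comp _).symm
  · rw [hY]; exact (e.sum_comp _).symm

end GrothendieckGroup

namespace AdmissiblePair

open GrothendieckGroup

variable {Q : GermaneParabolic P} (A : AdmissiblePair Q)

theorem mulW_apply (C : GrothendieckGroup A.ℒ) : A.mulW C =
    ∑ n ∈ Finset.range (Module.finrank ℂ Q.parab.nilRad + 1), (-1 : ℤ) ^ n • A.mulExtPow n C := by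
  rw [mulW, AddMonoidHom.finsetSum_apply]
  rfl

theorem H_cls {V : PreModule (Subpair.full P)} (hV : A.𝒢 V) :
    A.H (cls V hV) = eulerChar Q.levi_le_parab A.ℒ (Q.toParab V) fun n => A.coh_mem n V hV :=
  lift_cls _ _ _ _

theorem H_cls_eq_sum {V : PreModule (Subpair.full P)} (hV : A.𝒢 V) :
    A.H (cls V hV) = ∑ n : Fin (Module.finrank ℂ Q.parab.nilRad + 1),
      (-1 : ℤ) ^ (n : ℕ) • cls _ (A.coh_mem n V hV) :=
  (A.H_cls hV).trans (Finset.sum_range _)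

/-- `H([V]) = W · [V]` if the restriction of `V` lies in `ℒ`. -/
theorem H_eq_mulW_res {V : PreModule (Subpair.full P)} (hV : A.𝒢 V)
    (hR : A.ℒ (V.res Q.levi.le_full)) : A.H (cls V hV) = A.mulW (cls _ hR) := by
  have hi : ∀ n, ((V.res Q.levi.le_full).tensor (Q.extPow n)).Iso
      (((Q.toParab V).cochain n).res Q.levi_le_parab) := fun n =>
    (cochain_iso_tensor (Q.toParab V) n).res Q.levi_le_parab
  have hC : ∀ n, A.ℒ (((Q.toParab V).cochain n).res Q.levi_le_parab) := fun n =>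
    A.abelian_ℒ.iso _ _ (hi n) (A.tensor_mem n _ hR)
  refine (A.H_cls hV).trans ((sum_cls_cochain_eq_eulerChar A.abelian_ℒ _ hC _).symm.trans ?_)
  rw [mulW_apply]
  refine Finset.sum_congr rfl fun n _ => ?_
  rw [mulExtPow, tensorHom, lift_cls]
  exact congrArg _ (cls_eq_of_iso A.abelian_ℒ _ _ (hi n)).symm

theorem H_one : A.H A.one𝒢 = A.mulW A.oneℒ := by
  have hi : (triv Q.levi).Iso ((triv (Subpair.full P)).res Q.levi.le_full) :=
    ⟨LinearEquiv.refl ℂ _, ⟨fun _ _ => rfl, fun _ _ => rfl⟩⟩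
  have hR := A.abelian_ℒ.iso _ _ hi A.triv_levi_mem
  exact (A.H_eq_mulW_res A.triv_mem hR).trans
    (congrArg A.mulW (cls_eq_of_iso A.abelian_ℒ _ _ hi).symm)

theorem H_of_isRestriction {X : GrothendieckGroup A.𝒢} {R : GrothendieckGroup A.ℒ}
    (h : IsRestriction Q.levi.le_full X R) : A.H X = A.mulW R := by
  obtain ⟨m, a, V, hV, rfl, rfl⟩ := h
  simp only [map_sum, map_zsmul, A.H_eq_mulW_res _ (hV _)]

/-- `W_𝔮 · H([V ⊗ W]) = H([V]) · H([W])`. -/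
theorem mulW_H_cls_tensor (hA : A.IsMultiplicative) {V W : PreModule (Subpair.full P)}
    (hV : A.𝒢 V) (hW : A.𝒢 W) (hVW : A.𝒢 (V.tensor W)) :
    A.mulW (A.H (cls _ hVW)) =
      ∑ m : Fin (Module.finrank ℂ Q.parab.nilRad + 1),
        ∑ n : Fin (Module.finrank ℂ Q.parab.nilRad + 1),
          ((-1 : ℤ) ^ (m : ℕ) * (-1 : ℤ) ^ (n : ℕ)) • cls _ (hA V W hV hW hVW m n) := by
  have h := sum_eulerChar_tensor (hr := Q.levi_le_parab) A.abelian_ℒ A.tensor_mem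
    (Q.toParab V) (Q.toParab W) (fun n => A.coh_mem n _ hVW) (hA V W hV hW hVW)
  rw [H_cls, mulW_apply]
  refine h.trans ?_
  rw [Finset.sum_range, Finset.sum_comm]
  refine Finset.sum_congr rfl fun n _ => ?_
  rw [Finset.sum_range, Finset.smul_sum]
  refine Finset.sum_congr rfl fun m _ => ?_
  rw [smul_smul, mul_comm]
  rfl

/-- If `Z` is a product of `X` and `Y`, then `W · H(Z)` is a product of `H(X)` and `H(Y)`. -/
theorem H_isProduct (hA : A.IsMultiplicative) {X Y Z : GrothendieckGroup A.𝒢}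
    (h : IsProduct X Y Z) : IsProduct (A.H X) (A.H Y) (A.mulW (A.H Z)) := by
  obtain ⟨m, n, a, b, V, W, hVW, rfl, rfl, rfl⟩ := h
  refine IsProduct.of_fintype
    (ι := Fin m × Fin (Module.finrank ℂ Q.parab.nilRad + 1))
    (κ := Fin n × Fin (Module.finrank ℂ Q.parab.nilRad + 1))
    (fun i => a i.1 * (-1) ^ (i.2 : ℕ)) (fun j => b j.1 * (-1) ^ (j.2 : ℕ))
    (fun i => ⟨_, A.coh_mem i.2 _ (V i.1).2⟩) (fun j => ⟨_, A.coh_mem j.2 _ (W j.1).2⟩)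
    (fun i j => hA _ _ (V i.1).2 (W j.1).2 (hVW _ _) _ _) ?_ ?_ ?_
  · simp only [map_sum, map_zsmul, H_cls_eq_sum, Fintype.sum_prod_type, mul_smul, Finset.smul_sum]
  · simp only [map_sum, map_zsmul, H_cls_eq_sum, Fintype.sum_prod_type, mul_smul, Finset.smul_sum]
  · simp only [map_sum, map_zsmul, Fintype.sum_prod_type, Finset.smul_sum,
      A.mulW_H_cls_tensor hA (V _).2 (W _).2]
    refine Finset.sum_congr rfl fun i _ => ?_
    rw [Finset.sum_comm]
    refine Finset.sum_congr rfl fun k _ => Finset.sum_congr rfl fun j _ =>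
      Finset.sum_congr rfl fun l _ => ?_
    rw [smul_smul]
    congr 1
    ring

/-- The alternating sums for `V^*` and `V'` agree, since that of `V' / V^*` vanishes. -/
theorem H_cls_dual_eq_eulerChar (hA : A.HasDuality) {V : PreModule (Subpair.full P)} (hV : A.𝒢 V)
    (hV' : A.𝒢 V.dual) : A.H (cls _ hV') =
      eulerChar Q.levi_le_parab A.ℒ (Q.localDual V) (hA.coh_dual_mem V hV hV') := by
  have hi₀ : ∀ φ ∈ V.fullDual.finiteVectors, φ ∈ (Q.toParab V).fullDual.finiteVectors := by
    intro φ hφ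
    have : FiniteDimensional ℂ (V.fullDual.orbitSpan φ) := hφ
    exact @Submodule.finiteDimensional_of_le ℂ V.fullDual.V _ _ _ _ _ this
      ((Q.toParab V).fullDual.orbitSpan_le fun k =>
        V.fullDual.rep_mem_orbitSpan (Subgroup.inclusion Q.parab.le_full.2 k) φ)
  let i : (Q.toParab V.dual).V →ₗ[ℂ] (Q.localDual V).V := Submodule.inclusion hi₀
  have hs := (Q.localDual V).shortExact_sub_quot _ (Q.stable_dualSub V)
  have hi : IsShortExact (Q.toParab V.dual) (Q.localDual V) (Q.dualQuot V) i
      (Q.dualSub V).mkQ :=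
    .of_forall ⟨fun _ _ => rfl, fun _ _ => rfl⟩ hs.hom_right (Submodule.inclusion_injective hi₀)
      hs.surjective (fun a => hs.mem_range_iff.2 ⟨⟨i a, a.2⟩, rfl⟩) fun b hb => by
        obtain ⟨a, rfl⟩ := hs.mem_range_iff.1 hb
        exact ⟨⟨a.1.1, a.2⟩, rfl⟩
  have h := eulerChar_add Q.levi_le_parab A.abelian_ℒ (fun n => A.coh_mem n _ hV')
    (hA.coh_dual_mem V hV hV') (hA.coh_quot_mem V hV hV') hi
  exact (A.H_cls hV').trans ((h.trans (congrArg _ (hA.eulerChar_quot V hV hV'))).trans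
    (add_zero _)).symm

/-- `H([V^*]) = (-1)^d [⋀^d𝔲^*] · ∑ₙ (-1)ⁿ [Hⁿ(𝔲; V)^*]`, by Poincaré duality for `V'`. -/
theorem H_cls_dual (hA : A.HasDuality) {V : PreModule (Subpair.full P)} (hV : A.𝒢 V)
    (hV' : A.𝒢 V.dual) : A.H (cls _ hV') = A.mulTop
      (∑ n : Fin (Module.finrank ℂ Q.parab.nilRad + 1),
        (-1 : ℤ) ^ (n : ℕ) • cls _ (hA.dual_coh_mem V hV hV' n)) := by
  refine (A.H_cls_dual_eq_eulerChar hA hV hV').trans ((Finset.sum_range_reflect _ _).symm.trans ?_)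
  rw [Finset.sum_range, map_sum]
  refine Finset.sum_congr rfl fun n _ => ?_
  have hn : (n : ℕ) + (Module.finrank ℂ Q.parab.nilRad + 1 - 1 - n) = Q.dimU := by
    have := n.2
    unfold GermaneParabolic.dimU
    omega
  have hi := Q.coh_localDual_iso (A.abelian_𝒢.isHC V hV) hn
  rw [map_zsmul, mulTop, AddMonoidHom.smul_apply, mulExtPow, tensorHom, lift_cls, smul_smul,
    ← pow_add]
  refine congrArg₂ _ ?_ (cls_eq_of_iso A.abelian_ℒ _ _ hi)
  rw [← hn, ← add_assoc, pow_add, ← two_mul, pow_mul, neg_one_sq, one_pow, one_mul]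

theorem H_isDual (hA : A.HasDuality) {X Y : GrothendieckGroup A.𝒢} (h : IsDual X Y) :
    ∃ T, IsDual (A.H X) T ∧ A.H Y = A.mulTop T := by
  obtain ⟨m, a, V, hV, rfl, rfl⟩ := h
  refine ⟨_, IsDual.of_fintype
    (ι := Fin m × Fin (Module.finrank ℂ Q.parab.nilRad + 1))
    (fun i => a i.1 * (-1) ^ (i.2 : ℕ)) (fun i => ⟨_, A.coh_mem i.2 _ (V i.1).2⟩)
    (fun i => hA.dual_coh_mem _ (V i.1).2 (hV i.1) i.2) ?_ rfl, ?_⟩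
  · simp only [map_sum, map_zsmul, H_cls_eq_sum, Fintype.sum_prod_type, mul_smul, Finset.smul_sum]
  · simp only [map_sum, map_zsmul, Fintype.sum_prod_type, mul_smul,
      A.H_cls_dual hA (V _).2 (hV _), Finset.smul_sum]

/-- `(W · C) / Wⁿ⁺¹ = C / Wⁿ`. -/
theorem frac_mulW (C : GrothendieckGroup A.ℒ) (n : ℕ) : A.frac (A.mulW C) (n + 1) = A.frac C n := by
  rw [frac_eq_frac_iff]
  refine ⟨0, ?_⟩
  rw [zero_add, zero_add, Function.iterate_succ_apply]

end AdmissiblePair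

namespace AdmissibleQuadruple

variable {Q : GermaneParabolic P} (𝒬 : AdmissibleQuadruple Q)

theorem char_add (X Y : 𝒬.K𝒢) : 𝒬.char (X + Y) = 𝒬.char X + 𝒬.char Y := by
  refine Subtype.ext ?_
  change 𝒬.frac (𝒬.H (X + Y)) 1 = 𝒬.frac (𝒬.H X) 1 + 𝒬.frac (𝒬.H Y) 1
  rw [AdmissiblePair.frac_add, Function.iterate_one, ← map_add, ← map_add, 𝒬.frac_mulW]

end AdmissibleQuadruple

end AlgChar

end

theorem theorem1p4 {E : Type*} {K : Type*} {𝔤₀ : Type*}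
    [NormedAddCommGroup E] [NormedSpace ℝ E] [FiniteDimensional ℝ E]
    [TopologicalSpace K] [ChartedSpace E K] [Group K]
    [LieGroup (modelWithCornersSelf ℝ E) (((⊤ : ℕ∞) : WithTop ℕ∞)) K]
    [CompactSpace K] [T2Space K]
    [LieRing 𝔤₀] [LieAlgebra ℝ 𝔤₀] [FiniteDimensional ℝ 𝔤₀]
    (P : AlgChar.ReductivePair E K 𝔤₀) (Q : AlgChar.GermaneParabolic P)
    (𝒬 : AlgChar.AdmissibleQuadruple Q) :
    -- `c` is a group homomorphism
    (∀ X Y : 𝒬.K𝒢, 𝒬.char (X + Y) = 𝒬.char X + 𝒬.char Y) ∧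
    -- `c([ℂ]) = [ℂ]`
    (∀ h : 𝒬.one𝒢 ∈ 𝒬.K𝒢, (𝒬.char ⟨𝒬.one𝒢, h⟩ : 𝒬.Loc) = 𝒬.frac 𝒬.oneℒ 0) ∧
    -- `c(X) = [X]` if the restriction of `X` lies in `K_ℒ`
    (∀ X : 𝒬.K𝒢, ∀ R ∈ 𝒬.Kℒ,
      AlgChar.GrothendieckGroup.IsRestriction Q.levi.le_full (X : AlgChar.GrothendieckGroup 𝒬.𝒢) R →
      (𝒬.char X : 𝒬.Loc) = 𝒬.frac R 0) ∧
    -- `c(X Y) = c(X) c(Y)`, where `c(X) c(Y) = H(X) H(Y) / W²`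
    (𝒬.IsMultiplicative → ∀ X Y Z : 𝒬.K𝒢,
      AlgChar.GrothendieckGroup.IsProduct (X : AlgChar.GrothendieckGroup 𝒬.𝒢) Y Z →
      𝒬.IsCharProduct (𝒬.char X) (𝒬.char Y) (𝒬.char Z) ∧
      ∃ S ∈ 𝒬.Kℒ, AlgChar.GrothendieckGroup.IsProduct (𝒬.H X) (𝒬.H Y) S ∧
        (𝒬.char Z : 𝒬.Loc) = 𝒬.frac S 2) ∧
    -- `c(X^*) = c(X)^*`, where `c(X)^* = H(X)^* / W^* = ε H(X)^* / W`
    (𝒬.HasDuality → ∀ X Y : 𝒬.K𝒢,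
      AlgChar.GrothendieckGroup.IsDual (X : AlgChar.GrothendieckGroup 𝒬.𝒢) Y →
      𝒬.IsCharDual (𝒬.char X) (𝒬.char Y) ∧
      ∃ T, AlgChar.GrothendieckGroup.IsDual (𝒬.H X) T ∧
        (𝒬.char Y : 𝒬.Loc) = 𝒬.frac (𝒬.mulTop T) 1) := by
  refine ⟨𝒬.char_add, fun h => ?_, fun X R _ hR => ?_, fun hQ X Y Z h => ?_, fun hQ X Y h => ?_⟩
  · exact (congrArg (𝒬.frac · 1) 𝒬.H_one).trans (𝒬.frac_mulW _ 0)
  · exact (congrArg (𝒬.frac · 1) (𝒬.H_of_isRestriction hR)).trans (𝒬.frac_mulW _ 0)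
  · have hS := 𝒬.W_mem _ (𝒬.H_mem Z Z.2)
    have hP := 𝒬.H_isProduct hQ.pair h
    have hc := (𝒬.frac_mulW (𝒬.H Z) 1).symm
    exact ⟨⟨_, 𝒬.H_mem X X.2, _, 𝒬.H_mem Y Y.2, _, hS, 1, 1, rfl, rfl, hP, hc⟩, _, hS, hP, hc⟩
  · obtain ⟨T, hT, e⟩ := 𝒬.H_isDual hQ.pair h
    have hc : (𝒬.char Y : 𝒬.Loc) = 𝒬.frac (𝒬.mulTop T) 1 := congrArg (𝒬.frac · 1) e
    exact ⟨⟨_, 𝒬.H_mem X X.2, T, 1, rfl, hT, hc⟩, T, hT, hc⟩
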